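/- Let $\mathbb T=\{z\in\mathbb C:|z|=1\}$, $\overline{\mathbb D}=\{w\in\mathbb C:|w|\le 1\}$, and let $d\sigma=\frac{|dz|\,|dw|}{(2\pi)^2}$ be normalized Lebesgue measure on $\mathbb T^2$. For integers $n,m\ge 0$ let $\mathcal L_{n,m}$ be the complex span of the monomials $z^sw^t$ with $|s|\le n$, $|t|\le m$, and for integers $j,k$ let $\mathcal P_{j,k}$ be the complex span of the monomials $z^sw^t$ with $0\le s\le j$, $0\le t\le k$ (so $\mathcal P_{j,k}=\{0\}$ if $j<0$ or $k<0$). A linear form $\mathcal T:\mathcal L_{n,m}\to\mathbb C$ is called positive if $\mathcal T\big(f(z,w)\bar f(1/z,1/w)\big)>0$ for every nonzero $f\in\mathcal P_{n,m}$, where $\bar f(z,w)=\overline{f(\bar z,\bar w)}$; it then defines on $\mathcal P_{n,m}$ the inner product $\langle f,g\rangle_{\mathcal T}=\mathcal T\big(f(z,w)\bar g(1/z,1/w)\big)$, to which $\perp$, $\oplus$ (orthogonal direct sum) and $\ominus$ refer. For $k\le n$, $l\le m$ put $\mathcal E^1_{k,l}=\mathcal P_{k,l}\ominus w\mathcal P_{k,l-1}$.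 A positive linear form $\mathcal T$ on $\mathcal L_{n,m}$ satisfies the split-shift orthogonality condition if there are subspaces $\mathcal K_1,\mathcal K_2\subset\mathcal P_{n,m}$ such that (1) $\mathcal E^1_{n-1,m}=\mathcal K_1\oplus\mathcal K_2$, (2) $\mathcal K_1\perp z\mathcal K_2$, and (3) $\mathcal K_1\subset\mathcal E^1_{n,m}$ and $z\mathcal K_2\subset\mathcal E^1_{n,m}$. **Theorem.** Let $n,m\ge 0$ and let $t(z,w)=\sum_{j=-n}^{n}\sum_{k=-m}^{m}t_{jk}z^jw^k$, with $t_{jk}\in\mathbb C$, satisfy $t(z,w)>0$ for all $(z,w)\in\mathbb T^2$. Let $\mathcal T$ be the linear form on $\mathcal L_{n,m}$ given by $$\mathcal T(z^jw^k)=\int_{\mathbb T^2}\frac{z^jw^k}{t(z,w)}\,d\sigma,\qquad |j|\le n,\ |k|\le m .$$ Then $\mathcal T$ is positive. Moreover, there exists $p\in\mathbb C[z,w]$, of degree at most $n$ in $z$ and at most $m$ in $w$, with no zeros on $\mathbb T\times\overline{\mathbb D}$ and such that $t=|p|^2$ on $\mathbb T^2$, if and only if $\mathcal T$ satisfies the split-shift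 orthogonality condition. -/

import Mathlib

open scoped ComplexOrder ComplexConjugate

noncomputable section

namespace SplitShift

/-- Laurent polynomials in `z, w` with complex coefficients; the exponent `(s, t) : ℤ × ℤ`
stands for `z ^ s * w ^ t`. -/
abbrev Laurent : Type := AddMonoidAlgebra ℂ (ℤ × ℤ)

/-- The monomial `z ^ s * w ^ t`. -/
def mono (s t : ℤ) : Laurent := AddMonoidAlgebra.single (s, t) 1

/-- The value `f(z, w)`. -/
def evalAt (f : Laurent) (z w : ℂ) : ℂ := f.coeff.sum fun e c => c * (z ^ e.1 * w ^ e.2)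

/-- `𝓛_{n,m}`, the span of the `z ^ s * w ^ t` with `|s| ≤ n`, `|t| ≤ m`. -/
def laurentSpace (n m : ℕ) : Submodule ℂ Laurent :=
  Submodule.span ℂ {f | ∃ s t : ℤ, |s| ≤ n ∧ |t| ≤ m ∧ f = mono s t}

/-- `𝓟_{j,k}`, the span of the `z ^ s * w ^ t` with `0 ≤ s ≤ j`, `0 ≤ t ≤ k`; it is `{0}` if
`j < 0` or `k < 0`. -/
def polySpace (j k : ℤ) : Submodule ℂ Laurent :=
  Submodule.span ℂ {f | ∃ s t : ℤ, 0 ≤ s ∧ s ≤ j ∧ 0 ≤ t ∧ t ≤ k ∧ f = mono s t}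

/-- `f ↦ f̄(1/z, 1/w)`: conjugate the coefficients and negate the exponents. -/
def starRefl : Laurent →ₗ⋆[ℂ] Laurent where
  toFun f := AddMonoidAlgebra.ofCoeff
    (Finsupp.equivMapDomain (Equiv.neg (ℤ × ℤ)) (f.coeff.mapRange conj (map_zero _)))
  map_add' f g := by
    ext e
    simp [Finsupp.equivMapDomain_apply]
  map_smul' c f := by
    ext e
    simp [Finsupp.equivMapDomain_apply]

theorem starRefl_mono (s t : ℤ) : starRefl (mono s t) = mono (-s) (-t) := by
  ext e
  simp [starRefl, mono, Finsupp.equivMapDomain_single]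

theorem mul_mono (s t s' t' : ℤ) : mono s t * mono s' t' = mono (s + s') (t + t') := by
  simp [mono, AddMonoidAlgebra.single_mul_single]

theorem mul_starRefl_mem {n m : ℕ} {f g : Laurent} (hf : f ∈ polySpace n m)
    (hg : g ∈ polySpace n m) : f * starRefl g ∈ laurentSpace n m := by
  induction hf using Submodule.span_induction with
  | zero => simp
  | add x y _ _ hx hy => rw [add_mul]; exact add_mem hx hy
  | smul c x _ hx => rw [smul_mul_assoc]; exact Submodule.smul_mem _ _ hx
  | mem x hx =>
    obtain ⟨s, t, hs, hs', ht, ht', rfl⟩ := hx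
    induction hg using Submodule.span_induction with
    | zero => simp
    | add x y _ _ hx hy => rw [map_add, mul_add]; exact add_mem hx hy
    | smul c x _ hx =>
      rw [LinearMap.map_smulₛₗ, mul_smul_comm]; exact Submodule.smul_mem _ _ hx
    | mem y hy =>
      obtain ⟨s', t', hu, hu', hv, hv', rfl⟩ := hy
      rw [starRefl_mono, mul_mono]
      exact Submodule.subset_span ⟨_, _, by rw [abs_le]; omega, by rw [abs_le]; omega, rfl⟩

variable {n m : ℕ}

/-- `⟨f, g⟩ = 𝒯(f(z,w) ḡ(1/z,1/w))` for `f, g ∈ 𝓟_{n,m}`. -/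
def ip (T : laurentSpace n m →ₗ[ℂ] ℂ) (f g : polySpace n m) : ℂ :=
  T ⟨(f : Laurent) * starRefl g, mul_starRefl_mem f.2 g.2⟩

/-- Positive linear form on `𝓛_{n,m}` (in particular `⟨f, f⟩` is real). -/
def IsPositive (T : laurentSpace n m →ₗ[ℂ] ℂ) : Prop :=
  ∀ f : polySpace n m, f ≠ 0 → 0 < ip T f f

theorem ip_add_left (T : laurentSpace n m →ₗ[ℂ] ℂ) (f f' g : polySpace n m) :
    ip T (f + f') g = ip T f g + ip T f' g := by
  simp only [ip, ← map_add]
  congr 1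
  ext1
  simp [add_mul]

theorem ip_smul_left (T : laurentSpace n m →ₗ[ℂ] ℂ) (c : ℂ) (f g : polySpace n m) :
    ip T (c • f) g = c * ip T f g := by
  rw [← smul_eq_mul, ip, ip, ← map_smul]
  congr 1
  ext1
  simp

/-- `K ⟂ K'`. -/
def Orth (T : laurentSpace n m →ₗ[ℂ] ℂ) (K K' : Submodule ℂ (polySpace n m)) : Prop :=
  ∀ f ∈ K, ∀ g ∈ K', ip T f g = 0

/-- `K ⊖ K' = {f ∈ K : f ⟂ K'}`. -/
def ominus (T : laurentSpace n m →ₗ[ℂ] ℂ) (K K' : Submodule ℂ (polySpace n m)) :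
    Submodule ℂ (polySpace n m) where
  carrier := {f | f ∈ K ∧ ∀ g ∈ K', ip T f g = 0}
  zero_mem' := ⟨K.zero_mem, fun g _ => by simpa using ip_smul_left T 0 0 g⟩
  add_mem' := fun ha hb => ⟨K.add_mem ha.1 hb.1, fun g hg => by
    rw [ip_add_left, ha.2 g hg, hb.2 g hg, add_zero]⟩
  smul_mem' := fun c f hf => ⟨K.smul_mem c hf.1, fun g hg => by
    rw [ip_smul_left, hf.2 g hg, mul_zero]⟩

/-- A space of Laurent polynomials, seen inside `𝓟_{n,m}` (used for subspaces of `𝓟_{n,m}`). -/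
def inside (n m : ℕ) (V : Submodule ℂ Laurent) : Submodule ℂ (polySpace n m) :=
  V.comap (polySpace n m).subtype

/-- `q V = {q f : f ∈ V}`. -/
def times (q : Laurent) (V : Submodule ℂ Laurent) : Submodule ℂ Laurent :=
  V.map (LinearMap.mulLeft ℂ q)

/-- `z K` for a subspace `K` of `𝓟_{n,m}` with `z K ⊆ 𝓟_{n,m}` (as for `K ⊆ 𝓟_{n-1,m}`). -/
def zTimes (K : Submodule ℂ (polySpace n m)) : Submodule ℂ (polySpace n m) :=
  inside n m (times (mono 1 0) (K.map (polySpace n m).subtype))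

/-- `𝓔¹_{k,l} = 𝓟_{k,l} ⊖ w 𝓟_{k,l-1}`, for `k ≤ n` and `l ≤ m`. -/
def E1 (T : laurentSpace n m →ₗ[ℂ] ℂ) (k l : ℤ) : Submodule ℂ (polySpace n m) :=
  ominus T (inside n m (polySpace k l)) (inside n m (times (mono 0 1) (polySpace k (l - 1))))

/-- The split-shift orthogonality condition for a form `T` on `𝓛_{n,m}`: there are `K₁, K₂` with
`𝓔¹_{n-1,m} = K₁ ⊕ K₂` (orthogonal sum), `K₁ ⟂ z K₂` and `K₁, z K₂ ⊆ 𝓔¹_{n,m}`. -/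
def SplitShiftCondition (T : laurentSpace n m →ₗ[ℂ] ℂ) : Prop :=
  ∃ K₁ K₂ : Submodule ℂ (polySpace n m),
    (E1 T (n - 1) m = K₁ ⊔ K₂ ∧ Disjoint K₁ K₂ ∧ Orth T K₁ K₂) ∧
    Orth T K₁ (zTimes K₂) ∧
    K₁ ≤ E1 T n m ∧ zTimes K₂ ≤ E1 T n m

/-- `∫_{𝕋²} g dσ` for the normalized Lebesgue measure `dσ = |dz| |dw| / (2π)²`. -/
def torusAverage (g : ℂ → ℂ → ℂ) : ℂ :=
  ((2 * Real.pi) ^ 2 : ℂ)⁻¹ * ∫ θ in (0 : ℝ)..(2 * Real.pi), ∫ φ in (0 : ℝ)..(2 * Real.pi),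
    g (Complex.exp (θ * Complex.I)) (Complex.exp (φ * Complex.I))

/-- The linear form on `𝓛_{n,m}` with `z ^ j * w ^ k ↦ ∫_{𝕋²} z ^ j * w ^ k / t dσ`. -/
def momentForm (n m : ℕ) (t : Laurent) : laurentSpace n m →ₗ[ℂ] ℂ :=
  (Finsupp.linearCombination ℂ (fun e : ℤ × ℤ =>
      torusAverage fun z w => z ^ e.1 * w ^ e.2 / evalAt t z w) ∘ₗ
    (AddMonoidAlgebra.coeffLinearEquiv ℂ).toLinearMap).domRestrict (laurentSpace n m)

end SplitShift

end

noncomputable section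

namespace SplitShift

open Real (circleAverage)

/-! ### Laurent polynomials and their values on the torus -/

/-! The weight 1/t turns the Laurent polynomials into an inner product space on which multiplication
by z and by w is unitary, and 𝒯 induces its restriction to 𝓟_{n,m}; positivity of 𝒯 follows at once.
Both implications rest on one-variable Christoffel–Darboux theory on the fibres z = const, |z| = 1.
From a split pair to p: by dimension, 𝓔¹_{n,m} is spanned by K₁ ⊕ z K₂ and one further unit vector
p. On a fibre the reproducing kernels of K₂ and z K₂ coincide, so the kernels of 𝓔¹_{n,m} and
𝓔¹_{n-1,m} differ by that of p alone. Together with its reflection this gives, for X = 𝓟_{n,m-1} ⊖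
𝓟_{n-1,m-1}, the formula (1 - w w̄₁) X(w,w₁) = p(w) conj p(w₁) - p*(w) conj p*(w₁), where p* is p
reversed in w (`SplitPair.kern_identity`, `SplitPair.kern_identity'`). Positivity of kernels then
excludes zeros of p on 𝕋 × 𝔻̄ (`SplitPair.evalAt_ne_zero`), and the formula makes an orthonormal
basis of X orthonormal on every fibre for s = |p|² (`Factors.fibre_orthonormal`). It remains to show
s = t. The inner products of weights 1/s and 1/t agree on X and p by construction. They are carried
to all of 𝓟_{n,m} by a contraction argument: if z^{±1} V ⊆ V ⊕ Y, the compression of this unitary to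
a finite-dimensional V has powers tending to 0, since it has no eigenvectors in the Laurent ring;
hence relations known on the shifts of Y propagate to V (`transfer_ipw_zero`, `transfer_ipw_eq`).
Equality of the moments forces s = t (`AgreeOn.eq`). From p to a split pair: let L be the span of
the z^j p and z^j `dualRest`, j ≤ -1 (`negSpan`). In the Hilbert space completion, K₁ and K₂ are the
parts of 𝓔¹_{n-1,m} in the closure of L and in L^⊥. They exhaust it because projecting off L leaves
a polynomial: L contains the dual polynomials that read off the coefficients of negative z-degree
(`exists_orthogonal_component`, `Factors.ipw_dualPoly`). The shift conditions come from z⁻¹ L ⊆ L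
(`Factors.exists_splitPair`). -/

theorem laurent_induction {motive : Laurent → Prop} (f : Laurent) (zero : motive 0)
    (add : ∀ f g, motive f → motive g → motive (f + g))
    (mono : ∀ (c : ℂ) (s t : ℤ), motive (c • mono s t)) : motive f := by
  induction f using AddMonoidAlgebra.induction_linear with
  | zero => exact zero
  | add f g hf hg => exact add f g hf hg
  | single e c =>
    have := mono c e.1 e.2
    rwa [SplitShift.mono, AddMonoidAlgebra.smul_single, smul_eq_mul, mul_one] at this

/-- `f ↦ f(z, w)` as a linear map. -/
def evLin (z w : ℂ) : Laurent →ₗ[ℂ] ℂ :=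
  Finsupp.linearCombination ℂ (fun e : ℤ × ℤ => z ^ e.1 * w ^ e.2) ∘ₗ
    (AddMonoidAlgebra.coeffLinearEquiv ℂ).toLinearMap

theorem evalAt_eq_evLin (f : Laurent) (z w : ℂ) : evalAt f z w = evLin z w f := by
  simp [evalAt, evLin, Finsupp.linearCombination_apply]

theorem evalAt_add (f g : Laurent) (z w : ℂ) :
    evalAt (f + g) z w = evalAt f z w + evalAt g z w := by simp [evalAt_eq_evLin]

theorem evalAt_sub (f g : Laurent) (z w : ℂ) :
    evalAt (f - g) z w = evalAt f z w - evalAt g z w := by simp [evalAt_eq_evLin]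

theorem evalAt_smul (c : ℂ) (f : Laurent) (z w : ℂ) :
    evalAt (c • f) z w = c * evalAt f z w := by simp [evalAt_eq_evLin]

@[simp] theorem evalAt_zero (z w : ℂ) : evalAt 0 z w = 0 := by simp [evalAt_eq_evLin]

theorem evalAt_mono (s t : ℤ) (z w : ℂ) : evalAt (mono s t) z w = z ^ s * w ^ t := by
  simp [evalAt_eq_evLin, evLin, mono]

theorem evalAt_mul (f g : Laurent) {z w : ℂ} (hz : z ≠ 0) (hw : w ≠ 0) :
    evalAt (f * g) z w = evalAt f z w * evalAt g z w := by
  induction f using laurent_induction with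
  | zero => simp
  | add f f' hf hf' => rw [add_mul, evalAt_add, hf, hf', evalAt_add, add_mul]
  | mono c s t =>
    induction g using laurent_induction with
    | zero => simp
    | add f f' hf hf' => rw [mul_add, evalAt_add, hf, hf', evalAt_add, mul_add]
    | mono c' s' t' =>
      rw [smul_mul_smul_comm, mul_mono]
      simp only [evalAt_smul, evalAt_mono, zpow_add₀ hz, zpow_add₀ hw]
      ring

theorem evalAt_starRefl (f : Laurent) {z w : ℂ} (hz : ‖z‖ = 1) (hw : ‖w‖ = 1) :
    evalAt (starRefl f) z w = conj (evalAt f z w) := by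
  induction f using laurent_induction with
  | zero => simp
  | add f g hf hg => simp [evalAt_add, hf, hg]
  | mono c s t =>
    rw [LinearMap.map_smulₛₗ, starRefl_mono]
    simp only [evalAt_smul, evalAt_mono, map_mul, map_zpow₀, zpow_neg]
    rw [← Complex.inv_eq_conj hz, ← Complex.inv_eq_conj hw, inv_zpow, inv_zpow]

/-! ### The torus average -/

/-- Continuity of a function on the torus. -/
def TorusCont (F : ℂ → ℂ → ℂ) : Prop :=
  Continuous fun x : ℝ × ℝ => F (circleMap 0 1 x.1) (circleMap 0 1 x.2)

theorem norm_circleMap (θ : ℝ) : ‖circleMap 0 1 θ‖ = 1 := by simp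

theorem exists_circleMap {z : ℂ} (hz : ‖z‖ = 1) : ∃ θ : ℝ, circleMap 0 1 θ = z := by
  obtain ⟨θ, hθ⟩ := (Complex.norm_eq_one_iff z).1 hz
  exact ⟨θ, by simp [circleMap, hθ]⟩

theorem ne_zero_of_norm_one {z : ℂ} (hz : ‖z‖ = 1) : z ≠ 0 := by
  rintro rfl; simp at hz

theorem torusAverage_eq (F : ℂ → ℂ → ℂ) :
    torusAverage F = circleAverage (fun z => circleAverage (fun w => F z w) 0 1) 0 1 := by
  simp only [torusAverage, Real.circleAverage_def, circleMap_zero, Complex.ofReal_one, one_mul]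
  rw [intervalIntegral.integral_smul, smul_smul, Complex.real_smul]
  congr 1
  push_cast
  rw [sq, mul_inv]

theorem TorusCont.inner {F : ℂ → ℂ → ℂ} (hF : TorusCont F) (θ : ℝ) :
    Continuous fun φ : ℝ => F (circleMap 0 1 θ) (circleMap 0 1 φ) :=
  hF.comp (by fun_prop : Continuous fun φ : ℝ => (θ, φ))

theorem TorusCont.circleIntegrable {F : ℂ → ℂ → ℂ} (hF : TorusCont F) {z : ℂ} (hz : ‖z‖ = 1) :
    CircleIntegrable (F z) 0 1 := by
  obtain ⟨θ, rfl⟩ := exists_circleMap hz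
  exact (hF.inner θ).intervalIntegrable _ _

theorem TorusCont.outer {F : ℂ → ℂ → ℂ} (hF : TorusCont F) :
    Continuous fun θ : ℝ => circleAverage (fun w => F (circleMap 0 1 θ) w) 0 1 := by
  simp only [Real.circleAverage_def]
  exact (intervalIntegral.continuous_parametric_intervalIntegral_of_continuous'
    (f := fun θ φ : ℝ => F (circleMap 0 1 θ) (circleMap 0 1 φ)) hF _ _).const_smul _

theorem TorusCont.outer_integrable {F : ℂ → ℂ → ℂ} (hF : TorusCont F) :
    CircleIntegrable (fun z => circleAverage (fun w => F z w) 0 1) 0 1 :=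
  hF.outer.intervalIntegrable _ _

theorem circleAverage_congr_unit {f g : ℂ → ℂ} (h : ∀ z, ‖z‖ = 1 → f z = g z) :
    circleAverage f 0 1 = circleAverage g 0 1 :=
  Real.circleAverage_congr_sphere fun z hz => h z (by simpa using hz)

theorem torusAverage_congr {F G : ℂ → ℂ → ℂ}
    (h : ∀ z w, ‖z‖ = 1 → ‖w‖ = 1 → F z w = G z w) : torusAverage F = torusAverage G := by
  rw [torusAverage_eq, torusAverage_eq]
  exact circleAverage_congr_unit fun z hz => circleAverage_congr_unit fun w hw => h z w hz hw

theorem torusAverage_add {F G : ℂ → ℂ → ℂ} (hF : TorusCont F) (hG : TorusCont G) :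
    torusAverage (fun z w => F z w + G z w) = torusAverage F + torusAverage G := by
  simp only [torusAverage_eq]
  rw [← Real.circleAverage_fun_add hF.outer_integrable hG.outer_integrable]
  exact circleAverage_congr_unit fun z hz =>
    Real.circleAverage_fun_add (hF.circleIntegrable hz) (hG.circleIntegrable hz)

theorem torusAverage_smul (c : ℂ) (F : ℂ → ℂ → ℂ) :
    torusAverage (fun z w => c * F z w) = c * torusAverage F := by
  simp only [torusAverage_eq, ← smul_eq_mul]
  rw [← Real.circleAverage_fun_smul]
  simp only [Real.circleAverage_fun_smul]

theorem circleAverage_conj (f : ℂ → ℂ) :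
    circleAverage (fun z => conj (f z)) 0 1 = conj (circleAverage f 0 1) := by
  simp only [Real.circleAverage_def, Complex.real_smul, map_mul, Complex.conj_ofReal]
  congr 1
  rw [intervalIntegral, intervalIntegral, map_sub, integral_conj, integral_conj]

theorem torusAverage_conj (F : ℂ → ℂ → ℂ) :
    torusAverage (fun z w => conj (F z w)) = conj (torusAverage F) := by
  simp only [torusAverage_eq, ← circleAverage_conj]

theorem TorusCont.mul {F G : ℂ → ℂ → ℂ} (hF : TorusCont F) (hG : TorusCont G) :
    TorusCont fun z w => F z w * G z w := Continuous.mul hF hG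

theorem TorusCont.conj {F : ℂ → ℂ → ℂ} (hF : TorusCont F) :
    TorusCont fun z w => conj (F z w) := Complex.continuous_conj.comp hF

theorem TorusCont.div {F G : ℂ → ℂ → ℂ} (hF : TorusCont F) (hG : TorusCont G)
    (h0 : ∀ z w, ‖z‖ = 1 → ‖w‖ = 1 → G z w ≠ 0) : TorusCont fun z w => F z w / G z w :=
  Continuous.div hF hG fun _ => h0 _ _ (norm_circleMap _) (norm_circleMap _)

theorem torusCont_evalAt (f : Laurent) : TorusCont (evalAt f) := by
  unfold TorusCont
  induction f using laurent_induction with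
  | zero => simpa using continuous_const
  | add f g hf hg => simp only [evalAt_add]; exact Continuous.add hf hg
  | mono c s t =>
    simp only [evalAt_smul, evalAt_mono]
    refine continuous_const.mul (Continuous.mul ?_ ?_)
    · exact ((continuous_circleMap 0 1).comp continuous_fst).zpow₀ s
        fun _ => Or.inl (ne_zero_of_norm_one (norm_circleMap _))
    · exact ((continuous_circleMap 0 1).comp continuous_snd).zpow₀ t
        fun _ => Or.inl (ne_zero_of_norm_one (norm_circleMap _))

theorem circleAverage_nonneg_eq_zero {f : ℂ → ℝ} (hf : Continuous fun θ : ℝ => f (circleMap 0 1 θ))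
    (h0 : ∀ z, ‖z‖ = 1 → 0 ≤ f z) (h : circleAverage f 0 1 ≤ 0) {z : ℂ} (hz : ‖z‖ = 1) :
    f z = 0 := by
  by_contra hne
  obtain ⟨θ, hθ⟩ := exists_circleMap hz
  obtain ⟨θ', hθ', he⟩ := (periodic_circleMap 0 1).exists_mem_Ico₀ Real.two_pi_pos θ
  have hpos : 0 < ∫ θ in (0 : ℝ)..2 * Real.pi, f (circleMap 0 1 θ) := by
    refine intervalIntegral.integral_pos Real.two_pi_pos hf.continuousOn
      (fun x _ => h0 _ (norm_circleMap _)) ⟨θ', Set.Ico_subset_Icc_self hθ', ?_⟩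
    rw [← he, hθ]
    exact lt_of_le_of_ne (h0 z hz) (Ne.symm hne)
  rw [Real.circleAverage_def] at h
  have : 0 < (2 * Real.pi)⁻¹ • ∫ θ in (0 : ℝ)..2 * Real.pi, f (circleMap 0 1 θ) :=
    smul_pos (by positivity) hpos
  linarith

theorem circleAverage_ofReal (f : ℂ → ℝ) :
    circleAverage (fun z => (f z : ℂ)) 0 1 = (circleAverage f 0 1 : ℝ) := by
  simp only [Real.circleAverage_def, Complex.real_smul, smul_eq_mul, Complex.ofReal_mul]
  rw [intervalIntegral.integral_ofReal]

theorem circleAverage_nonneg {f : ℂ → ℝ} (h0 : ∀ z, ‖z‖ = 1 → 0 ≤ f z) :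
    0 ≤ circleAverage f 0 1 :=
  Real.circleAverage_nonneg_of_nonneg fun z hz => h0 z (by simpa using hz)

/-- A continuous nonnegative function on the torus has a nonnegative average. -/
theorem torusAverage_nonneg {F : ℂ → ℂ → ℝ} (h0 : ∀ z w, ‖z‖ = 1 → ‖w‖ = 1 → 0 ≤ F z w) :
    0 ≤ torusAverage fun z w => (F z w : ℂ) := by
  simp only [torusAverage_eq, circleAverage_ofReal]
  exact_mod_cast circleAverage_nonneg fun z hz => circleAverage_nonneg fun w hw => h0 z w hz hw

theorem torusAverage_eq_zero {F : ℂ → ℂ → ℝ} (hF : TorusCont fun z w => (F z w : ℂ))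
    (h0 : ∀ z w, ‖z‖ = 1 → ‖w‖ = 1 → 0 ≤ F z w)
    (h : torusAverage (fun z w => (F z w : ℂ)) = 0) {z w : ℂ} (hz : ‖z‖ = 1) (hw : ‖w‖ = 1) :
    F z w = 0 := by
  simp only [torusAverage_eq, circleAverage_ofReal, Complex.ofReal_eq_zero] at h
  have h1 := circleAverage_nonneg_eq_zero (f := fun z => circleAverage (fun w => F z w) 0 1)
    (by
      have := Complex.continuous_re.comp hF.outer
      refine this.congr fun θ => ?_
      simp only [Function.comp, circleAverage_ofReal, Complex.ofReal_re])
    (fun z hz => circleAverage_nonneg fun w hw => h0 z w hz hw) h.le hz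
  refine circleAverage_nonneg_eq_zero (f := fun w => F z w) ?_ (fun w hw => h0 z w hz hw) h1.le hw
  obtain ⟨θ, rfl⟩ := exists_circleMap hz
  refine (Complex.continuous_re.comp (hF.inner θ)).congr fun φ => ?_
  simp

theorem circleAverage_zpow (k : ℤ) :
    circleAverage (fun z : ℂ => z ^ k) 0 1 = if k = 0 then 1 else 0 := by
  split_ifs with h
  · subst h; simp [Real.circleAverage_const]
  · rw [Real.circleAverage_eq_circleIntegral one_ne_zero]
    have : (∮ z in C(0, 1), (z - 0)⁻¹ • z ^ k) = ∮ z in C(0, 1), (z - 0) ^ (k - 1) := by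
      refine circleIntegral.integral_congr zero_le_one fun z hz => ?_
      have hz0 : z ≠ 0 := ne_zero_of_norm_one (by simpa using hz)
      simp only [sub_zero, smul_eq_mul]
      rw [zpow_sub_one₀ hz0, mul_comm]
    rw [this, circleIntegral.integral_sub_zpow_of_ne (by omega), smul_zero]

theorem torusAverage_mono (s t : ℤ) :
    torusAverage (fun z w => z ^ s * w ^ t) = if s = 0 ∧ t = 0 then 1 else 0 := by
  simp only [torusAverage_eq, ← smul_eq_mul, Real.circleAverage_fun_smul, circleAverage_zpow]
  simp only [smul_eq_mul]
  by_cases ht : t = 0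
  · simp [ht, circleAverage_zpow]
  · simp [ht, Real.circleAverage_const]

theorem torusAverage_coeff (f : Laurent) (s t : ℤ) :
    torusAverage (fun z w => conj (z ^ s * w ^ t) * evalAt f z w) = f.coeff (s, t) := by
  have hm := (torusCont_evalAt (mono s t)).conj
  simp only [evalAt_mono] at hm
  induction f using laurent_induction with
  | zero =>
    simp only [evalAt_zero, mul_zero]
    simp [torusAverage]
  | add f g hf hg =>
    simp only [evalAt_add, mul_add]
    rw [torusAverage_add (hm.mul (torusCont_evalAt f)) (hm.mul (torusCont_evalAt g)), hf, hg]
    simp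
  | mono c a b =>
    have : torusAverage (fun z w => conj (z ^ s * w ^ t) * evalAt (c • mono a b) z w) =
        torusAverage (fun z w => c * (z ^ (a - s) * w ^ (b - t))) := by
      refine torusAverage_congr fun z w hz hw => ?_
      have hz0 := ne_zero_of_norm_one hz
      have hw0 := ne_zero_of_norm_one hw
      simp only [evalAt_smul, evalAt_mono, map_mul, map_zpow₀]
      rw [← Complex.inv_eq_conj hz, ← Complex.inv_eq_conj hw, zpow_sub₀ hz0, zpow_sub₀ hw0,
        inv_zpow, inv_zpow]
      ring
    rw [this, torusAverage_smul, torusAverage_mono]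
    simp only [mono, AddMonoidAlgebra.smul_single, smul_eq_mul, mul_one]
    simp only [AddMonoidAlgebra.coeff_single, Finsupp.single_apply, Prod.mk.injEq, sub_eq_zero]
    split_ifs <;> simp

theorem eq_zero_of_evalAt {f : Laurent}
    (h : ∀ z w, ‖z‖ = 1 → ‖w‖ = 1 → evalAt f z w = 0) : f = 0 := by
  ext e
  rw [← torusAverage_coeff f e.1 e.2]
  rw [torusAverage_congr (G := fun _ _ => 0) fun z w hz hw => by simp [h z w hz hw]]
  simp [torusAverage]

/-! ### Weighted inner products -/

/-- Positivity of a Laurent polynomial on the torus. -/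
def TorusPos (t : Laurent) : Prop := ∀ z w : ℂ, ‖z‖ = 1 → ‖w‖ = 1 → 0 < evalAt t z w

/-- The inner product `∫ conj f * g / t` on all Laurent polynomials. -/
def ipw (t f g : Laurent) : ℂ :=
  torusAverage fun z w => conj (evalAt f z w) * evalAt g z w / evalAt t z w

section ipw

variable {t : Laurent} (ht : TorusPos t)
include ht

theorem TorusPos.ne_zero {z w : ℂ} (hz : ‖z‖ = 1) (hw : ‖w‖ = 1) : evalAt t z w ≠ 0 :=
  (ht z w hz hw).ne'

theorem TorusPos.conj_eq {z w : ℂ} (hz : ‖z‖ = 1) (hw : ‖w‖ = 1) :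
    conj (evalAt t z w) = evalAt t z w :=
  Complex.conj_eq_iff_im.2 (Complex.pos_iff.1 (ht z w hz hw)).2.symm

theorem torusCont_ipw (f g : Laurent) :
    TorusCont fun z w => conj (evalAt f z w) * evalAt g z w / evalAt t z w :=
  ((torusCont_evalAt f).conj.mul (torusCont_evalAt g)).div (torusCont_evalAt t)
    fun _ _ => ht.ne_zero

theorem ipw_add_right (f g g' : Laurent) : ipw t f (g + g') = ipw t f g + ipw t f g' := by
  rw [ipw, ipw, ipw, ← torusAverage_add (torusCont_ipw ht f g) (torusCont_ipw ht f g')]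
  simp only [evalAt_add, mul_add, add_div]

omit ht in
theorem ipw_smul_right (c : ℂ) (f g : Laurent) : ipw t f (c • g) = c * ipw t f g := by
  rw [ipw, ipw, ← torusAverage_smul]
  simp only [evalAt_smul]
  congr 1; ext z w; ring

theorem ipw_conj (f g : Laurent) : conj (ipw t f g) = ipw t g f := by
  rw [ipw, ipw, ← torusAverage_conj]
  refine torusAverage_congr fun z w hz hw => ?_
  rw [map_div₀, map_mul, Complex.conj_conj, ht.conj_eq hz hw, mul_comm]

theorem ipw_add_left (f g h : Laurent) : ipw t (f + g) h = ipw t f h + ipw t g h := by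
  rw [← ipw_conj ht, ← ipw_conj ht h f, ← ipw_conj ht h g, ← map_add, ← ipw_add_right ht]

theorem ipw_smul_left (c : ℂ) (f g : Laurent) : ipw t (c • f) g = conj c * ipw t f g := by
  rw [← ipw_conj ht, ← ipw_conj ht g f, ← map_mul, ← ipw_smul_right]

theorem ipw_self_eq (f : Laurent) : ipw t f f = torusAverage fun z w =>
    ((‖evalAt f z w‖ ^ 2 / (evalAt t z w).re : ℝ) : ℂ) := by
  refine torusAverage_congr fun z w hz hw => ?_
  have h : evalAt t z w = ((evalAt t z w).re : ℂ) :=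
    (Complex.conj_eq_iff_re.1 (ht.conj_eq hz hw)).symm
  rw [mul_comm, Complex.mul_conj, Complex.normSq_eq_norm_sq]
  conv_lhs => rw [h]
  push_cast
  rfl

theorem ipw_self_nonneg (f : Laurent) : 0 ≤ ipw t f f := by
  rw [ipw_self_eq ht]
  exact torusAverage_nonneg fun z w hz hw =>
    div_nonneg (sq_nonneg _) (Complex.pos_iff.1 (ht z w hz hw)).1.le

theorem eq_zero_of_ipw_self {f : Laurent} (h : ipw t f f = 0) : f = 0 := by
  refine eq_zero_of_evalAt fun z w hz hw => ?_
  have hc := torusCont_ipw ht f f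
  have hp := fun z w (hz : ‖z‖ = 1) (hw : ‖w‖ = 1) => (Complex.pos_iff.1 (ht z w hz hw)).1
  rw [ipw_self_eq ht] at h
  have := torusAverage_eq_zero (F := fun z w => ‖evalAt f z w‖ ^ 2 / (evalAt t z w).re) ?_
    (fun z w hz hw => div_nonneg (sq_nonneg _) (hp z w hz hw).le) h hz hw
  · simpa [(hp z w hz hw).ne'] using this
  · refine Continuous.congr hc fun x => ?_
    beta_reduce
    have h : evalAt t (circleMap 0 1 x.1) (circleMap 0 1 x.2) =
        ((evalAt t (circleMap 0 1 x.1) (circleMap 0 1 x.2)).re : ℂ) :=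
      (Complex.conj_eq_iff_re.1 (ht.conj_eq (norm_circleMap _) (norm_circleMap _))).symm
    rw [mul_comm, Complex.mul_conj, Complex.normSq_eq_norm_sq]
    conv_lhs => rw [h]
    push_cast
    rfl

omit ht in
theorem ipw_shift (j k : ℤ) (f g : Laurent) : ipw t (mono j k * f) (mono j k * g) = ipw t f g := by
  refine torusAverage_congr fun z w hz hw => ?_
  have hz0 := ne_zero_of_norm_one hz
  have hw0 := ne_zero_of_norm_one hw
  rw [evalAt_mul _ _ hz0 hw0, evalAt_mul _ _ hz0 hw0, evalAt_mono, map_mul]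
  have : conj (z ^ j * w ^ k) * (z ^ j * w ^ k) = 1 := by
    rw [mul_comm, Complex.mul_conj, Complex.normSq_eq_norm_sq]
    simp [hz, hw]
  linear_combination (conj (evalAt f z w) * evalAt g z w / evalAt t z w) * this

end ipw

/-- The space of Laurent polynomials with the inner product of weight `1 / t`. -/
def WSpace {t : Laurent} (_ : TorusPos t) : Type := Laurent

section WSpace

variable {t : Laurent} (ht : TorusPos t)

instance : AddCommGroup (WSpace ht) := inferInstanceAs (AddCommGroup Laurent)
instance : Module ℂ (WSpace ht) := inferInstanceAs (Module ℂ Laurent)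

/-- A Laurent polynomial as an element of the weighted space. -/
def toW : Laurent ≃ₗ[ℂ] WSpace ht := LinearEquiv.refl ℂ Laurent

/-- The weighted inner product. -/
abbrev ipwCore : InnerProductSpace.Core ℂ (WSpace ht) where
  inner f g := ipw t ((toW ht).symm f) ((toW ht).symm g)
  conj_inner_symm f g := ipw_conj ht _ _
  re_inner_nonneg f := (Complex.nonneg_iff.1 (ipw_self_nonneg ht _)).1
  add_left f g h := by
    rw [map_add, ipw_add_left ht]
  smul_left f g c := by
    rw [map_smul, ipw_smul_left ht]
  definite f h := (toW ht).symm.map_eq_zero_iff.1 (eq_zero_of_ipw_self ht h)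

instance : NormedAddCommGroup (WSpace ht) := (ipwCore ht).toNormedAddCommGroup
instance : InnerProductSpace ℂ (WSpace ht) := InnerProductSpace.ofCore (ipwCore ht).toCore

theorem inner_toW (f g : Laurent) : inner ℂ (toW ht f) (toW ht g) = ipw t f g := rfl

end WSpace

/-! ### Rectangles of exponents. -/

/-- The span of the `z ^ s * w ^ t` with `a ≤ s ≤ b`, `c ≤ t ≤ d`. -/
def rect (a b c d : ℤ) : Submodule ℂ Laurent :=
  Submodule.span ℂ {f | ∃ s t : ℤ, a ≤ s ∧ s ≤ b ∧ c ≤ t ∧ t ≤ d ∧ f = mono s t}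

theorem mem_rect_iff {a b c d : ℤ} {f : Laurent} : f ∈ rect a b c d ↔
    ∀ s t : ℤ, ¬(a ≤ s ∧ s ≤ b ∧ c ≤ t ∧ t ≤ d) → f.coeff (s, t) = 0 := by
  constructor
  · intro hf s t h
    induction hf using Submodule.span_induction with
    | zero => simp
    | add x y _ _ hx hy => simp [hx, hy]
    | smul r x _ hx => simp [hx]
    | mem x hx =>
      obtain ⟨s', t', h1, h2, h3, h4, rfl⟩ := hx
      simp only [mono, AddMonoidAlgebra.coeff_single, Finsupp.single_apply, Prod.mk.injEq]
      rw [if_neg]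
      rintro ⟨rfl, rfl⟩
      exact h ⟨h1, h2, h3, h4⟩
  · intro h
    have : f = ∑ e ∈ f.coeff.support, f.coeff e • mono e.1 e.2 := by
      have h1 : f.coeff = ∑ e ∈ f.coeff.support, Finsupp.single e (f.coeff e) :=
        (Finsupp.sum_single f.coeff).symm
      ext e
      conv_lhs => rw [h1]
      simp [mono]
    rw [this]
    refine Submodule.sum_mem _ fun e he => Submodule.smul_mem _ _ (Submodule.subset_span ?_)
    have h2 : ¬¬(a ≤ e.1 ∧ e.1 ≤ b ∧ c ≤ e.2 ∧ e.2 ≤ d) := fun h3 =>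
      Finsupp.mem_support_iff.1 he (h e.1 e.2 h3)
    obtain ⟨h1, h2, h3, h4⟩ := not_not.1 h2
    exact ⟨_, _, h1, h2, h3, h4, rfl⟩

theorem mono_mem_rect {a b c d s t : ℤ} (h1 : a ≤ s) (h2 : s ≤ b) (h3 : c ≤ t) (h4 : t ≤ d) :
    mono s t ∈ rect a b c d := Submodule.subset_span ⟨s, t, h1, h2, h3, h4, rfl⟩

theorem rect_mono {a b c d a' b' c' d' : ℤ} (h1 : a' ≤ a) (h2 : b ≤ b') (h3 : c' ≤ c)
    (h4 : d ≤ d') : rect a b c d ≤ rect a' b' c' d' := by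
  refine Submodule.span_mono ?_
  rintro f ⟨s, t, h⟩
  exact ⟨s, t, by omega, by omega, by omega, by omega, h.2.2.2.2⟩

instance finiteDimensional_rect (a b c d : ℤ) : FiniteDimensional ℂ (rect a b c d) := by
  refine FiniteDimensional.span_of_finite ℂ ?_
  refine ((Set.finite_Icc (a, c) (b, d)).image fun e : ℤ × ℤ => mono e.1 e.2).subset ?_
  rintro f ⟨s, t, h1, h2, h3, h4, rfl⟩
  exact ⟨(s, t), ⟨⟨h1, h3⟩, ⟨h2, h4⟩⟩, rfl⟩

theorem coeff_mono_mul (j k : ℤ) (f : Laurent) (s t : ℤ) :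
    (mono j k * f).coeff (s, t) = f.coeff (s - j, t - k) := by
  rw [← torusAverage_coeff, ← torusAverage_coeff]
  refine torusAverage_congr fun z w hz hw => ?_
  have hz0 := ne_zero_of_norm_one hz
  have hw0 := ne_zero_of_norm_one hw
  rw [evalAt_mul _ _ hz0 hw0, evalAt_mono]
  simp only [map_mul, map_zpow₀, ← Complex.inv_eq_conj hz, ← Complex.inv_eq_conj hw,
    zpow_sub₀ hz0, zpow_sub₀ hw0, inv_zpow, map_div₀]
  field_simp

theorem mono_mul_mem_rect {a b c d : ℤ} (j k : ℤ) {f : Laurent} :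
    mono j k * f ∈ rect (a + j) (b + j) (c + k) (d + k) ↔ f ∈ rect a b c d := by
  simp only [mem_rect_iff, coeff_mono_mul]
  constructor
  · intro h s t hst
    have := h (s + j) (t + k) (by omega)
    simpa using this
  · intro h s t hst
    exact h _ _ (by omega)

theorem coeff_starRefl (f : Laurent) (s t : ℤ) :
    (starRefl f).coeff (s, t) = conj (f.coeff (-s, -t)) := by
  simp [starRefl, Finsupp.equivMapDomain_apply]

/-! ### Powers of a linear map with eigenvalues in the open disc -/

section Abstract

open Filter Topology

/-- Gelfand's formula: ‖a^N‖^(1/N) tends to the spectral radius, so eventually ‖a^N‖ ≤ r^N for some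
r < 1. Compactness of the spectrum makes the pointwise bound uniform. -/
theorem tendsto_pow_zero_of_spectrum {A : Type*} [NormedRing A] [NormedAlgebra ℂ A]
    [CompleteSpace A] (a : A) (h : ∀ μ ∈ spectrum ℂ a, ‖μ‖ < 1) :
    Tendsto (fun N : ℕ => a ^ N) atTop (𝓝 0) := by
  cases subsingleton_or_nontrivial A with
  | inl hs => simp [Subsingleton.elim _ (0 : A)]
  | inr hn =>
    have h1 : spectralRadius ℂ a < (1 : NNReal) :=
      spectrum.spectralRadius_lt_of_forall_lt a fun μ hμ => by
        rw [← NNReal.coe_lt_coe]; simpa using h μ hμ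
    obtain ⟨r, hr, hr1⟩ := ENNReal.lt_iff_exists_nnreal_btwn.1 h1
    have h2 := (spectrum.pow_nnnorm_pow_one_div_tendsto_nhds_spectralRadius a).eventually
      (gt_mem_nhds hr)
    rw [tendsto_zero_iff_norm_tendsto_zero]
    have hr' : (r : ℝ) < 1 := by exact_mod_cast hr1
    refine squeeze_zero' (Eventually.of_forall fun _ => norm_nonneg _) ?_
      (tendsto_pow_atTop_nhds_zero_of_lt_one r.2 hr')
    filter_upwards [h2, eventually_gt_atTop 0] with N hN hN0
    have hN' : (0 : ℝ) < N := by exact_mod_cast hN0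
    have h3 : ((‖a ^ N‖₊ : ENNReal) ^ (1 / (N : ℝ))) ^ (N : ℝ) ≤ (r : ENNReal) ^ (N : ℝ) :=
      ENNReal.rpow_le_rpow hN.le hN'.le
    rw [← ENNReal.rpow_mul, one_div_mul_cancel hN'.ne', ENNReal.rpow_one,
      ENNReal.rpow_natCast] at h3
    exact_mod_cast h3

theorem tendsto_pow_apply_zero {V : Type*} [NormedAddCommGroup V] [NormedSpace ℂ V]
    [FiniteDimensional ℂ V] (M : V →ₗ[ℂ] V)
    (h : ∀ (μ : ℂ) (v : V), 1 ≤ ‖μ‖ → M v = μ • v → v = 0) (v : V) :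
    Tendsto (fun N : ℕ => (M ^ N) v) atTop (𝓝 0) := by
  have hcs : CompleteSpace (V →L[ℂ] V) := by
    have := FiniteDimensional.complete ℂ V
    infer_instance
  have h1 := tendsto_pow_zero_of_spectrum (Module.End.toContinuousLinearMap (𝕜 := ℂ) V M) ?_
  · have h2 := ((ContinuousLinearMap.apply ℂ V v).continuous.tendsto 0).comp h1
    simp only [map_zero] at h2
    refine h2.congr fun N => ?_
    simp only [Function.comp, ContinuousLinearMap.apply_apply]
    rw [← map_pow]
    rfl
  · intro μ hμ
    rw [AlgEquiv.spectrum_eq] at hμ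
    obtain ⟨v, hv⟩ := (Module.End.hasEigenvalue_iff_mem_spectrum.2 hμ).exists_hasEigenvector
    by_contra hlt
    exact hv.2 (h μ v (not_lt.1 hlt) hv.apply_eq_smul)

/-- φ_j(v) = φ_{j+N}(M^N v) for every N, where M^N v → 0; in finite dimension the pointwise bounds
on the functionals, taken on a basis, are uniform. -/
theorem apply_eq_zero_of_intertwine {V : Type*} [NormedAddCommGroup V] [InnerProductSpace ℂ V]
    [FiniteDimensional ℂ V] (M : V →ₗ[ℂ] V)
    (h : ∀ v : V, Tendsto (fun N : ℕ => (M ^ N) v) atTop (𝓝 0)) (φ : ℕ → V →ₗ[ℂ] ℂ)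
    (hb : ∀ v, ∃ C, ∀ j, ‖φ j v‖ ≤ C) (hφ : ∀ j v, φ (j + 1) (M v) = φ j v) (j : ℕ) (v : V) :
    φ j v = 0 := by
  have h1 : ∀ N v, φ (j + N) ((M ^ N) v) = φ j v := by
    intro N
    induction N with
    | zero => intro v; simp
    | succ N ih =>
      intro v
      rw [pow_succ', ← add_assoc, Module.End.mul_apply, hφ, ih]
  set b := stdOrthonormalBasis ℂ V
  choose C hC using hb
  have h2 : ∀ N, ‖φ j v‖ ≤ ∑ i, ‖inner ℂ (b i) ((M ^ N) v)‖ * C (b i) := by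
    intro N
    rw [← h1 N v]
    conv_lhs => rw [← b.sum_repr' ((M ^ N) v)]
    rw [map_sum]
    refine (norm_sum_le _ _).trans (Finset.sum_le_sum fun i _ => ?_)
    rw [map_smul, norm_smul]
    exact mul_le_mul_of_nonneg_left (hC _ _) (norm_nonneg _)
  have h3 : Tendsto (fun N => ∑ i, ‖inner ℂ (b i) ((M ^ N) v)‖ * C (b i)) atTop (𝓝 0) := by
    have : (0 : ℝ) = ∑ i, ‖inner ℂ (b i) (0 : V)‖ * C (b i) := by simp
    rw [this]
    refine tendsto_finsetSum _ fun i _ => Tendsto.mul_const _ ?_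
    exact (((continuous_const.inner continuous_id).tendsto (0 : V)).comp (h v)).norm
  have := ge_of_tendsto' h3 h2
  exact norm_le_zero_iff.1 this

variable {E : Type*} [NormedAddCommGroup E] [InnerProductSpace ℂ E]

theorem sub_starProjection_mem {V Y : Submodule ℂ E} [FiniteDimensional ℂ V]
    (hVY : V ⟂ Y) (x : E) (hx : x ∈ V ⊔ Y) :
    x - V.starProjection x ∈ Y := by
  obtain ⟨v, hv, y, hy, rfl⟩ := Submodule.mem_sup.1 hx
  rw [map_add, Submodule.starProjection_eq_self_iff.2 hv,
    (Submodule.starProjection_apply_eq_zero_iff V).2 (hVY.symm hy)]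
  simpa using hy

/-- The compression of `Z` to `V`. -/
def compress (V : Submodule ℂ E) [FiniteDimensional ℂ V] (Z : E →ₗ[ℂ] E) : V →ₗ[ℂ] V :=
  (V.orthogonalProjectionOnto : E →ₗ[ℂ] V) ∘ₗ Z ∘ₗ V.subtype

theorem coe_compress (V : Submodule ℂ E) [FiniteDimensional ℂ V] (Z : E →ₗ[ℂ] E) (v : V) :
    (compress V Z v : E) = V.starProjection (Z v) := rfl

/-- If the projection of Z v to V is μ v with |μ| ≥ 1, then ‖Z v‖ = ‖v‖ and Pythagoras leave no room
for a component off V, so v would be an eigenvector of Z itself. -/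
theorem compress_pow_tendsto {V : Submodule ℂ E} [FiniteDimensional ℂ V] {Z : E →ₗ[ℂ] E}
    (hZ : ∀ x, ‖Z x‖ = ‖x‖) (hev : ∀ (μ : ℂ) x, Z x = μ • x → x = 0) (v : V) :
    Tendsto (fun N : ℕ => (compress V Z ^ N) v) atTop (𝓝 0) := by
  refine tendsto_pow_apply_zero _ (fun μ v hμ hv => ?_) v
  have h1 : V.starProjection (Z v) = μ • (v : E) := by rw [← coe_compress, hv]; rfl
  have h2 : ‖Z v - V.starProjection (Z v)‖ = 0 := by
    have h3 := V.norm_sq_eq_add_norm_sq_starProjection (Z v)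
    have h4 : Vᗮ.starProjection (Z v) = Z v - V.starProjection (Z v) := by
      simp
    rw [h4, hZ, h1, norm_smul, mul_pow] at h3
    rw [h1]
    have h5 : (1 : ℝ) ≤ ‖μ‖ ^ 2 := one_le_pow₀ hμ
    have h6 := mul_le_mul_of_nonneg_right h5 (sq_nonneg ‖(v : E)‖)
    have h7 := sq_nonneg ‖Z v - μ • (v : E)‖
    exact pow_eq_zero_iff two_ne_zero |>.1 (le_antisymm (by linarith) h7)
  rw [norm_eq_zero, sub_eq_zero, h1] at h2
  exact Subtype.ext (hev μ _ h2)

/-- A bounded sequence of functionals compatible with `Z` that vanishes on the part of `Z V`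
orthogonal to `V` vanishes on `V`. -/
theorem transfer_zero {V Y : Submodule ℂ E} [FiniteDimensional ℂ V] {Z : E →ₗ[ℂ] E}
    (hZ : ∀ x, ‖Z x‖ = ‖x‖) (hev : ∀ (μ : ℂ) x, Z x = μ • x → x = 0) (hVY : V ⟂ Y)
    (hsup : ∀ v ∈ V, Z v ∈ V ⊔ Y) (φ : ℕ → E →ₗ[ℂ] ℂ) (hb : ∀ v ∈ V, ∃ C, ∀ j, ‖φ j v‖ ≤ C)
    (hφ : ∀ j, ∀ v ∈ V, φ (j + 1) (Z v) = φ j v) (hY : ∀ j, ∀ y ∈ Y, φ (j + 1) y = 0) (j : ℕ)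
    {v : E} (hv : v ∈ V) : φ j v = 0 := by
  refine apply_eq_zero_of_intertwine (compress V Z) (compress_pow_tendsto hZ hev)
    (fun j => φ j ∘ₗ V.subtype) (fun v => hb v v.2) (fun j v => ?_) j ⟨v, hv⟩
  -- Z v and its compression differ by an element of Y, which the functionals do not see; so they
  -- are compatible with the compression as well.
  have h1 := hY j _ (sub_starProjection_mem hVY _ (hsup v v.2))
  rw [map_sub, sub_eq_zero, hφ j v v.2] at h1
  simp only [LinearMap.comp_apply, Submodule.subtype_apply, coe_compress, h1]

/-- A sesquilinear form invariant under `Z` vanishes on `V` if it vanishes as soon as one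
argument lies in the part of `Z V` orthogonal to `V`. -/
theorem transfer_form {V Y : Submodule ℂ E} [FiniteDimensional ℂ V] {Z : E →ₗ[ℂ] E}
    (hZ : ∀ x, ‖Z x‖ = ‖x‖) (hev : ∀ (μ : ℂ) x, Z x = μ • x → x = 0) (hVY : V ⟂ Y)
    (hsup : ∀ v ∈ V, Z v ∈ V ⊔ Y) (Δ : E →ₗ⋆[ℂ] E →ₗ[ℂ] ℂ)
    (hΔ : ∀ u ∈ V, ∀ v ∈ V, Δ (Z u) (Z v) = Δ u v)
    (hl : ∀ y ∈ Y, ∀ v ∈ V, Δ y v = 0) (hr : ∀ y ∈ Y, ∀ v ∈ V, Δ v y = 0)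
    (hy : ∀ y ∈ Y, ∀ y' ∈ Y, Δ y y' = 0) {u v : E} (hu : u ∈ V) (hv : v ∈ V) : Δ u v = 0 := by
  have hpow := fun v => compress_pow_tendsto (V := V) hZ hev v
  -- Iterating the compression in both arguments reduces this to functionals Δ(C^j u, ·), with C the
  -- compression; they are bounded pointwise because C^j u converges.
  refine apply_eq_zero_of_intertwine (compress V Z) hpow
    (fun j => Δ ((compress V Z ^ j) ⟨u, hu⟩ : V) ∘ₗ V.subtype) (fun v => ?_) (fun j v => ?_) 0
    ⟨v, hv⟩
  · have hc : Continuous fun x : V => ‖Δ x v‖ := by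
      have h0 : Continuous fun x : V => conj (Δ x v) := by
        let L : V →ₗ[ℂ] ℂ :=
          { toFun := fun x => conj (Δ x v)
            map_add' := fun x y => by simp
            map_smul' := fun c x => by simp }
        exact L.continuous_of_finiteDimensional
      refine h0.norm.congr fun x => ?_
      simp
    obtain ⟨C, hC⟩ := (((hc.tendsto 0).comp (hpow ⟨u, hu⟩)).bddAbove_range)
    exact ⟨C, fun j => hC ⟨j, rfl⟩⟩
  · set x := (compress V Z ^ j) ⟨u, hu⟩
    have h1 := sub_starProjection_mem hVY _ (hsup x x.2)
    have h2 := sub_starProjection_mem hVY _ (hsup v v.2)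
    simp only [LinearMap.comp_apply, Submodule.subtype_apply, pow_succ', Module.End.mul_apply]
    change Δ (compress V Z x : V) (compress V Z v : V) = Δ x v
    rw [← hΔ x x.2 v v.2]
    have e1 : Z x = (compress V Z x : V) + (Z x - V.starProjection (Z x)) := by
      rw [coe_compress]; abel
    have e2 : Z v = (compress V Z v : V) + (Z v - V.starProjection (Z v)) := by
      rw [coe_compress]; abel
    conv_rhs => rw [e1, e2]
    simp only [map_add, LinearMap.add_apply]
    rw [hl _ h1 _ (compress V Z v).2, hr _ h2 _ (compress V Z x).2, hy _ h1 _ h2]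
    simp

end Abstract

/-! ### Orthogonality of Laurent polynomials for a weight -/

section Interface

variable {t s : Laurent}

theorem exists_ipw_projection (ht : TorusPos t) (V : Submodule ℂ Laurent) [FiniteDimensional ℂ V]
    (f : Laurent) : ∃ g ∈ V, ∀ v ∈ V, ipw t v (f - g) = 0 := by
  set V' := V.map (toW ht).toLinearMap
  have hg := V'.starProjection_apply_mem (toW ht f)
  obtain ⟨g, hg, hgf⟩ := Submodule.mem_map.1 hg
  refine ⟨g, hg, fun v hv => ?_⟩
  have h := V'.sub_starProjection_mem_orthogonal (toW ht f)
  rw [← hgf] at h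
  exact (Submodule.mem_orthogonal _ _).1 h _ (Submodule.mem_map_of_mem hv)

theorem exists_ipw_basis (ht : TorusPos t) (V : Submodule ℂ Laurent) [FiniteDimensional ℂ V] :
    ∃ e : Fin (Module.finrank ℂ V) → Laurent, (∀ i, e i ∈ V) ∧
      (∀ i j, ipw t (e i) (e j) = if i = j then 1 else 0) ∧
      ∀ f ∈ V, f = ∑ i, ipw t (e i) f • e i := by
  set V' := V.map (toW ht).toLinearMap
  have hd : Module.finrank ℂ V' = Module.finrank ℂ V :=
    LinearEquiv.finrank_map_eq (toW ht) V
  set b := (stdOrthonormalBasis ℂ V').reindex (finCongr hd)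
  refine ⟨fun i => (toW ht).symm (b i), fun i => ?_, fun i j => ?_, fun f hf => ?_⟩
  · obtain ⟨v, hv, hvb⟩ := Submodule.mem_map.1 (b i).2
    have h : (toW ht).symm (b i) = v := by rw [← hvb]; rfl
    change (toW ht).symm (b i) ∈ V
    rw [h]
    exact hv
  · exact (orthonormal_iff_ite.1 b.orthonormal i j)
  · have h := b.sum_repr' ⟨toW ht f, Submodule.mem_map_of_mem hf⟩
    have h' := congrArg (fun x : V' => (toW ht).symm (x : WSpace ht)) h
    simp only [Submodule.coe_sum, Submodule.coe_smul, map_sum, map_smul] at h'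
    exact h'.symm

theorem norm_ipw_mono_mul_le (hs : TorusPos s) (x v : Laurent) :
    ∃ C, ∀ j k : ℤ, ‖ipw s x (mono j k * v)‖ ≤ C := by
  refine ⟨‖toW hs x‖ * ‖toW hs v‖, fun j k => ?_⟩
  have h1 := norm_inner_le_norm (𝕜 := ℂ) (toW hs x) (toW hs (mono j k * v))
  have h2 : ‖toW hs (mono j k * v)‖ = ‖toW hs v‖ := by
    rw [norm_eq_sqrt_re_inner (𝕜 := ℂ), norm_eq_sqrt_re_inner (𝕜 := ℂ) (toW hs v), inner_toW,
      inner_toW, ipw_shift]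
  rwa [h2] at h1

/-- The Laurent ring is a domain, so multiplication by z^j, j ≠ 0, has no eigenvectors. This is the
hypothesis on Z in the transfer lemmas. -/
theorem eq_zero_of_mono_mul_eq_smul {j : ℤ} (hj : j ≠ 0) {μ : ℂ} {x : Laurent}
    (h : mono j 0 * x = μ • x) : x = 0 := by
  have h1 : (mono j 0 - μ • (1 : Laurent)) * x = 0 := by
    rw [sub_mul, h, smul_mul_assoc, one_mul, sub_self]
  rcases mul_eq_zero.1 h1 with h2 | h2
  · exfalso
    have h3 := congrArg (fun f : Laurent => f.coeff (j, 0)) h2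
    simp [mono, AddMonoidAlgebra.one_def, hj] at h3
  · exact h2

/-- Multiplication by a monomial. -/
def mulMono (j k : ℤ) : Laurent →ₗ[ℂ] Laurent := LinearMap.mulLeft ℂ (mono j k)

theorem mulMono_apply (j k : ℤ) (f : Laurent) : mulMono j k f = mono j k * f := rfl

theorem mono_mul_mono_mul (j k j' k' : ℤ) (f : Laurent) :
    mono j k * (mono j' k' * f) = mono (j + j') (k + k') * f := by
  rw [← mul_assoc, mul_mono]

theorem mono_zero_mul (f : Laurent) : mono 0 0 * f = f := by
  have : mono 0 0 = 1 := rfl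
  rw [this, one_mul]

theorem ipw_zero_left (ht : TorusPos t) (f : Laurent) : ipw t 0 f = 0 := by
  simpa using ipw_smul_left ht 0 0 f

theorem ipw_zero_right (f : Laurent) : ipw t f 0 = 0 := by
  simpa using ipw_smul_right (t := t) 0 f 0

/-- `g ↦ ⟨f, g⟩` as a linear map. -/
def ipwRight (ht : TorusPos t) (f : Laurent) : Laurent →ₗ[ℂ] ℂ where
  toFun g := ipw t f g
  map_add' := ipw_add_right ht f
  map_smul' c g := ipw_smul_right c f g

/-- The inner product as a sesquilinear map. -/
def ipwForm (ht : TorusPos t) : Laurent →ₗ⋆[ℂ] Laurent →ₗ[ℂ] ℂ where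
  toFun f := ipwRight ht f
  map_add' f g := by refine LinearMap.ext fun h => ?_; exact ipw_add_left ht f g h
  map_smul' c f := by refine LinearMap.ext fun h => ?_; exact ipw_smul_left ht c f h

theorem ipwForm_apply (ht : TorusPos t) (f g : Laurent) : ipwForm ht f g = ipw t f g := rfl

theorem ipw_eq_zero_symm (ht : TorusPos t) {f g : Laurent} (h : ipw t f g = 0) :
    ipw t g f = 0 := by
  rw [← ipw_conj ht, h, map_zero]

/-- `transfer_zero` for the functionals v ↦ ⟨x, z^{-jN} v⟩ of weight 1/s, bounded by Cauchy–Schwarz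
since monomials act isometrically. The geometry of V and Y is that of 1/t, while the relation
obtained is one for 1/s. -/
theorem transfer_ipw_zero (ht : TorusPos t) (hs : TorusPos s) {V Y : Submodule ℂ Laurent}
    [FiniteDimensional ℂ V] {j : ℤ} (hj : j ≠ 0) (hVY : ∀ v ∈ V, ∀ y ∈ Y, ipw t v y = 0)
    (hsup : ∀ v ∈ V, mono j 0 * v ∈ V ⊔ Y) (x : Laurent)
    (hY : ∀ N : ℕ, ∀ y ∈ Y, ipw s x (mono (-j * (N + 1)) 0 * y) = 0) (N : ℕ) {v : Laurent}
    (hv : v ∈ V) : ipw s x (mono (-j * N) 0 * v) = 0 := by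
  have key := transfer_zero (E := WSpace ht) (V := V.map (toW ht).toLinearMap)
    (Y := Y.map (toW ht).toLinearMap)
    (Z := (toW ht).toLinearMap ∘ₗ mulMono j 0 ∘ₗ (toW ht).symm.toLinearMap) ?_ ?_ ?_ ?_
    (fun N => ipwRight hs x ∘ₗ mulMono (-j * N) 0 ∘ₗ (toW ht).symm.toLinearMap) ?_ ?_ ?_ N
    (Submodule.mem_map_of_mem hv)
  · exact key
  · intro x
    have : x = toW ht ((toW ht).symm x) := rfl
    rw [this, norm_eq_sqrt_re_inner (𝕜 := ℂ), norm_eq_sqrt_re_inner (𝕜 := ℂ) (toW ht _),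
      inner_toW, ← ipw_shift j 0]
    rfl
  · intro μ x hx
    exact eq_zero_of_mono_mul_eq_smul (x := (toW ht).symm x) hj hx
  · rw [Submodule.isOrtho_iff_inner_eq]
    rintro _ ⟨v, hv, rfl⟩ _ ⟨y, hy, rfl⟩
    exact hVY v hv y hy
  · rintro _ ⟨v, hv, rfl⟩
    rw [← Submodule.map_sup]
    exact Submodule.mem_map_of_mem (hsup v hv)
  · rintro _ ⟨v, hv, rfl⟩
    obtain ⟨C, hC⟩ := norm_ipw_mono_mul_le hs x v
    exact ⟨C, fun N => hC _ _⟩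
  · rintro N _ ⟨v, hv, rfl⟩
    change ipw s x (mono (-j * (N + 1 : ℕ)) 0 * (mono j 0 * v)) = ipw s x (mono (-j * N) 0 * v)
    rw [mono_mul_mono_mul]
    congr 3
    push_cast; ring
  · rintro N _ ⟨y, hy, rfl⟩
    have := hY N y hy
    change ipw s x (mono (-j * (N + 1 : ℕ)) 0 * y) = 0
    exact_mod_cast this

/-- `transfer_form` for the difference of the two inner products, which is invariant under z^j. Its
mixed terms vanish by `transfer_ipw_zero` with N = 0. -/
theorem transfer_ipw_eq (ht : TorusPos t) (hs : TorusPos s) {V Y : Submodule ℂ Laurent}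
    [FiniteDimensional ℂ V] {j : ℤ} (hj : j ≠ 0) (hVY : ∀ v ∈ V, ∀ y ∈ Y, ipw t v y = 0)
    (hsup : ∀ v ∈ V, mono j 0 * v ∈ V ⊔ Y)
    (hY : ∀ y' ∈ Y, ∀ N : ℕ, ∀ y ∈ Y, ipw s y' (mono (-j * (N + 1)) 0 * y) = 0)
    (hyy : ∀ y ∈ Y, ∀ y' ∈ Y, ipw s y y' = ipw t y y') {u v : Laurent}
    (hu : u ∈ V) (hv : v ∈ V) : ipw s u v = ipw t u v := by
  have hz : ∀ y ∈ Y, ∀ v ∈ V, ipw s y v = 0 := fun y hy v hv => by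
    have := transfer_ipw_zero ht hs hj hVY hsup y (hY y hy) 0 hv
    simpa [mono_zero_mul] using this
  have key := transfer_form (E := WSpace ht) (V := V.map (toW ht).toLinearMap)
    (Y := Y.map (toW ht).toLinearMap)
    (Z := (toW ht).toLinearMap ∘ₗ mulMono j 0 ∘ₗ (toW ht).symm.toLinearMap) ?_ ?_ ?_ ?_
    (((ipwForm hs - ipwForm ht).compl₂ (toW ht).symm.toLinearMap).comp (toW ht).symm.toLinearMap)
    ?_ ?_ ?_ ?_
    (Submodule.mem_map_of_mem hu) (Submodule.mem_map_of_mem hv)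
  · exact sub_eq_zero.1 key
  · intro x
    have : x = toW ht ((toW ht).symm x) := rfl
    rw [this, norm_eq_sqrt_re_inner (𝕜 := ℂ), norm_eq_sqrt_re_inner (𝕜 := ℂ) (toW ht _),
      inner_toW, ← ipw_shift j 0]
    rfl
  · intro μ x hx
    exact eq_zero_of_mono_mul_eq_smul (x := (toW ht).symm x) hj hx
  · rw [Submodule.isOrtho_iff_inner_eq]
    rintro _ ⟨v, hv, rfl⟩ _ ⟨y, hy, rfl⟩
    exact hVY v hv y hy
  · rintro _ ⟨v, hv, rfl⟩
    rw [← Submodule.map_sup]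
    exact Submodule.mem_map_of_mem (hsup v hv)
  · rintro _ ⟨u, hu, rfl⟩ _ ⟨v, hv, rfl⟩
    change ipw s (mono j 0 * u) (mono j 0 * v) - ipw t (mono j 0 * u) (mono j 0 * v) =
      ipw s u v - ipw t u v
    rw [ipw_shift, ipw_shift]
  · rintro _ ⟨y, hy, rfl⟩ _ ⟨v, hv, rfl⟩
    change ipw s y v - ipw t y v = 0
    rw [hz y hy v hv, ipw_eq_zero_symm ht (hVY v hv y hy), sub_zero]
  · rintro _ ⟨y, hy, rfl⟩ _ ⟨v, hv, rfl⟩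
    change ipw s v y - ipw t v y = 0
    rw [ipw_eq_zero_symm hs (hz y hy v hv), hVY v hv y hy, sub_zero]
  · rintro _ ⟨y, hy, rfl⟩ _ ⟨y', hy', rfl⟩
    exact sub_eq_zero.2 (hyy y hy y' hy')

end Interface

/-! ### Fibre coefficients -/

/-- The coefficient of `w ^ k` in `f(z, ·)`. -/
def fib (z : ℂ) (k : ℤ) : Laurent →ₗ[ℂ] ℂ :=
  Finsupp.linearCombination ℂ (fun e : ℤ × ℤ => if e.2 = k then z ^ e.1 else 0) ∘ₗ
    (AddMonoidAlgebra.coeffLinearEquiv ℂ).toLinearMap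

theorem fib_mono (z : ℂ) (k i j : ℤ) : fib z k (mono i j) = if j = k then z ^ i else 0 := by
  simp [fib, mono]

theorem fib_mono_mul {z : ℂ} (hz : z ≠ 0) (k i j : ℤ) (f : Laurent) :
    fib z k (mono i j * f) = z ^ i * fib z (k - j) f := by
  induction f using laurent_induction with
  | zero => simp
  | add f g hf hg => simp [mul_add, hf, hg]
  | mono c a b =>
    rw [mul_smul_comm, mul_mono, map_smul, map_smul, fib_mono, fib_mono]
    by_cases h : b = k - j
    · rw [if_pos (by omega), if_pos h, zpow_add₀ hz]
      simp only [smul_eq_mul]; ring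
    · rw [if_neg (by omega), if_neg h]; simp

theorem fib_starRefl {z : ℂ} (hz : ‖z‖ = 1) (k : ℤ) (f : Laurent) :
    fib z k (starRefl f) = conj (fib z (-k) f) := by
  induction f using laurent_induction with
  | zero => simp
  | add f g hf hg => simp [hf, hg]
  | mono c a b =>
    rw [LinearMap.map_smulₛₗ, starRefl_mono, map_smul, map_smul, fib_mono, fib_mono]
    by_cases h : b = -k
    · rw [if_pos (by omega), if_pos h]
      simp [← Complex.inv_eq_conj hz]
    · rw [if_neg (by omega), if_neg h]; simp

theorem fib_eq_zero {a b c d : ℤ} {f : Laurent} (hf : f ∈ rect a b c d) (z : ℂ) {k : ℤ}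
    (hk : ¬(c ≤ k ∧ k ≤ d)) : fib z k f = 0 := by
  induction hf using Submodule.span_induction with
  | zero => simp
  | add x y _ _ hx hy => simp [hx, hy]
  | smul r x _ hx => simp [hx]
  | mem x hx =>
    obtain ⟨s, t, h1, h2, h3, h4, rfl⟩ := hx
    rw [fib_mono, if_neg]
    rintro rfl
    exact hk ⟨h3, h4⟩

theorem evalAt_eq_sum_fib {a b : ℤ} {M : ℕ} {f : Laurent} (hf : f ∈ rect a b 0 (M - 1))
    (z w : ℂ) : evalAt f z w = ∑ k ∈ Finset.range M, fib z k f * w ^ k := by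
  induction hf using Submodule.span_induction with
  | zero => simp
  | add x y _ _ hx hy => simp [evalAt_add, hx, hy, add_mul, Finset.sum_add_distrib]
  | smul r x _ hx => simp [evalAt_smul, hx, Finset.mul_sum, mul_assoc]
  | mem x hx =>
    obtain ⟨s, t, h1, h2, h3, h4, rfl⟩ := hx
    lift t to ℕ using h3
    rw [evalAt_mono, Finset.sum_eq_single t]
    · simp [fib_mono]
    · intro k _ hk
      rw [fib_mono, if_neg (by exact_mod_cast hk.symm), zero_mul]
    · intro h
      exact absurd (Finset.mem_range.2 (by omega)) h

/-! ### Averages over a fibre -/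

theorem diffContOnCl_div {g P : ℂ → ℂ} (hg : Differentiable ℂ g) (hP : Differentiable ℂ P)
    (h0 : ∀ w, ‖w‖ ≤ 1 → P w ≠ 0) :
    DiffContOnCl ℂ (fun w => g w / P w) (Metric.ball 0 |1|) := by
  refine DifferentiableOn.diffContOnCl fun w hw => ?_
  rw [abs_one, closure_ball _ one_ne_zero] at hw
  exact (hg.differentiableAt.div hP.differentiableAt
    (h0 w (by simpa using hw))).differentiableWithinAt

theorem circleAverage_div {g P : ℂ → ℂ} (hg : Differentiable ℂ g) (hP : Differentiable ℂ P)
    (h0 : ∀ w, ‖w‖ ≤ 1 → P w ≠ 0) :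
    circleAverage (fun w => g w / P w) 0 1 = g 0 / P 0 :=
  (diffContOnCl_div hg hP h0).circleAverage

theorem circleAverage_pow_div {P : ℂ → ℂ} (hP : Differentiable ℂ P)
    (h0 : ∀ w, ‖w‖ ≤ 1 → P w ≠ 0) {k : ℕ} (hk : k ≠ 0) :
    circleAverage (fun w => w ^ k / P w) 0 1 = 0 := by
  rw [circleAverage_div (differentiable_pow k) hP h0]
  simp [hk]

theorem one_sub_mul_conj_ne_zero {w w₁ : ℂ} (hw : ‖w‖ ≤ 1) (hw₁ : ‖w₁‖ < 1) :
    1 - w * conj w₁ ≠ 0 := by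
  intro h
  have h1 : ‖w * conj w₁‖ = 1 := by rw [← sub_eq_zero.1 h]; simp
  rw [norm_mul, Complex.norm_conj] at h1
  nlinarith [norm_nonneg w, norm_nonneg w₁]

/-- A Christoffel–Darboux kernel reproduces polynomials for the weight `1 / |P|²`. -/
theorem circleAverage_kernel {P : ℂ → ℂ} (hP : Differentiable ℂ P)
    (h0 : ∀ w, ‖w‖ ≤ 1 → P w ≠ 0) {M : ℕ} (a : ℕ → ℂ) {w₁ : ℂ} (hw₁ : ‖w₁‖ < 1)
    (C : ℂ → ℂ) (c : ℂ)
    (hC : ∀ w, ‖w‖ = 1 → (1 - w * conj w₁) * C w = P w * conj (P w₁) - c * w ^ M * conj (P w)) :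
    circleAverage (fun w => conj (C w) * (∑ i ∈ Finset.range M, a i * w ^ i) /
      (P w * conj (P w))) 0 1 = ∑ i ∈ Finset.range M, a i * w₁ ^ i := by
  set h : ℂ → ℂ := fun w => ∑ i ∈ Finset.range M, a i * w ^ i with hh
  have hhd : Differentiable ℂ h := by rw [hh]; fun_prop
  set g : ℂ → ℂ := fun w => ∑ i ∈ Finset.range M, conj (a i) * w ^ (M - i) with hg
  have hgd : Differentiable ℂ g := by rw [hg]; fun_prop
  set Q : ℂ → ℂ := fun w => P w * (1 - w * conj w₁) with hQ
  have hQd : Differentiable ℂ Q := by rw [hQ]; fun_prop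
  have hQ0 : ∀ w, ‖w‖ ≤ 1 → Q w ≠ 0 := fun w hw =>
    mul_ne_zero (h0 w hw) (one_sub_mul_conj_ne_zero hw hw₁)
  have hgc : ∀ w : ℂ, ‖w‖ = 1 → w ^ M * conj (h w) = g w := by
    intro w hw
    have hw0 := ne_zero_of_norm_one hw
    simp only [hh, hg, map_sum, Finset.mul_sum]
    refine Finset.sum_congr rfl fun i hi => ?_
    rw [map_mul, map_pow, ← Complex.inv_eq_conj hw, pow_sub₀ _ hw0 (Finset.mem_range.1 hi).le,
      inv_pow]
    ring
  -- The integrand splits into P(w₁) times the Cauchy integrand of h/P at w₁, and a multiple of the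
  -- conjugate of g/Q. On the circle g = w^M h̄; as h has degree below M, g/Q is holomorphic and
  -- zero at the origin, so the second part averages to zero.
  have h1 : circleAverage (fun w => conj (C w) * h w / (P w * conj (P w))) 0 1 =
      circleAverage (fun w => P w₁ * (((w - 0) / (w - w₁)) • (h w / P w)) -
        conj c * conj (g w / Q w)) 0 1 := by
    refine circleAverage_congr_unit fun w hw => ?_
    have hw0 := ne_zero_of_norm_one hw
    have hPw := h0 w hw.le
    have hd := one_sub_mul_conj_ne_zero hw.le hw₁
    have hd' : 1 - conj w * w₁ ≠ 0 := by
      have := (map_ne_zero (starRingEnd ℂ)).2 hd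
      simpa using this
    have hPc : conj (P w) ≠ 0 := (map_ne_zero _).2 hPw
    have e1 : conj (C w) = (conj (P w) * P w₁ - conj c * conj w ^ M * P w) /
        (1 - conj w * w₁) := by
      rw [eq_div_iff hd', mul_comm]
      have := congrArg conj (hC w hw)
      simpa using this
    have e2 : conj (g w / Q w) = conj w ^ M * h w / (conj (P w) * (1 - conj w * w₁)) := by
      rw [← hgc w hw]
      simp [hQ]
    have e3 : (w - 0) / (w - w₁) = 1 / (1 - conj w * w₁) := by
      have : w - w₁ = w * (1 - conj w * w₁) := by
        rw [← Complex.inv_eq_conj hw]; field_simp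
      rw [this, sub_zero]; field_simp
    rw [e1, e2, e3, smul_eq_mul]
    field_simp
  have hcont : ∀ w, ‖w‖ = 1 → w - w₁ ≠ 0 := by
    intro w hw hww
    rw [sub_eq_zero.1 hww] at hw
    exact absurd hw hw₁.ne
  have i1 : CircleIntegrable (fun w => P w₁ * (((w - 0) / (w - w₁)) • (h w / P w))) 0 1 := by
    refine ContinuousOn.circleIntegrable zero_le_one ?_
    have hs : ∀ w ∈ Metric.sphere (0 : ℂ) 1, ‖w‖ = 1 := fun w hw => by simpa using hw
    refine continuousOn_const.mul (ContinuousOn.smul (ContinuousOn.div (by fun_prop) (by fun_prop)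
      fun w hw => hcont w (hs w hw)) (ContinuousOn.div hhd.continuous.continuousOn
      hP.continuous.continuousOn fun w hw => h0 w (hs w hw).le))
  have i2 : CircleIntegrable (fun w => conj c * conj (g w / Q w)) 0 1 := by
    refine ContinuousOn.circleIntegrable zero_le_one ?_
    have hs : ∀ w ∈ Metric.sphere (0 : ℂ) 1, ‖w‖ = 1 := fun w hw => by simpa using hw
    exact continuousOn_const.mul (Complex.continuous_conj.comp_continuousOn
      (ContinuousOn.div hgd.continuous.continuousOn
      hQd.continuous.continuousOn fun w hw => hQ0 w (hs w hw).le))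
  rw [h1, Real.circleAverage_fun_sub i1 i2]
  have e1 : circleAverage (fun w => P w₁ * (((w - 0) / (w - w₁)) • (h w / P w))) 0 1 = h w₁ := by
    have := (diffContOnCl_div hhd hP h0).circleAverage_smul_div (w := w₁) (by simpa using hw₁)
    simp only [← smul_eq_mul (P w₁)]
    rw [Real.circleAverage_fun_smul, this, smul_eq_mul]
    field_simp [h0 w₁ hw₁.le]
  have e2 : circleAverage (fun w => conj c * conj (g w / Q w)) 0 1 = 0 := by
    simp only [← smul_eq_mul (conj c)]
    rw [Real.circleAverage_fun_smul, circleAverage_conj, circleAverage_div hgd hQd hQ0]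
    have : g 0 = 0 := Finset.sum_eq_zero fun i hi => by
      have := Finset.mem_range.1 hi
      rw [zero_pow (by omega), mul_zero]
    simp [this]
  rw [e1, e2, sub_zero]

/-- Multiplication by 1 - u v takes differences of coefficients along diagonals; the vanishing
conditions on the border remove the boundary terms. In this form coefficient identities become
Christoffel–Darboux formulas. -/
theorem double_sum_shift (x : ℤ → ℤ → ℂ) (M : ℕ) (h1 : ∀ k, x (-1) k = 0) (h2 : ∀ b, x b (-1) = 0)
    (h3 : ∀ k : ℕ, k ≤ M → x M k = 0) (h4 : ∀ b : ℕ, b ≤ M → x b M = 0) (u v : ℂ) :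
    (1 - u * v) * ∑ b ∈ Finset.range M, ∑ k ∈ Finset.range M, x b k * u ^ b * v ^ k =
      ∑ b ∈ Finset.range (M + 1), ∑ k ∈ Finset.range (M + 1),
        (x b k - x (b - 1) (k - 1)) * u ^ b * v ^ k := by
  simp only [sub_mul, Finset.sum_sub_distrib, one_mul]
  congr 1
  · rw [Finset.sum_range_succ, Finset.sum_eq_zero (s := Finset.range (M + 1)) fun k hk => by
      rw [h3 k (Nat.lt_succ_iff.1 (Finset.mem_range.1 hk)), zero_mul, zero_mul], add_zero]
    refine Finset.sum_congr rfl fun b hb => ?_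
    rw [Finset.sum_range_succ, h4 b (Finset.mem_range.1 hb).le, zero_mul, zero_mul, add_zero]
  · rw [Finset.sum_range_succ']
    simp only [Finset.sum_range_succ' _ M]
    simp only [Nat.cast_zero, zero_sub, h1, h2, zero_mul, Finset.sum_const_zero, add_zero,
      Nat.cast_add, Nat.cast_one, add_sub_cancel_right, Finset.mul_sum]
    refine Finset.sum_congr rfl fun b _ => Finset.sum_congr rfl fun k _ => ?_
    ring

theorem sum_mul_pow_eq_zero {M : ℕ} {a : ℕ → ℂ}
    (h : ∀ w : ℂ, ‖w‖ < 1 → ∑ k ∈ Finset.range M, a k * w ^ k = 0) {k : ℕ} (hk : k < M) :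
    a k = 0 := by
  set q : Polynomial ℂ := ∑ k ∈ Finset.range M, Polynomial.C (a k) * Polynomial.X ^ k with hq
  have hq0 : q = 0 := by
    refine Polynomial.eq_zero_of_infinite_isRoot q ?_
    refine Set.Infinite.mono (s := Metric.ball (0 : ℂ) 1) ?_ ?_
    · intro w hw
      have := h w (by simpa using hw)
      simp only [Set.mem_ofPred_eq, Polynomial.IsRoot, hq, Polynomial.eval_finsetSum]
      simpa using this
    · exact (infinite_of_mem_nhds 0 (Metric.ball_mem_nhds _ one_pos))
  have := congrArg (fun r => Polynomial.coeff r k) hq0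
  simpa [hq, Polynomial.finsetSum_coeff, Polynomial.coeff_C_mul, Polynomial.coeff_X_pow, hk]
    using this

/-! ### Weights of the form |p|². -/

/-- `t = |p|²` on the torus, where `p` has no zeros on `𝕋 × 𝔻̄` and nonnegative degrees in `w`. -/
structure Factors (t p : Laurent) (n m : ℕ) : Prop where
  mem : p ∈ rect 0 n 0 m
  ne_zero : ∀ z w : ℂ, ‖z‖ = 1 → ‖w‖ ≤ 1 → evalAt p z w ≠ 0
  eq : ∀ z w : ℂ, ‖z‖ = 1 → ‖w‖ = 1 → evalAt t z w = evalAt p z w * conj (evalAt p z w)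

theorem differentiable_evalAt {a b d : ℤ} {p : Laurent} (hp : p ∈ rect a b 0 d) (z : ℂ) :
    Differentiable ℂ (evalAt p z) := by
  have hp' : p ∈ rect a b 0 ((d.toNat + 1 : ℕ) - 1) :=
    rect_mono le_rfl le_rfl le_rfl (by push_cast; omega) hp
  have : evalAt p z = fun w => ∑ k ∈ Finset.range (d.toNat + 1), fib z k p * w ^ k :=
    funext fun w => evalAt_eq_sum_fib hp' z w
  rw [this]
  fun_prop

section Factors

variable {t p : Laurent} {n m : ℕ} (h : Factors t p n m)
include h

theorem Factors.torusPos : TorusPos t := by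
  intro z w hz hw
  rw [h.eq z w hz hw, Complex.mul_conj]
  exact_mod_cast Complex.normSq_pos.2 (h.ne_zero z w hz hw.le)

theorem Factors.ipw_eq (f g : Laurent) : ipw t f g = circleAverage (fun z =>
    circleAverage (fun w => conj (evalAt f z w) * evalAt g z w /
      (evalAt p z w * conj (evalAt p z w))) 0 1) 0 1 := by
  rw [ipw, torusAverage_eq]
  refine circleAverage_congr_unit fun z hz => circleAverage_congr_unit fun w hw => ?_
  rw [h.eq z w hz hw]

/-- Conjugate p cancels against the weight and leaves w^k / p, which is holomorphic in the disc for
each z and zero at w = 0. No restriction on l is needed. -/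
theorem Factors.ipw_p_mono (l k : ℤ) (hk : 0 < k) : ipw t p (mono l k) = 0 := by
  lift k to ℕ using hk.le
  rw [h.ipw_eq]
  rw [circleAverage_congr_unit (g := fun _ => 0), Real.circleAverage_const]
  intro z hz
  rw [circleAverage_congr_unit (g := fun w => z ^ l • (w ^ k / evalAt p z w)),
    Real.circleAverage_fun_smul, circleAverage_pow_div (differentiable_evalAt h.mem z)
    (fun w => h.ne_zero z w hz) (by omega), smul_zero]
  intro w hw
  have h0 := h.ne_zero z w hz hw.le
  have h1 : conj (evalAt p z w) ≠ 0 := (map_ne_zero _).2 h0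
  rw [evalAt_mono, smul_eq_mul, zpow_natCast]
  field_simp

theorem Factors.ipw_p_p (l : ℤ) : ipw t p (mono l 0 * p) = if l = 0 then 1 else 0 := by
  rw [ipw, torusAverage_congr (G := fun z w => z ^ l * w ^ (0 : ℤ)), torusAverage_mono]
  · simp
  · intro z w hz hw
    have h0 := h.ne_zero z w hz hw.le
    have h1 : conj (evalAt p z w) ≠ 0 := (map_ne_zero _).2 h0
    rw [h.eq z w hz hw, evalAt_mul _ _ (ne_zero_of_norm_one hz) (ne_zero_of_norm_one hw),
      evalAt_mono]
    field_simp

end Factors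

theorem torusCont_of_factors {t p : Laurent} {n m : ℕ} (h : Factors t p n m) (f g : Laurent)
    {z : ℂ} (hz : ‖z‖ = 1) :
    CircleIntegrable (fun w => conj (evalAt f z w) * evalAt g z w /
      (evalAt p z w * conj (evalAt p z w))) 0 1 := by
  refine TorusCont.circleIntegrable (F := fun z w => conj (evalAt f z w) * evalAt g z w /
      (evalAt p z w * conj (evalAt p z w))) ?_ hz
  exact ((torusCont_evalAt f).conj.mul (torusCont_evalAt g)).div
    ((torusCont_evalAt p).mul (torusCont_evalAt p).conj)
    fun z w hz hw => mul_ne_zero (h.ne_zero z w hz hw.le)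
      ((map_ne_zero _).2 (h.ne_zero z w hz hw.le))

/-- A fibre average independent of z has only its zeroth Fourier coefficient in z. Fibrewise
relations thus give orthogonality of all z-shifts. -/
theorem Factors.ipw_of_fibre {t p : Laurent} {n m : ℕ} (h : Factors t p n m) {f g : Laurent} (c : ℂ)
    (hfg : ∀ z, ‖z‖ = 1 → circleAverage (fun w => conj (evalAt f z w) * evalAt g z w /
      (evalAt p z w * conj (evalAt p z w))) 0 1 = c) (l : ℤ) :
    ipw t f (mono l 0 * g) = if l = 0 then c else 0 := by
  rw [h.ipw_eq, circleAverage_congr_unit (g := fun z => c • z ^ l)]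
  · rw [Real.circleAverage_fun_smul, circleAverage_zpow]
    split_ifs <;> simp
  · intro z hz
    rw [circleAverage_congr_unit (g := fun w => z ^ l • (conj (evalAt f z w) * evalAt g z w /
      (evalAt p z w * conj (evalAt p z w)))), Real.circleAverage_fun_smul, hfg z hz, smul_eq_mul,
      smul_eq_mul, mul_comm]
    intro w hw
    rw [evalAt_mul _ _ (ne_zero_of_norm_one hz) (ne_zero_of_norm_one hw), evalAt_mono, smul_eq_mul,
      zpow_zero]
    ring

theorem sum_conj_reverse {M : ℕ} (a : ℕ → ℂ) {w : ℂ} (hw : ‖w‖ = 1) :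
    ∑ b ∈ Finset.range (M + 1), conj (a (M - b)) * w ^ b =
      w ^ M * conj (∑ b ∈ Finset.range (M + 1), a b * w ^ b) := by
  rw [← Finset.sum_range_reflect, map_sum, Finset.mul_sum]
  refine Finset.sum_congr rfl fun b hb => ?_
  have hb' : b ≤ M := Nat.lt_succ_iff.1 (Finset.mem_range.1 hb)
  have e1 : M + 1 - 1 - b = M - b := by omega
  have e2 : M - (M - b) = b := by omega
  rw [e1, e2, map_mul, map_pow, ← Complex.inv_eq_conj hw,
    pow_sub₀ _ (ne_zero_of_norm_one hw) hb', inv_pow]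
  ring

/-- Laurent polynomials whose fibre kernel is the Christoffel–Darboux kernel of `p` are
orthonormal on each fibre for the weight `1 / |p|²`. -/
theorem Factors.fibre_orthonormal {t p : Laurent} {n m : ℕ} (h : Factors t p n m) {d : ℕ}
    (f : Fin d → Laurent) (hf : ∀ i, f i ∈ rect 0 n 0 (m - 1))
    (hind : ∀ z : ℂ, ‖z‖ = 1 → ∀ c : Fin d → ℂ, (∀ k : ℤ, ∑ i, c i * fib z k (f i) = 0) →
      ∀ i, c i = 0)
    (hstar : ∀ z : ℂ, ‖z‖ = 1 → ∀ b k : ℤ, (∑ i, fib z b (f i) * conj (fib z k (f i))) -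
      (∑ i, fib z (b - 1) (f i) * conj (fib z (k - 1) (f i))) =
      fib z b p * conj (fib z k p) - conj (fib z (m - b) p) * fib z (m - k) p)
    (a b : Fin d) {z : ℂ} (hz : ‖z‖ = 1) :
    circleAverage (fun w => conj (evalAt (f a) z w) * evalAt (f b) z w /
      (evalAt p z w * conj (evalAt p z w))) 0 1 = if a = b then 1 else 0 := by
  have hpm : p ∈ rect 0 n 0 ((m + 1 : ℕ) - 1) := by simpa using h.mem
  -- By `hstar` the kernel Σ f_i(w) conj f_i(w₁) satisfies the hypothesis of `circleAverage_kernel`,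
  -- so it reproduces f_b. The constant c there is the conjugate of the reversed polynomial at w₁.
  have key : ∀ w₁ : ℂ, ‖w₁‖ < 1 → ∑ i, evalAt (f i) z w₁ * circleAverage (fun w =>
      conj (evalAt (f i) z w) * evalAt (f b) z w / (evalAt p z w * conj (evalAt p z w))) 0 1 =
      evalAt (f b) z w₁ := by
    intro w₁ hw₁
    have := circleAverage_kernel (M := m) (differentiable_evalAt h.mem z)
      (fun w => h.ne_zero z w hz) (fun k => fib z k (f b)) hw₁
      (fun w => ∑ i, evalAt (f i) z w * conj (evalAt (f i) z w₁))
      (∑ k ∈ Finset.range (m + 1), fib z (m - k) p * conj w₁ ^ k) ?_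
    · rw [← evalAt_eq_sum_fib (hf b)] at this
      rw [← this]
      rw [circleAverage_congr_unit (f := fun w => conj (∑ i, evalAt (f i) z w * _) * _ / _)
        (g := fun w => ∑ i, evalAt (f i) z w₁ • (conj (evalAt (f i) z w) * evalAt (f b) z w /
        (evalAt p z w * conj (evalAt p z w))))]
      · rw [Real.circleAverage_fun_sum
          fun i _ => (torusCont_of_factors h (f i) (f b) hz).const_fun_smul]
        exact Finset.sum_congr rfl fun i _ => by rw [Real.circleAverage_fun_smul, smul_eq_mul]
      · intro w hw
        rw [← evalAt_eq_sum_fib (hf b), map_sum, Finset.sum_mul, Finset.sum_div]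
        refine Finset.sum_congr rfl fun i _ => ?_
        simp only [map_mul, Complex.conj_conj, smul_eq_mul]
        ring
    · intro w hw
      have h1 : ∑ i, evalAt (f i) z w * conj (evalAt (f i) z w₁) =
          ∑ b ∈ Finset.range m, ∑ k ∈ Finset.range m,
            (∑ i, fib z b (f i) * conj (fib z k (f i))) * w ^ b * conj w₁ ^ k := by
        simp only [Finset.sum_mul]
        rw [Finset.sum_congr rfl fun b _ => Finset.sum_comm, Finset.sum_comm]
        refine Finset.sum_congr rfl fun i _ => ?_
        rw [evalAt_eq_sum_fib (hf i), evalAt_eq_sum_fib (hf i), map_sum, Finset.sum_mul_sum]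
        refine Finset.sum_congr rfl fun b _ => Finset.sum_congr rfl fun k _ => ?_
        simp only [map_mul, map_pow]
        ring
      have hz' : ∀ k : ℤ, ¬(0 ≤ k ∧ k ≤ (m : ℤ) - 1) → ∀ i, fib z k (f i) = 0 :=
        fun k hk i => fib_eq_zero (hf i) z hk
      rw [h1, double_sum_shift (fun b k => ∑ i, fib z b (f i) * conj (fib z k (f i))) m
        (fun k => Finset.sum_eq_zero fun i _ => by rw [hz' _ (by omega), zero_mul])
        (fun k => Finset.sum_eq_zero fun i _ => by rw [hz' (-1) (by omega), map_zero, mul_zero])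
        (fun k _ => Finset.sum_eq_zero fun i _ => by rw [hz' _ (by omega), zero_mul])
        (fun k _ => Finset.sum_eq_zero fun i _ => by rw [hz' m (by omega), map_zero, mul_zero])]
      simp only [hstar z hz]
      rw [evalAt_eq_sum_fib hpm z w₁, mul_assoc, evalAt_eq_sum_fib hpm z w,
        ← sum_conj_reverse (fun b => fib z b p) hw, map_sum, Finset.sum_mul_sum,
        mul_comm (∑ k ∈ Finset.range (m + 1), fib z (m - k) p * conj w₁ ^ k), Finset.sum_mul_sum,
        ← Finset.sum_sub_distrib]
      refine Finset.sum_congr rfl fun b hb => ?_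
      rw [← Finset.sum_sub_distrib]
      refine Finset.sum_congr rfl fun k _ => ?_
      rw [Nat.cast_sub (Nat.lt_succ_iff.1 (Finset.mem_range.1 hb))]
      simp only [map_mul, map_pow]
      ring
  set G : Fin d → ℂ := fun i => circleAverage (fun w =>
      conj (evalAt (f i) z w) * evalAt (f b) z w / (evalAt p z w * conj (evalAt p z w))) 0 1
  -- Reproduction reads Σ_i G_i f_i = f_b on the fibre; independence of the f_i on the fibre
  -- identifies the G_i.
  have h2 := hind z hz (fun i => G i - if i = b then 1 else 0) fun k => ?_
  · exact sub_eq_zero.1 (h2 a)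
  · by_cases hk : 0 ≤ k ∧ k ≤ (m : ℤ) - 1
    · lift k to ℕ using hk.1
      refine sum_mul_pow_eq_zero (M := m) (a := fun k : ℕ =>
        ∑ i, (G i - if i = b then 1 else 0) * fib z k (f i)) (fun w hw => ?_) (by omega)
      simp only [Finset.sum_mul]
      rw [Finset.sum_comm]
      have h3 := key w hw
      have h4 : ∀ i, ∑ k ∈ Finset.range m, (G i - if i = b then 1 else 0) * fib z k (f i) * w ^ k =
          (G i - if i = b then 1 else 0) * evalAt (f i) z w := by
        intro i
        rw [evalAt_eq_sum_fib (hf i), Finset.mul_sum]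
        exact Finset.sum_congr rfl fun k _ => mul_assoc _ _ _
      rw [Finset.sum_congr rfl fun i _ => h4 i]
      simp only [sub_mul, Finset.sum_sub_distrib, ite_mul, one_mul, zero_mul,
        Finset.sum_ite_eq', Finset.mem_univ, if_true]
      rw [sub_eq_zero, ← h3]
      exact Finset.sum_congr rfl fun i _ => mul_comm _ _
    · exact Finset.sum_eq_zero fun i _ => by rw [fib_eq_zero (hf i) z hk, mul_zero]

/-! ### The dual system of a factorized weight -/

/-- The coefficient of `w ^ k`, as a Laurent polynomial in `z`. -/
def row (k : ℤ) : Laurent →ₗ[ℂ] Laurent :=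
  Finsupp.linearCombination ℂ (fun e : ℤ × ℤ => if e.2 = k then mono e.1 0 else 0) ∘ₗ
    (AddMonoidAlgebra.coeffLinearEquiv ℂ).toLinearMap

theorem row_mono (k i j : ℤ) : row k (mono i j) = if j = k then mono i 0 else 0 := by
  simp [row, mono]

theorem evalAt_row (k : ℤ) (f : Laurent) (z w : ℂ) : evalAt (row k f) z w = fib z k f := by
  induction f using laurent_induction with
  | zero => simp
  | add f g hf hg => simp [evalAt_add, hf, hg]
  | mono c a b =>
    rw [map_smul, map_smul, row_mono, fib_mono, evalAt_smul, smul_eq_mul]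
    split_ifs <;> simp [evalAt_mono]

theorem row_mem {a b c d : ℤ} {f : Laurent} (hf : f ∈ rect a b c d) (k : ℤ) :
    row k f ∈ rect a b 0 0 := by
  induction hf using Submodule.span_induction with
  | zero => simp
  | add x y _ _ hx hy => rw [map_add]; exact add_mem hx hy
  | smul r x _ hx => rw [map_smul]; exact Submodule.smul_mem _ _ hx
  | mem x hx =>
    obtain ⟨s, t, h1, h2, h3, h4, rfl⟩ := hx
    rw [row_mono]
    split_ifs
    · exact mono_mem_rect h1 h2 le_rfl le_rfl
    · exact zero_mem _

theorem row_eq_zero {a b c d : ℤ} {f : Laurent} (hf : f ∈ rect a b c d) {k : ℤ}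
    (hk : ¬(c ≤ k ∧ k ≤ d)) : row k f = 0 :=
  eq_zero_of_evalAt fun z w _ _ => by rw [evalAt_row, fib_eq_zero hf z hk]

theorem sub_row_zero_mem {a b d : ℤ} {f : Laurent} (hf : f ∈ rect a b 0 d) :
    f - row 0 f ∈ rect a b 1 d := by
  induction hf using Submodule.span_induction with
  | zero => simp
  | add x y _ _ hx hy =>
    rw [map_add, add_sub_add_comm]; exact add_mem hx hy
  | smul r x _ hx => rw [map_smul, ← smul_sub]; exact Submodule.smul_mem _ _ hx
  | mem x hx =>
    obtain ⟨s, t, h1, h2, h3, h4, rfl⟩ := hx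
    rw [row_mono]
    split_ifs with h
    · subst h; simp
    · rw [sub_zero]; exact mono_mem_rect h1 h2 (by omega) h4

theorem mul_mem_rect {a b c d a' b' c' d' : ℤ} {f g : Laurent} (hf : f ∈ rect a b c d)
    (hg : g ∈ rect a' b' c' d') : f * g ∈ rect (a + a') (b + b') (c + c') (d + d') := by
  induction hf using Submodule.span_induction with
  | zero => simp
  | add x y _ _ hx hy => rw [add_mul]; exact add_mem hx hy
  | smul r x _ hx => rw [smul_mul_assoc]; exact Submodule.smul_mem _ _ hx
  | mem x hx =>
    obtain ⟨s, t, h1, h2, h3, h4, rfl⟩ := hx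
    induction hg using Submodule.span_induction with
    | zero => simp
    | add x y _ _ hx hy => rw [mul_add]; exact add_mem hx hy
    | smul r x _ hx => rw [mul_smul_comm]; exact Submodule.smul_mem _ _ hx
    | mem y hy =>
      obtain ⟨s', t', h1', h2', h3', h4', rfl⟩ := hy
      rw [mul_mono]
      exact mono_mem_rect (by omega) (by omega) (by omega) (by omega)

theorem starRefl_mem_rect {a b c d : ℤ} {f : Laurent} (hf : f ∈ rect a b c d) :
    starRefl f ∈ rect (-b) (-a) (-d) (-c) := by
  rw [mem_rect_iff] at hf ⊢
  intro s t h
  rw [coeff_starRefl, hf _ _ (by omega), map_zero]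

/-- The Christoffel–Darboux numerator coefficients. -/
def cdNum (p : Laurent) (m : ℕ) (b k : ℤ) : Laurent :=
  -- Here p has formal degree m + 1 in w, so that the resulting kernel has degree m and reproduces
  -- all of 1, w, ..., w^m.
  row b p * starRefl (row k p) - starRefl (row (m + 1 - b) p) * row (m + 1 - k) p

/-- The coefficient of the Christoffel–Darboux kernel of degree `m` of `p`. -/
def cdCoeff (p : Laurent) (m : ℕ) (b k : ℤ) : Laurent :=
  -- Summation down a diagonal is division of the numerator by 1 - w w̄₁; terms with a negative
  -- index vanish.
  ∑ j ∈ Finset.range (m + 2), cdNum p m (b - j) (k - j)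

/-- The Laurent polynomial dual to `w ^ k` for the weight `1 / |p|²`. -/
def dualPoly (p : Laurent) (m : ℕ) (k : ℤ) : Laurent :=
  ∑ b ∈ Finset.range (m + 1), mono 0 b * cdCoeff p m b k

theorem cdNum_mem {p : Laurent} {n m : ℕ} (hp : p ∈ rect 0 n 0 m) (b k : ℤ) :
    cdNum p m b k ∈ rect (-n) n 0 0 := by
  have h1 := mul_mem_rect (row_mem hp b) (starRefl_mem_rect (row_mem hp k))
  have h2 := mul_mem_rect (starRefl_mem_rect (row_mem hp (m + 1 - b))) (row_mem hp (m + 1 - k))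
  refine sub_mem ?_ ?_
  · simpa using h1
  · simpa using h2

theorem cdCoeff_mem {p : Laurent} {n m : ℕ} (hp : p ∈ rect 0 n 0 m) (b k : ℤ) :
    cdCoeff p m b k ∈ rect (-n) n 0 0 :=
  Submodule.sum_mem _ fun _ _ => cdNum_mem hp _ _

/-- In w-degree 0 only the summand j = 0 survives, and there the reversed term contains the
coefficient of w^(m+1) in p, which is zero. So both polynomials have the constant term p₀ conj p_k
in w. -/
theorem dualPoly_sub_mem {p : Laurent} {n m : ℕ} (hp : p ∈ rect 0 n 0 m) (k : ℕ) :
    dualPoly p m k - p * starRefl (row k p) ∈ rect (-n) n 1 m := by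
  have h0 : cdCoeff p m (0 : ℕ) k = row 0 p * starRefl (row k p) := by
    rw [cdCoeff, Finset.sum_range_succ', Finset.sum_eq_zero, zero_add]
    · simp only [cdNum, Nat.cast_zero, sub_zero]
      rw [row_eq_zero hp (k := m + 1) (by omega)]
      simp
    · intro j _
      rw [cdNum, row_eq_zero hp (by push_cast; omega), row_eq_zero hp
        (k := m + 1 - (((0 : ℕ) : ℤ) - ((j + 1 : ℕ) : ℤ))) (by push_cast; omega)]
      simp
  rw [dualPoly, Finset.sum_range_succ', h0, Nat.cast_zero, mono_zero_mul]
  have h1 : (∑ b ∈ Finset.range m, mono 0 (b + 1 : ℕ) * cdCoeff p m (b + 1 : ℕ) k) +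
      row 0 p * starRefl (row k p) - p * starRefl (row k p) =
      (∑ b ∈ Finset.range m, mono 0 (b + 1 : ℕ) * cdCoeff p m (b + 1 : ℕ) k) -
      (p - row 0 p) * starRefl (row k p) := by ring
  rw [h1]
  refine sub_mem (Submodule.sum_mem _ fun b hb => ?_) ?_
  · have := mul_mem_rect (mono_mem_rect (a := 0) (b := 0) (c := (b + 1 : ℕ)) (d := (b + 1 : ℕ))
      (le_refl 0) (le_refl 0) le_rfl le_rfl) (cdCoeff_mem hp (b + 1 : ℕ) k)
    have hb' := Finset.mem_range.1 hb
    exact rect_mono (by omega) (by omega) (by push_cast; omega) (by push_cast; omega) this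
  · have := mul_mem_rect (sub_row_zero_mem hp) (starRefl_mem_rect (row_mem hp k))
    simpa using this

/-- The values of `cdNum` on a fibre. -/
def cdNumVal (p : Laurent) (m : ℕ) (z : ℂ) (b k : ℤ) : ℂ :=
  fib z b p * conj (fib z k p) - conj (fib z (m + 1 - b) p) * fib z (m + 1 - k) p

theorem evalAt_cdCoeff (p : Laurent) (m : ℕ) (b k : ℤ) {z w : ℂ} (hz : ‖z‖ = 1) (hw : ‖w‖ = 1) :
    evalAt (cdCoeff p m b k) z w = ∑ j ∈ Finset.range (m + 2), cdNumVal p m z (b - j) (k - j) := by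
  have hz0 := ne_zero_of_norm_one hz
  have hw0 := ne_zero_of_norm_one hw
  rw [cdCoeff, evalAt_eq_evLin, map_sum]
  refine Finset.sum_congr rfl fun j _ => ?_
  rw [← evalAt_eq_evLin, cdNum, evalAt_sub, evalAt_mul _ _ hz0 hw0, evalAt_mul _ _ hz0 hw0,
    evalAt_starRefl _ hz hw, evalAt_starRefl _ hz hw]
  simp only [evalAt_row]
  rfl

section

variable {p : Laurent} {n m : ℕ} (hp : p ∈ rect 0 n 0 m) (z : ℂ)
include hp

theorem cdNumVal_of_neg {b k : ℤ} (h : b < 0 ∨ k < 0) : cdNumVal p m z b k = 0 := by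
  rcases h with h | h
  · rw [cdNumVal, fib_eq_zero hp z (k := b) (by omega),
      fib_eq_zero hp z (k := m + 1 - b) (by omega)]
    simp
  · rw [cdNumVal, fib_eq_zero hp z (k := k) (by omega),
      fib_eq_zero hp z (k := m + 1 - k) (by omega)]
    simp

omit hp in
theorem cdNumVal_antisymm (b k : ℤ) :
    cdNumVal p m z (m + 1 - k) (m + 1 - b) = -cdNumVal p m z b k := by
  simp only [cdNumVal, sub_sub_cancel]
  ring

omit hp in
theorem cdNumVal_conj (b k : ℤ) : conj (cdNumVal p m z b k) = cdNumVal p m z k b := by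
  simp only [cdNumVal, map_sub, map_mul, Complex.conj_conj]
  ring

/-- The map (b, k) ↦ (m + 1 - k, m + 1 - b) reverses this diagonal and changes the sign of the
numerator, so the sum equals its negative. This is divisibility of the numerator by 1 - w w̄₁: the
kernel has no terms of degree m + 1. -/
theorem sum_cdNumVal_last (k : ℕ) (hk : k ≤ m + 1) :
    ∑ j ∈ Finset.range (m + 2), cdNumVal p m z ((m + 1 : ℕ) - j) (k - j) = 0 := by
  have h1 : ∑ j ∈ Finset.range (m + 2), cdNumVal p m z ((m + 1 : ℕ) - j) (k - j) =
      ∑ j ∈ Finset.range (k + 1), cdNumVal p m z ((m + 1 : ℕ) - j) (k - j) := by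
    refine (Finset.sum_subset (Finset.range_subset_range.2 (by omega)) fun j _ hj => ?_).symm
    rw [Finset.mem_range] at hj
    exact cdNumVal_of_neg hp z (Or.inr (by omega))
  rw [h1]
  have h2 := Finset.sum_range_reflect
    (fun j : ℕ => cdNumVal p m z ((m + 1 : ℕ) - j) (k - j)) (k + 1)
  have h3 : ∑ j ∈ Finset.range (k + 1),
      cdNumVal p m z ((m + 1 : ℕ) - ((k + 1 - 1 - j : ℕ) : ℤ)) (k - ((k + 1 - 1 - j : ℕ) : ℤ)) =
      -∑ j ∈ Finset.range (k + 1), cdNumVal p m z ((m + 1 : ℕ) - j) (k - j) := by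
    rw [← Finset.sum_neg_distrib]
    refine Finset.sum_congr rfl fun j hj => ?_
    have := Finset.mem_range.1 hj
    rw [← cdNumVal_antisymm]
    congr 1 <;> push_cast [Nat.cast_sub (show j ≤ k by omega)] <;> ring
  rw [h3] at h2
  exact self_eq_neg.1 h2.symm

theorem sum_cdNumVal_last' (k : ℕ) (hk : k ≤ m + 1) :
    ∑ j ∈ Finset.range (m + 2), cdNumVal p m z (k - j) ((m + 1 : ℕ) - j) = 0 := by
  have := congrArg conj (sum_cdNumVal_last hp z k hk)
  rw [map_sum, map_zero] at this
  simpa only [cdNumVal_conj] using this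

theorem sum_cdNumVal_sub (b k : ℤ) (hb : b ≤ m + 1) :
    (∑ j ∈ Finset.range (m + 2), cdNumVal p m z (b - j) (k - j)) -
      ∑ j ∈ Finset.range (m + 2), cdNumVal p m z (b - 1 - j) (k - 1 - j) =
      cdNumVal p m z b k := by
  have h := Finset.sum_range_sub' (fun j : ℕ => cdNumVal p m z (b - j) (k - j)) (m + 2)
  rw [cdNumVal_of_neg hp z (b := b - (m + 2 : ℕ)) (Or.inl (by push_cast; omega))] at h
  rw [← Finset.sum_sub_distrib]
  simpa [sub_sub, add_comm] using h

end

/-- On a fibre the dual polynomials are the coefficients, in powers of w̄₁, of the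
Christoffel–Darboux kernel. That kernel reproduces w^i, and comparison of powers of w₁ gives
biorthogonality. -/
theorem Factors.ipw_dualPoly {t p : Laurent} {n m : ℕ} (h : Factors t p n m) (k i : ℕ)
    (hk : k ≤ m) (hi : i ≤ m) (l : ℤ) :
    ipw t (dualPoly p m k) (mono l i) = if l = 0 then (if k = i then 1 else 0) else 0 := by
  have h1 : mono l i = mono l 0 * mono 0 i := by rw [mul_mono]; simp
  rw [h1]
  refine h.ipw_of_fibre _ (fun z hz => ?_) l
  have hpm : p ∈ rect 0 n 0 ((m + 2 : ℕ) - 1) :=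
    rect_mono le_rfl le_rfl le_rfl (by push_cast; omega) h.mem
  set τ : ℤ → ℤ → ℂ := fun b k =>
    ∑ j ∈ Finset.range (m + 2), cdNumVal p m z (b - j) (k - j) with hτ
  have hT : ∀ (k : ℕ) (w : ℂ), ‖w‖ = 1 → evalAt (dualPoly p m k) z w =
      ∑ b ∈ Finset.range (m + 1), τ b k * w ^ b := by
    intro k w hw
    rw [dualPoly, evalAt_eq_evLin, map_sum]
    refine Finset.sum_congr rfl fun b _ => ?_
    rw [← evalAt_eq_evLin, evalAt_mul _ _ (ne_zero_of_norm_one hz) (ne_zero_of_norm_one hw),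
      evalAt_cdCoeff p m b k hz hw, evalAt_mono]
    simp [hτ, mul_comm]
  have key : ∀ w₁ : ℂ, ‖w₁‖ < 1 → ∑ k ∈ Finset.range (m + 1), circleAverage (fun w =>
      conj (evalAt (dualPoly p m k) z w) * evalAt (mono 0 i) z w /
        (evalAt p z w * conj (evalAt p z w))) 0 1 * w₁ ^ k = w₁ ^ i := by
    intro w₁ hw₁
    have := circleAverage_kernel (M := m + 1) (differentiable_evalAt h.mem z)
      (fun w => h.ne_zero z w hz) (fun k => if k = i then 1 else 0) hw₁
      (fun w => ∑ b ∈ Finset.range (m + 1), ∑ k ∈ Finset.range (m + 1),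
        τ b k * w ^ b * conj w₁ ^ k)
      (∑ k ∈ Finset.range (m + 2), fib z ((m + 1 : ℕ) - k) p * conj w₁ ^ k) ?_
    · have hs : ∀ w : ℂ, ∑ k ∈ Finset.range (m + 1), (if k = i then 1 else 0) * w ^ k = w ^ i := by
        intro w
        simp [Nat.lt_succ_of_le hi]
      rw [hs] at this
      rw [← this]
      rw [circleAverage_congr_unit (f := fun w => conj (∑ b ∈ Finset.range (m + 1), _) * _ / _)
        (g := fun w => ∑ k ∈ Finset.range (m + 1), w₁ ^ k •
        (conj (evalAt (dualPoly p m k) z w) * evalAt (mono 0 i) z w /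
        (evalAt p z w * conj (evalAt p z w))))]
      · rw [Real.circleAverage_fun_sum
          fun (k : ℕ) _ => (torusCont_of_factors h (dualPoly p m k) (mono 0 i) hz).const_fun_smul]
        exact Finset.sum_congr rfl fun i _ => by
          rw [Real.circleAverage_fun_smul, smul_eq_mul, mul_comm]
      · intro w hw
        rw [hs, Finset.sum_comm, map_sum, Finset.sum_mul, Finset.sum_div]
        refine Finset.sum_congr rfl fun k _ => ?_
        rw [hT k w hw, evalAt_mono, ← Finset.sum_mul]
        simp only [map_mul, map_pow, Complex.conj_conj, smul_eq_mul, zpow_zero, one_mul,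
          zpow_natCast]
        ring
    · intro w hw
      rw [double_sum_shift τ (m + 1)
        (fun k => Finset.sum_eq_zero fun j _ => cdNumVal_of_neg h.mem z (Or.inl (by omega)))
        (fun b => Finset.sum_eq_zero fun j _ => cdNumVal_of_neg h.mem z (Or.inr (by omega)))
        (fun k hk => sum_cdNumVal_last h.mem z k hk)
        (fun k hk => sum_cdNumVal_last' h.mem z k hk)]
      rw [evalAt_eq_sum_fib hpm z w₁, mul_assoc, evalAt_eq_sum_fib hpm z w,
        ← sum_conj_reverse (fun b => fib z b p) hw, map_sum, Finset.sum_mul_sum,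
        mul_comm (∑ k ∈ Finset.range (m + 2), _ * conj w₁ ^ k), Finset.sum_mul_sum,
        ← Finset.sum_sub_distrib]
      refine Finset.sum_congr rfl fun b hb => ?_
      rw [← Finset.sum_sub_distrib]
      refine Finset.sum_congr rfl fun k _ => ?_
      have hb' : b ≤ m + 1 := Nat.lt_succ_iff.1 (Finset.mem_range.1 hb)
      have hτs : τ b k - τ (b - 1) (k - 1) = cdNumVal p m z b k :=
        sum_cdNumVal_sub h.mem z b k (by exact_mod_cast hb')
      rw [hτs, cdNumVal, Nat.cast_sub hb']
      simp only [map_mul, map_pow, Nat.cast_add, Nat.cast_one]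
      ring
  have h2 := sum_mul_pow_eq_zero (M := m + 1) (a := fun k : ℕ => circleAverage (fun w =>
      conj (evalAt (dualPoly p m k) z w) * evalAt (mono 0 i) z w /
        (evalAt p z w * conj (evalAt p z w))) 0 1 - if k = i then 1 else 0) (fun w hw => ?_)
      (Nat.lt_succ_of_le hk)
  · exact sub_eq_zero.1 h2
  · simp only [sub_mul, Finset.sum_sub_distrib, ite_mul, one_mul, zero_mul, Finset.sum_ite_eq',
      Finset.mem_range, Nat.lt_succ_of_le hi, if_true]
    rw [key w hw, sub_self]

/-! ### Orthogonal complements and reproducing kernels -/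

section Kernel

variable {t : Laurent} (ht : TorusPos t)

/-- `A ⊖ B` for the weight `1 / t`. -/
def wOminus (A B : Submodule ℂ Laurent) : Submodule ℂ Laurent where
  carrier := {f | f ∈ A ∧ ∀ g ∈ B, ipw t g f = 0}
  zero_mem' := ⟨A.zero_mem, fun g _ => ipw_zero_right g⟩
  add_mem' := fun ha hb => ⟨A.add_mem ha.1 hb.1, fun g hg => by
    rw [ipw_add_right ht, ha.2 g hg, hb.2 g hg, add_zero]⟩
  smul_mem' := fun c f hf => ⟨A.smul_mem c hf.1, fun g hg => by
    rw [ipw_smul_right, hf.2 g hg, mul_zero]⟩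

variable {ht}

theorem wOminus_le {A B : Submodule ℂ Laurent} : wOminus ht A B ≤ A := fun _ hf => hf.1

theorem ipw_wOminus_left {A B : Submodule ℂ Laurent} {f g : Laurent} (hf : f ∈ wOminus ht A B)
    (hg : g ∈ B) : ipw t f g = 0 := ipw_eq_zero_symm ht (hf.2 g hg)

theorem wOminus_sup {A B : Submodule ℂ Laurent} [FiniteDimensional ℂ B] (hBA : B ≤ A) :
    wOminus ht A B ⊔ B = A := by
  refine le_antisymm (sup_le wOminus_le hBA) fun f hf => ?_
  obtain ⟨g, hg, h⟩ := exists_ipw_projection ht B f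
  exact Submodule.mem_sup.2 ⟨f - g, ⟨A.sub_mem hf (hBA hg), h⟩, g, hg, sub_add_cancel _ _⟩

theorem disjoint_of_ipw {A B : Submodule ℂ Laurent} (ht : TorusPos t)
    (h : ∀ f ∈ A, ∀ g ∈ B, ipw t f g = 0) : Disjoint A B := by
  rw [Submodule.disjoint_def]
  exact fun f hA hB => eq_zero_of_ipw_self ht (h f hA f hB)

theorem finiteDimensional_of_le_rect {A : Submodule ℂ Laurent} {a b c d : ℤ}
    (h : A ≤ rect a b c d) : FiniteDimensional ℂ A :=
  Submodule.finiteDimensional_of_le h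

theorem finrank_sup_of_ipw {A B : Submodule ℂ Laurent} [FiniteDimensional ℂ A]
    [FiniteDimensional ℂ B] (ht : TorusPos t) (h : ∀ f ∈ A, ∀ g ∈ B, ipw t f g = 0) :
    Module.finrank ℂ (A ⊔ B : Submodule ℂ Laurent) =
      Module.finrank ℂ A + Module.finrank ℂ B := by
  have := Submodule.finrank_sup_add_finrank_inf_eq A B
  rw [(disjoint_of_ipw ht h).eq_bot, finrank_bot] at this
  omega

theorem finrank_wOminus {A B : Submodule ℂ Laurent} [FiniteDimensional ℂ A]
    [FiniteDimensional ℂ B] (hBA : B ≤ A) :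
    Module.finrank ℂ (wOminus ht A B) + Module.finrank ℂ B = Module.finrank ℂ A := by
  have : FiniteDimensional ℂ (wOminus ht A B) := Submodule.finiteDimensional_of_le wOminus_le
  rw [← finrank_sup_of_ipw ht fun f hf g hg => ipw_wOminus_left hf hg, wOminus_sup hBA]

theorem mem_of_mem_sup_of_ipw {A B : Submodule ℂ Laurent} (ht : TorusPos t)
    (h : ∀ f ∈ A, ∀ g ∈ B, ipw t f g = 0) {f : Laurent} (hf : f ∈ A ⊔ B)
    (hfB : ∀ g ∈ B, ipw t f g = 0) : f ∈ A := by
  obtain ⟨a, ha, b, hb, rfl⟩ := Submodule.mem_sup.1 hf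
  have h1 := hfB b hb
  rw [ipw_add_left ht, h a ha b hb, zero_add] at h1
  rw [eq_zero_of_ipw_self ht h1, add_zero]
  exact ha

theorem ipw_sup_left {A B : Submodule ℂ Laurent} (ht : TorusPos t) {g : Laurent}
    (hA : ∀ f ∈ A, ipw t f g = 0) (hB : ∀ f ∈ B, ipw t f g = 0) :
    ∀ f ∈ A ⊔ B, ipw t f g = 0 := by
  intro f hf
  obtain ⟨a, ha, b, hb, rfl⟩ := Submodule.mem_sup.1 hf
  rw [ipw_add_left ht, hA a ha, hB b hb, add_zero]

theorem ipw_sup_right {A B : Submodule ℂ Laurent} (ht : TorusPos t) {g : Laurent}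
    (hA : ∀ f ∈ A, ipw t g f = 0) (hB : ∀ f ∈ B, ipw t g f = 0) :
    ∀ f ∈ A ⊔ B, ipw t g f = 0 := by
  intro f hf
  obtain ⟨a, ha, b, hb, rfl⟩ := Submodule.mem_sup.1 hf
  rw [ipw_add_right ht, hA a ha, hB b hb, add_zero]

theorem map_rect (i j a b c d : ℤ) :
    (rect a b c d).map (mulMono i j) = rect (a + i) (b + i) (c + j) (d + j) := by
  refine le_antisymm ?_ fun f hf => ?_
  · rintro _ ⟨f, hf, rfl⟩
    exact (mono_mul_mem_rect i j).2 hf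
  · refine ⟨mono (-i) (-j) * f, ?_, ?_⟩
    · have := (mono_mul_mem_rect (-i) (-j)).2 hf
      simpa using this
    · rw [mulMono_apply, mono_mul_mono_mul, add_neg_cancel, add_neg_cancel, mono_zero_mul]

theorem mulMono_injective (i j : ℤ) : Function.Injective (mulMono i j) := by
  intro f g h
  have := congrArg (fun f => mono (-i) (-j) * f) h
  simpa [mulMono_apply, mono_mul_mono_mul, mono_zero_mul] using this

variable (ht) in
/-- An orthonormal basis for the weight `1 / t`. -/
def wBasis (V : Submodule ℂ Laurent) [FiniteDimensional ℂ V] :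
    Fin (Module.finrank ℂ V) → Laurent := (exists_ipw_basis ht V).choose

theorem wBasis_mem (V : Submodule ℂ Laurent) [FiniteDimensional ℂ V]
    (i : Fin (Module.finrank ℂ V)) : wBasis ht V i ∈ V :=
  (exists_ipw_basis ht V).choose_spec.1 i

theorem ipw_wBasis (V : Submodule ℂ Laurent) [FiniteDimensional ℂ V]
    (i j : Fin (Module.finrank ℂ V)) :
    ipw t (wBasis ht V i) (wBasis ht V j) = if i = j then 1 else 0 :=
  (exists_ipw_basis ht V).choose_spec.2.1 i j

theorem wBasis_sum (V : Submodule ℂ Laurent) [FiniteDimensional ℂ V] {f : Laurent} (hf : f ∈ V) :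
    f = ∑ i, ipw t (wBasis ht V i) f • wBasis ht V i :=
  (exists_ipw_basis ht V).choose_spec.2.2 f hf

variable (ht) in
/-- The reproducing kernel of `V`, evaluated at a pair of functionals. -/
def kern (V : Submodule ℂ Laurent) [FiniteDimensional ℂ V] (φ ψ : Laurent →ₗ[ℂ] ℂ) : ℂ :=
  ∑ i, φ (wBasis ht V i) * conj (ψ (wBasis ht V i))

theorem exists_riesz (V : Submodule ℂ Laurent) [FiniteDimensional ℂ V] (ht : TorusPos t)
    (ψ : Laurent →ₗ[ℂ] ℂ) : ∃ r ∈ V, ∀ v ∈ V, ipw t r v = ψ v := by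
  refine ⟨∑ i, conj (ψ (wBasis ht V i)) • wBasis ht V i,
    V.sum_mem fun i _ => V.smul_mem _ (wBasis_mem V i), fun v hv => ?_⟩
  have h1 : ∀ f g, ipw t f g = ipwForm ht f g := fun _ _ => rfl
  rw [h1, map_sum, LinearMap.sum_apply]
  conv_rhs => rw [wBasis_sum (ht := ht) V hv]
  rw [map_sum]
  refine Finset.sum_congr rfl fun i _ => ?_
  simp [← h1, mul_comm]

/-- This frees the kernel from the choice of basis: it is φ evaluated at the Riesz representer of ψ.
The later kernel identities transport representers. -/
theorem kern_eq (V : Submodule ℂ Laurent) [FiniteDimensional ℂ V] (φ ψ : Laurent →ₗ[ℂ] ℂ)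
    {r : Laurent} (hr : r ∈ V) (h : ∀ v ∈ V, ipw t r v = ψ v) : kern ht V φ ψ = φ r := by
  conv_rhs => rw [wBasis_sum (ht := ht) V hr]
  rw [map_sum, kern]
  refine Finset.sum_congr rfl fun i _ => ?_
  rw [map_smul, smul_eq_mul, ← ipw_conj ht, h _ (wBasis_mem V i), mul_comm]

theorem kern_sup (A B C : Submodule ℂ Laurent) [FiniteDimensional ℂ A] [FiniteDimensional ℂ B]
    [FiniteDimensional ℂ C] (hC : A ⊔ B = C) (h : ∀ f ∈ A, ∀ g ∈ B, ipw t f g = 0)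
    (φ ψ : Laurent →ₗ[ℂ] ℂ) : kern ht C φ ψ = kern ht A φ ψ + kern ht B φ ψ := by
  obtain ⟨a, ha, ha'⟩ := exists_riesz A ht ψ
  obtain ⟨b, hb, hb'⟩ := exists_riesz B ht ψ
  rw [kern_eq A φ ψ ha ha', kern_eq B φ ψ hb hb', ← map_add]
  refine kern_eq C φ ψ (hC ▸ Submodule.add_mem_sup ha hb) fun v hv => ?_
  rw [← hC] at hv
  obtain ⟨x, hx, y, hy, rfl⟩ := Submodule.mem_sup.1 hv
  rw [ipw_add_left ht, ipw_add_right ht, ipw_add_right ht, h a ha y hy,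
    ipw_eq_zero_symm ht (h x hx b hb), ha' x hx, hb' y hy, map_add, add_zero, zero_add]

theorem kern_span_singleton {p : Laurent} (hp : ipw t p p = 1) (φ ψ : Laurent →ₗ[ℂ] ℂ) :
    kern ht (Submodule.span ℂ {p}) φ ψ = φ p * conj (ψ p) := by
  rw [kern_eq (r := conj (ψ p) • p) _ φ ψ
    (Submodule.smul_mem _ _ (Submodule.mem_span_singleton_self p))]
  · rw [map_smul, smul_eq_mul, mul_comm]
  · intro v hv
    obtain ⟨c, rfl⟩ := Submodule.mem_span_singleton.1 hv
    rw [ipw_smul_left ht, ipw_smul_right, hp, map_smul]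
    simp [mul_comm]

theorem conj_zpow_mul_zpow {z : ℂ} (hz : ‖z‖ = 1) (i : ℤ) : conj (z ^ i) * z ^ i = 1 := by
  rw [mul_comm, Complex.mul_conj, Complex.normSq_eq_norm_sq]
  simp [hz]

/-- Multiplication by a monomial is unitary, and z^i enters the kernel only through z^i conj(z^i) =
1. In particular K₂ and z K₂ have the same kernel on a fibre. -/
theorem kern_map (V V' : Submodule ℂ Laurent) [FiniteDimensional ℂ V] [FiniteDimensional ℂ V']
    {i j : ℤ} (hV : V.map (mulMono i j) = V') {z : ℂ} (hz : ‖z‖ = 1) (b k : ℤ) :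
    kern ht V' (fib z b) (fib z k) = kern ht V (fib z (b - j)) (fib z (k - j)) := by
  have hz0 := ne_zero_of_norm_one hz
  obtain ⟨r, hr, hr'⟩ := exists_riesz V ht (fib z (k - j))
  rw [kern_eq V _ _ hr hr', kern_eq V' _ _ (r := conj (z ^ i) • (mono i j * r))]
  · rw [map_smul, fib_mono_mul hz0, smul_eq_mul, ← mul_assoc, conj_zpow_mul_zpow hz, one_mul]
  · exact V'.smul_mem _ (hV ▸ ⟨r, hr, rfl⟩)
  · rw [← hV]
    rintro _ ⟨v, hv, rfl⟩
    rw [mulMono_apply, ipw_smul_left ht, ipw_shift, hr' v hv, fib_mono_mul hz0, Complex.conj_conj]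

/-! ### Reflection and its effect on kernels. -/

/-- Reflection of polynomials of degree `(N, M)`. -/
def reflect (N M : ℤ) (f : Laurent) : Laurent := mono N M * starRefl f

theorem reflect_reflect (N M : ℤ) (f : Laurent) : reflect N M (reflect N M f) = f := by
  refine sub_eq_zero.1 (eq_zero_of_evalAt fun z w hz hw => ?_)
  have hz0 := ne_zero_of_norm_one hz
  have hw0 := ne_zero_of_norm_one hw
  have h1 := conj_zpow_mul_zpow hz N
  have h2 := conj_zpow_mul_zpow hw M
  simp only [reflect]
  rw [evalAt_sub, evalAt_mul _ _ hz0 hw0, evalAt_starRefl _ hz hw, evalAt_mul _ _ hz0 hw0,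
    evalAt_starRefl _ hz hw, evalAt_mono]
  simp only [map_mul, Complex.conj_conj]
  linear_combination (evalAt f z w * conj (w ^ M) * w ^ M) * h1 + evalAt f z w * h2

theorem reflect_mem {N M a b c d : ℤ} {f : Laurent} (hf : f ∈ rect a b c d) :
    reflect N M f ∈ rect (N - b) (N - a) (M - d) (M - c) := by
  have := (mono_mul_mem_rect N M).2 (starRefl_mem_rect hf)
  refine rect_mono ?_ ?_ ?_ ?_ this <;> omega

theorem reflect_mono (N M s k : ℤ) : reflect N M (mono s k) = mono (N - s) (M - k) := by
  rw [reflect, starRefl_mono, mul_mono]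
  rfl

theorem reflect_mono_mul (N M l : ℤ) (f : Laurent) :
    reflect N M (mono l 0 * f) = mono (-l) 0 * reflect N M f := by
  refine sub_eq_zero.1 (eq_zero_of_evalAt fun z w hz hw => ?_)
  have hz0 := ne_zero_of_norm_one hz
  have hw0 := ne_zero_of_norm_one hw
  simp only [reflect]
  rw [evalAt_sub, evalAt_mul _ _ hz0 hw0, evalAt_starRefl _ hz hw, evalAt_mul _ _ hz0 hw0,
    evalAt_mul _ _ hz0 hw0, evalAt_mul _ _ hz0 hw0, evalAt_starRefl _ hz hw]
  simp only [evalAt_mono, map_mul, map_zpow₀, ← Complex.inv_eq_conj hz, inv_zpow, zpow_neg,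
    zpow_zero, map_one]
  ring

theorem ipw_reflect (N M : ℤ) (f g : Laurent) :
    ipw t (reflect N M f) (reflect N M g) = ipw t g f := by
  rw [reflect, reflect, ipw_shift]
  refine torusAverage_congr fun z w hz hw => ?_
  rw [evalAt_starRefl _ hz hw, evalAt_starRefl _ hz hw, Complex.conj_conj, mul_comm]

theorem fib_reflect {z : ℂ} (hz : ‖z‖ = 1) (N M k : ℤ) (f : Laurent) :
    fib z k (reflect N M f) = z ^ N * conj (fib z (M - k) f) := by
  rw [reflect, fib_mono_mul (ne_zero_of_norm_one hz), fib_starRefl hz, neg_sub]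

/-- Reflection is an antiunitary map of 𝓟_{N,M} onto itself exchanging the coefficients of w^k and
w^(M-k). -/
theorem kern_rect_reflect (N M : ℤ) {z : ℂ} (hz : ‖z‖ = 1) (b k : ℤ) :
    kern ht (rect 0 N 0 M) (fib z b) (fib z k) =
      conj (kern ht (rect 0 N 0 M) (fib z (M - b)) (fib z (M - k))) := by
  have hm : ∀ f ∈ rect 0 N 0 M, reflect N M f ∈ rect 0 N 0 M := fun f hf => by
    simpa using reflect_mem (N := N) (M := M) hf
  obtain ⟨r, hr, hr'⟩ := exists_riesz (rect 0 N 0 M) ht (fib z (M - k))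
  rw [kern_eq _ _ _ hr hr', kern_eq (rect 0 N 0 M) _ _ (r := conj (z ^ N) • reflect N M r)]
  · rw [map_smul, fib_reflect hz, smul_eq_mul, ← mul_assoc, conj_zpow_mul_zpow hz, one_mul]
  · exact Submodule.smul_mem _ _ (hm r hr)
  · intro v hv
    rw [ipw_smul_left ht, Complex.conj_conj]
    conv_lhs => rw [← reflect_reflect N M v]
    rw [ipw_reflect, ← ipw_conj ht, hr' _ (hm v hv), fib_reflect hz, map_mul,
      Complex.conj_conj, sub_sub_cancel, ← mul_assoc, mul_comm (z ^ N), conj_zpow_mul_zpow hz,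
      one_mul]

end Kernel

/-! ### Fibres of the top-degree polynomials -/

section Fibre

variable {t : Laurent} {ht : TorusPos t}

/-- Multiplication by `z - z₀`. -/
def mulSub (z₀ : ℂ) : Laurent →ₗ[ℂ] Laurent := mulMono 1 0 - z₀ • LinearMap.id

theorem mulSub_apply (z₀ : ℂ) (f : Laurent) : mulSub z₀ f = mono 1 0 * f - z₀ • f := rfl

/-- Division with remainder by ζ - z, for the variable ζ: it suffices that ζ - z divides ζ^s - z^s.
-/
theorem sub_sum_fib_mem {n : ℕ} {M : ℕ} {z : ℂ} {f : Laurent} (hf : f ∈ rect 0 n 0 (M - 1)) :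
    f - ∑ k ∈ Finset.range M, fib z k f • mono 0 k ∈ (rect 0 (n - 1) 0 (M - 1)).map (mulSub z) := by
  induction hf using Submodule.span_induction with
  | zero => simp
  | add x y _ _ hx hy =>
    simp only [map_add, add_smul, Finset.sum_add_distrib]
    rw [add_sub_add_comm]
    exact add_mem hx hy
  | smul r x _ hx =>
    simp only [map_smul, smul_eq_mul, mul_smul, ← Finset.smul_sum]
    rw [← smul_sub]
    exact Submodule.smul_mem _ _ hx
  | mem x hx =>
    obtain ⟨s, t, h1, h2, h3, h4, rfl⟩ := hx
    lift t to ℕ using h3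
    lift s to ℕ using h1
    have hs : ∑ k ∈ Finset.range M, fib z k (mono s t) • mono 0 k = z ^ s • mono 0 t := by
      rw [Finset.sum_eq_single t]
      · simp [fib_mono]
      · intro k _ hk
        rw [fib_mono, if_neg (by exact_mod_cast hk.symm), zero_smul]
      · intro h
        exact absurd (Finset.mem_range.2 (by omega)) h
    rw [hs]
    clear hs
    induction s with
    | zero => simp
    | succ s ih =>
      have h5 : mulSub z (mono s t) = mono (s + 1 : ℕ) t - z • mono s t := by
        rw [mulSub_apply, mul_mono, zero_add]
        congr 2
        push_cast; ring
      have h6 : mono (s + 1 : ℕ) t - z ^ (s + 1) • mono 0 t =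
          mulSub z (mono s t) + z • (mono s t - z ^ s • mono 0 t) := by
        rw [h5, pow_succ', mul_smul, smul_sub]
        abel
      rw [h6]
      refine add_mem ⟨_, mono_mem_rect (by omega) (by push_cast at h2; omega) (by omega) h4, rfl⟩
        (Submodule.smul_mem _ _ (ih (by push_cast at h2; omega)))

/-- Let ζ be the variable. Then ζ g = z g + (ζ - z) g with orthogonal summands, while ζ g and z g
have the same norm; hence the second summand is zero. -/
theorem mulSub_eq_zero_of_ipw {V : Submodule ℂ Laurent} {z : ℂ} (hz : ‖z‖ = 1) {g : Laurent}
    (hg : g ∈ V) (ht : TorusPos t) (h : ∀ v ∈ V, ipw t v (mulSub z g) = 0) : mulSub z g = 0 := by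
  have h1 : mono 1 0 * g = mulSub z g + z • g := by rw [mulSub_apply]; abel
  have h2 := ipw_shift (t := t) 1 0 g g
  have h3 := h g hg
  have h5 : conj z * z = 1 := by simpa using conj_zpow_mul_zpow hz 1
  rw [h1, ipw_add_left ht, ipw_add_right ht, ipw_add_right ht, ipw_smul_left ht, ipw_smul_left ht,
    ipw_smul_right, ipw_smul_right, h3, ipw_eq_zero_symm ht h3] at h2
  exact eq_zero_of_ipw_self ht (by linear_combination h2 - ipw t g g * h5)

theorem fib_mulSub {z : ℂ} (hz : ‖z‖ = 1) (k : ℤ) (f : Laurent) : fib z k (mulSub z f) = 0 := by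
  rw [mulSub_apply, map_sub, map_smul, fib_mono_mul (ne_zero_of_norm_one hz)]
  simp

/-- The kernel of restriction to a fibre consists of the multiples of ζ - z, none of which but 0 is
orthogonal to 𝓟_{n-1,M-1}. Together with `exists_fib_eq`, restriction is a bijection onto
polynomials in w of degree below M. -/
theorem eq_zero_of_fib {n M : ℕ} {z : ℂ} (hz : ‖z‖ = 1) {d : Laurent}
    (hd : d ∈ wOminus ht (rect 0 n 0 (M - 1)) (rect 0 (n - 1) 0 (M - 1)))
    (h : ∀ k : ℤ, fib z k d = 0) : d = 0 := by
  have h1 := sub_sum_fib_mem (z := z) hd.1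
  simp only [h, zero_smul, Finset.sum_const_zero, sub_zero] at h1
  obtain ⟨g, hg, rfl⟩ := h1
  exact mulSub_eq_zero_of_ipw hz hg ht hd.2

theorem exists_fib_eq {n M : ℕ} {z : ℂ} (hz : ‖z‖ = 1) {f : Laurent}
    (hf : f ∈ rect 0 n 0 (M - 1)) :
    ∃ d ∈ wOminus ht (rect 0 n 0 (M - 1)) (rect 0 (n - 1) 0 (M - 1)),
      ∀ k : ℤ, fib z k d = fib z k f := by
  set D := wOminus ht (rect 0 n 0 (M - 1)) (rect 0 (n - 1) 0 (M - 1))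
  set Q := (rect 0 (n - 1) 0 (M - 1)).map (mulSub z)
  have hle : rect 0 (n - 1) 0 (M - 1) ≤ rect 0 n 0 (M - 1) :=
    rect_mono le_rfl (by omega) le_rfl le_rfl
  have hQ : Q ≤ rect 0 n 0 (M - 1) := by
    rintro _ ⟨g, hg, rfl⟩
    refine sub_mem ?_ (Submodule.smul_mem _ _ (hle hg))
    have := (mono_mul_mem_rect 1 0).2 hg
    exact rect_mono (by omega) (by omega) (by omega) (by omega) this
  have hDf : FiniteDimensional ℂ D := Submodule.finiteDimensional_of_le wOminus_le
  have hdisj : D ⊓ Q = ⊥ := by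
    rw [← disjoint_iff, Submodule.disjoint_def]
    rintro _ hd ⟨g, hg, rfl⟩
    exact mulSub_eq_zero_of_ipw hz hg ht hd.2
  have hinj : Function.Injective (mulSub z) := by
    rw [← LinearMap.ker_eq_bot, LinearMap.ker_eq_bot']
    intro x hx
    rw [mulSub_apply, sub_eq_zero] at hx
    exact eq_zero_of_mono_mul_eq_smul one_ne_zero hx
  have h1 : Module.finrank ℂ D + _ = _ := finrank_wOminus (ht := ht) hle
  have h2 : Module.finrank ℂ Q = Module.finrank ℂ (rect 0 (n - 1) 0 (M - 1)) :=
    (Submodule.equivMapOfInjective _ hinj _).finrank_eq.symm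
  have h3 := Submodule.finrank_sup_add_finrank_inf_eq D Q
  rw [hdisj, finrank_bot, h2] at h3
  -- D has the dimension complementary to 𝓟_{n-1,M-1}, which ζ - z maps injectively onto Q; as D
  -- meets Q trivially, they fill the whole space.
  have h4 : D ⊔ Q = rect 0 n 0 (M - 1) :=
    Submodule.eq_of_le_of_finrank_eq (sup_le wOminus_le hQ) (by omega)
  rw [← h4] at hf
  obtain ⟨d, hd, _, ⟨g, -, rfl⟩, rfl⟩ := Submodule.mem_sup.1 hf
  exact ⟨d, hd, fun k => by rw [map_add, fib_mulSub hz, add_zero]⟩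

end Fibre

/-! ### The split-shift condition for a weight -/

/-- `𝓔¹_{N,m}` for the weight `1 / t`. -/
def eSpace {t : Laurent} (ht : TorusPos t) (N : ℤ) (m : ℕ) : Submodule ℂ Laurent :=
  wOminus ht (rect 0 N 0 m) (rect 0 N 1 m)

/-- A pair of subspaces as in the split-shift orthogonality condition. -/
structure SplitPair {t : Laurent} (ht : TorusPos t) (n m : ℕ) (K₁ K₂ : Submodule ℂ Laurent) :
    Prop where
  sup : eSpace ht (n - 1) m = K₁ ⊔ K₂
  orth : ∀ f ∈ K₁, ∀ g ∈ K₂, ipw t f g = 0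
  orth_shift : ∀ f ∈ K₁, ∀ g ∈ K₂.map (mulMono 1 0), ipw t f g = 0
  left_le : K₁ ≤ eSpace ht n m
  right_le : K₂.map (mulMono 1 0) ≤ eSpace ht n m

theorem finrank_rect_row (N : ℕ) : Module.finrank ℂ (rect 0 ((N : ℤ) - 1) 0 0) = N := by
  have hli : LinearIndependent ℂ fun i : Fin N => mono (i : ℤ) 0 := by
    rw [Fintype.linearIndependent_iff]
    intro c hc i
    have := congrArg (fun f : Laurent => f.coeff ((i : ℤ), 0)) hc
    simpa [mono, Finsupp.single_apply, Fin.val_inj] using this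
  have h := finrank_span_eq_card hli
  rw [Fintype.card_fin] at h
  have h2 : Submodule.span ℂ (Set.range fun i : Fin N => mono (i : ℤ) 0) =
      rect 0 ((N : ℤ) - 1) 0 0 := by
    rw [rect]
    congr 1
    ext f
    constructor
    · rintro ⟨i, rfl⟩
      exact ⟨i, 0, by omega, by omega, le_rfl, le_rfl, rfl⟩
    · rintro ⟨s, t, h1, h2, h3, h4, rfl⟩
      lift s to ℕ using h1
      obtain rfl : t = 0 := le_antisymm h4 h3
      exact ⟨⟨s, by omega⟩, rfl⟩
  rw [← h2, h]

theorem finrank_rect_split (N : ℤ) (m : ℕ) : Module.finrank ℂ (rect 0 N 0 m) =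
    Module.finrank ℂ (rect 0 N 0 0) + Module.finrank ℂ (rect 0 N 1 m) := by
  have h1 : rect 0 N 0 0 ⊔ rect 0 N 1 m = rect 0 N 0 m := by
    refine le_antisymm (sup_le (rect_mono le_rfl le_rfl le_rfl (by omega))
      (rect_mono le_rfl le_rfl (by omega) le_rfl)) fun f hf => ?_
    exact Submodule.mem_sup.2 ⟨row 0 f, row_mem hf 0, f - row 0 f, sub_row_zero_mem hf,
      add_sub_cancel _ _⟩
  have h2 : rect 0 N 0 0 ⊓ rect 0 N 1 m = ⊥ := by
    rw [← disjoint_iff, Submodule.disjoint_def]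
    intro f h1 h2
    rw [mem_rect_iff] at h1 h2
    ext ⟨s, k⟩
    by_cases hk : k = 0
    · exact h2 s k (by omega)
    · exact h1 s k (by omega)
  have h3 := Submodule.finrank_sup_add_finrank_inf_eq (rect 0 N 0 0) (rect 0 N 1 m)
  rw [h2, finrank_bot, h1] at h3
  omega

section

variable {t : Laurent} {ht : TorusPos t} {n m : ℕ}

instance (N : ℤ) (m : ℕ) : FiniteDimensional ℂ (eSpace ht N m) :=
  Submodule.finiteDimensional_of_le wOminus_le

theorem finrank_eSpace (ht : TorusPos t) (N m : ℕ) :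
    Module.finrank ℂ (eSpace ht ((N : ℤ) - 1) m) = N := by
  have h1 : Module.finrank ℂ (eSpace ht ((N : ℤ) - 1) m) + _ = _ :=
    finrank_wOminus (ht := ht) (A := rect 0 ((N : ℤ) - 1) 0 m) (B := rect 0 ((N : ℤ) - 1) 1 m)
      (rect_mono le_rfl le_rfl (by omega) le_rfl)
  rw [finrank_rect_split, finrank_rect_row] at h1
  omega

theorem eSpace_sup (ht : TorusPos t) (N : ℤ) (m : ℕ) :
    eSpace ht N m ⊔ rect 0 N 1 m = rect 0 N 0 m :=
  wOminus_sup (rect_mono le_rfl le_rfl (by omega) le_rfl)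

variable {K₁ K₂ : Submodule ℂ Laurent}

theorem SplitPair.left_le' (h : SplitPair ht n m K₁ K₂) : K₁ ≤ eSpace ht (n - 1) m :=
  h.sup ▸ le_sup_left

theorem SplitPair.right_le' (h : SplitPair ht n m K₁ K₂) : K₂ ≤ eSpace ht (n - 1) m :=
  h.sup ▸ le_sup_right

/-- The unit vector of `𝓔¹_{n,m} ⊖ (K₁ ⊕ z K₂)`. -/
theorem SplitPair.exists_unit (h : SplitPair ht n m K₁ K₂) : ∃ p ∈ eSpace ht n m,
    ipw t p p = 1 ∧ (∀ f ∈ K₁ ⊔ K₂.map (mulMono 1 0), ipw t f p = 0) ∧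
    (K₁ ⊔ K₂.map (mulMono 1 0)) ⊔ Submodule.span ℂ {p} = eSpace ht n m := by
  have f1 : FiniteDimensional ℂ K₁ := Submodule.finiteDimensional_of_le h.left_le
  have f2 : FiniteDimensional ℂ K₂ := Submodule.finiteDimensional_of_le h.right_le'
  set K := K₁ ⊔ K₂.map (mulMono 1 0)
  have hK : K ≤ eSpace ht n m := sup_le h.left_le h.right_le
  -- Multiplication by z is injective, so both orthogonality conditions on K₁ give dim K = dim K₁ +
  -- dim K₂ = dim 𝓔¹_{n-1,m}.
  have e1 : Module.finrank ℂ K = n := by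
    rw [finrank_sup_of_ipw ht h.orth_shift,
      (Submodule.equivMapOfInjective _ (mulMono_injective 1 0) K₂).finrank_eq.symm,
      ← finrank_sup_of_ipw ht h.orth, ← h.sup, finrank_eSpace]
  have e2 : Module.finrank ℂ (eSpace ht n m) = n + 1 := by
    have := finrank_eSpace ht (n + 1) m
    rwa [Nat.cast_add, Nat.cast_one, add_sub_cancel_right] at this
  have e3 := finrank_wOminus (ht := ht) hK
  have f3 : FiniteDimensional ℂ (wOminus ht (eSpace ht n m) K) :=
    Submodule.finiteDimensional_of_le wOminus_le
  have e4 : Module.finrank ℂ (wOminus ht (eSpace ht n m) K) = 1 := by omega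
  set C := wOminus ht (eSpace ht n m) K
  have hsub : Subsingleton (Fin (Module.finrank ℂ C)) := by rw [e4]; infer_instance
  set i₀ : Fin (Module.finrank ℂ C) := ⟨0, by omega⟩
  have hmem : wBasis ht C i₀ ∈ C := wBasis_mem C i₀
  refine ⟨wBasis ht C i₀, hmem.1, by simp [ipw_wBasis], hmem.2, ?_⟩
  have hC : Submodule.span ℂ {wBasis ht C i₀} = C := by
    refine le_antisymm ((Submodule.span_singleton_le_iff_mem _ _).2 hmem) fun f hf => ?_
    have := wBasis_sum (ht := ht) C hf
    rw [Fintype.sum_subsingleton _ i₀] at this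
    exact Submodule.mem_span_singleton.2 ⟨_, this.symm⟩
  rw [hC, sup_comm, wOminus_sup hK]

/-! ### Kernel identities on a fibre and the absence of zeros. -/

variable (ht) in
/-- `𝓟_{n,M} ⊖ 𝓟_{n-1,M}` for the weight `1 / t`. -/
def topSpace (n M : ℤ) : Submodule ℂ Laurent := wOminus ht (rect 0 n 0 M) (rect 0 (n - 1) 0 M)

instance (n M : ℤ) : FiniteDimensional ℂ (topSpace ht n M) :=
  Submodule.finiteDimensional_of_le wOminus_le

theorem topSpace_sup (ht : TorusPos t) (n M : ℤ) :
    topSpace ht n M ⊔ rect 0 (n - 1) 0 M = rect 0 n 0 M :=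
  wOminus_sup (rect_mono le_rfl (by omega) le_rfl le_rfl)

theorem kern_topSpace (n M : ℤ) (φ ψ : Laurent →ₗ[ℂ] ℂ) : kern ht (rect 0 n 0 M) φ ψ =
    kern ht (topSpace ht n M) φ ψ + kern ht (rect 0 (n - 1) 0 M) φ ψ :=
  kern_sup _ _ _ (topSpace_sup ht n M) (fun _ hf _ hg => ipw_wOminus_left hf hg) φ ψ

theorem kern_topSpace_reflect (n M : ℤ) {z : ℂ} (hz : ‖z‖ = 1) (b k : ℤ) :
    kern ht (topSpace ht n M) (fib z b) (fib z k) =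
      conj (kern ht (topSpace ht n M) (fib z (M - b)) (fib z (M - k))) := by
  have h1 := kern_topSpace (ht := ht) n M (fib z b) (fib z k)
  have h2 := kern_topSpace (ht := ht) n M (fib z (M - b)) (fib z (M - k))
  rw [← sub_eq_iff_eq_add] at h2 h1
  rw [← h1, ← h2, map_sub, ← kern_rect_reflect n M hz, ← kern_rect_reflect (n - 1) M hz]

theorem kern_eSpace (N : ℤ) (m : ℕ) {z : ℂ} (hz : ‖z‖ = 1) (b k : ℤ) :
    kern ht (rect 0 N 0 m) (fib z b) (fib z k) = kern ht (eSpace ht N m) (fib z b) (fib z k) +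
      kern ht (rect 0 N 0 (m - 1)) (fib z (b - 1)) (fib z (k - 1)) := by
  rw [kern_sup _ _ _ (eSpace_sup ht N m) (fun _ hf _ hg => ipw_wOminus_left hf hg)]
  congr 1
  refine kern_map _ _ (i := 0) (j := 1) ?_ hz b k
  rw [map_rect]
  congr 1 <;> ring

/-- The two expressions for the kernel of `𝓟_{n,m} ⊖ 𝓟_{n-1,m}` on a fibre. -/
theorem SplitPair.kern_identity (h : SplitPair ht n m K₁ K₂) {p : Laurent}
    (hp1 : ipw t p p = 1) (hpo : ∀ f ∈ K₁ ⊔ K₂.map (mulMono 1 0), ipw t f p = 0)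
    (hps : (K₁ ⊔ K₂.map (mulMono 1 0)) ⊔ Submodule.span ℂ {p} = eSpace ht n m)
    {z : ℂ} (hz : ‖z‖ = 1) (b k : ℤ) :
    kern ht (topSpace ht n m) (fib z b) (fib z k) = fib z b p * conj (fib z k p) +
      kern ht (topSpace ht n (m - 1)) (fib z (b - 1)) (fib z (k - 1)) := by
  have f1 : FiniteDimensional ℂ K₁ := Submodule.finiteDimensional_of_le h.left_le
  have f2 : FiniteDimensional ℂ K₂ := Submodule.finiteDimensional_of_le h.right_le'
  have e1 := kern_eSpace (ht := ht) n m hz b k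
  have e2 := kern_eSpace (ht := ht) (n - 1) m hz b k
  have e3 := kern_sup _ _ _ hps (fun f hf g hg => by
    obtain ⟨c, rfl⟩ := Submodule.mem_span_singleton.1 hg
    rw [ipw_smul_right, hpo f hf, mul_zero]) (ht := ht) (fib z b) (fib z k)
  -- The kernel of z K₂ becomes that of K₂, so e3 minus e4 leaves only p: the kernels of 𝓔¹_{n,m}
  -- and 𝓔¹_{n-1,m} differ by a term of rank one.
  rw [kern_sup _ _ _ rfl h.orth_shift, kern_map K₂ _ rfl hz, kern_span_singleton hp1,
    sub_zero, sub_zero] at e3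
  have e4 := kern_sup _ _ _ h.sup.symm h.orth (ht := ht) (fib z b) (fib z k)
  have e5 := kern_topSpace (ht := ht) n m (fib z b) (fib z k)
  have e6 := kern_topSpace (ht := ht) n (m - 1) (fib z (b - 1)) (fib z (k - 1))
  linear_combination e1 - e2 + e3 - e4 - e5 + e6

/-- `kern_identity` under reflection. The kernel of 𝓟_{n,m} is reflected in degree m and that of
𝓟_{n,m-1} in degree m - 1, which undoes the shift by one in the indices. -/
theorem SplitPair.kern_identity' (h : SplitPair ht n m K₁ K₂) {p : Laurent}
    (hp1 : ipw t p p = 1) (hpo : ∀ f ∈ K₁ ⊔ K₂.map (mulMono 1 0), ipw t f p = 0)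
    (hps : (K₁ ⊔ K₂.map (mulMono 1 0)) ⊔ Submodule.span ℂ {p} = eSpace ht n m)
    {z : ℂ} (hz : ‖z‖ = 1) (b k : ℤ) :
    kern ht (topSpace ht n m) (fib z b) (fib z k) =
      conj (fib z (m - b) p) * fib z (m - k) p +
      kern ht (topSpace ht n (m - 1)) (fib z b) (fib z k) := by
  rw [kern_topSpace_reflect _ _ hz, h.kern_identity hp1 hpo hps hz, map_add, map_mul,
    Complex.conj_conj, kern_topSpace_reflect n (m - 1) hz b k]
  congr 3 <;> congr 1 <;> ring

theorem sum_sum_kern (V : Submodule ℂ Laurent) [FiniteDimensional ℂ V] {M : ℕ} {n : ℤ}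
    (hV : V ≤ rect 0 n 0 (M - 1)) (z w w₁ : ℂ) :
    ∑ b ∈ Finset.range M, ∑ k ∈ Finset.range M,
      kern ht V (fib z b) (fib z k) * w ^ b * conj w₁ ^ k =
      ∑ i, evalAt (wBasis ht V i) z w * conj (evalAt (wBasis ht V i) z w₁) := by
  simp only [kern, Finset.sum_mul]
  rw [Finset.sum_congr rfl fun b _ => Finset.sum_comm, Finset.sum_comm]
  refine Finset.sum_congr rfl fun i _ => ?_
  have hf := hV (wBasis_mem (ht := ht) V i)
  rw [evalAt_eq_sum_fib hf, evalAt_eq_sum_fib hf, map_sum, Finset.sum_mul_sum]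
  refine Finset.sum_congr rfl fun b _ => Finset.sum_congr rfl fun k _ => ?_
  simp only [map_mul, map_pow]
  ring

theorem kern_eq_zero_left (V : Submodule ℂ Laurent) [FiniteDimensional ℂ V] {M n : ℤ}
    (hV : V ≤ rect 0 n 0 M) (z : ℂ) {b : ℤ} (hb : ¬(0 ≤ b ∧ b ≤ M)) (ψ : Laurent →ₗ[ℂ] ℂ) :
    kern ht V (fib z b) ψ = 0 :=
  Finset.sum_eq_zero fun i _ => by rw [fib_eq_zero (hV (wBasis_mem V i)) z hb, zero_mul]

theorem kern_eq_zero_right (V : Submodule ℂ Laurent) [FiniteDimensional ℂ V] {M n : ℤ}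
    (hV : V ≤ rect 0 n 0 M) (z : ℂ) {b : ℤ} (hb : ¬(0 ≤ b ∧ b ≤ M)) (φ : Laurent →ₗ[ℂ] ℂ) :
    kern ht V φ (fib z b) = 0 :=
  Finset.sum_eq_zero fun i _ => by
    rw [fib_eq_zero (hV (wBasis_mem V i)) z hb, map_zero, mul_zero]

/-- Write X(·,·), D(·,·) for the fibre kernels and p* for the reversal of p. At a zero w₀ the
Christoffel–Darboux formula gives (1 - |w₀|²) X(w₀,w₀) = -|p*(w₀)|², so p*(w₀) = 0; then X(w₀,w₀) =
0 and D(w₀,w₀) = 0. All of D would vanish at (z, w₀), although some element of D restricts to the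
constant 1 on the fibre. -/
theorem SplitPair.evalAt_ne_zero (h : SplitPair ht n m K₁ K₂) {p : Laurent}
    (hp : p ∈ eSpace ht n m)
    (hp1 : ipw t p p = 1) (hpo : ∀ f ∈ K₁ ⊔ K₂.map (mulMono 1 0), ipw t f p = 0)
    (hps : (K₁ ⊔ K₂.map (mulMono 1 0)) ⊔ Submodule.span ℂ {p} = eSpace ht n m)
    {z w₀ : ℂ} (hz : ‖z‖ = 1) (hw₀ : ‖w₀‖ ≤ 1) : evalAt p z w₀ ≠ 0 := by
  intro h0
  set D := topSpace ht n m with hD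
  set X := topSpace ht n (m - 1) with hX
  have hDle : D ≤ rect 0 n 0 ((m + 1 : ℕ) - 1) := by
    rw [Nat.cast_add, Nat.cast_one, add_sub_cancel_right]; exact wOminus_le
  have hXle : X ≤ rect 0 n 0 (m - 1) := wOminus_le
  have hpm : p ∈ rect 0 n 0 ((m + 1 : ℕ) - 1) := by
    rw [Nat.cast_add, Nat.cast_one, add_sub_cancel_right]; exact hp.1
  set Xs : ℂ → ℂ := fun w => ∑ b ∈ Finset.range m, ∑ k ∈ Finset.range m,
    kern ht X (fib z b) (fib z k) * w ^ b * conj w₀ ^ k with hXs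
  set Ps : ℂ → ℂ := fun w => ∑ b ∈ Finset.range (m + 1), conj (fib z (m - b) p) * w ^ b with hPs
  -- the kernel of `D` in two ways
  have hXX : ∀ w, (1 - w * conj w₀) * Xs w = ∑ b ∈ Finset.range (m + 1),
      ∑ k ∈ Finset.range (m + 1), (kern ht X (fib z b) (fib z k) -
        kern ht X (fib z (b - 1 : ℤ)) (fib z (k - 1 : ℤ))) * w ^ b * conj w₀ ^ k := fun w =>
    double_sum_shift (fun b k => kern ht X (fib z b) (fib z k)) m
      (fun k => kern_eq_zero_left X hXle z (by omega) _)
      (fun k => kern_eq_zero_right X hXle z (by omega) _)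
      (fun k _ => kern_eq_zero_left X hXle z (by omega) _)
      (fun k _ => kern_eq_zero_right X hXle z (by omega) _) _ _
  have hPP : ∀ w, (1 - w * conj w₀) * Xs w = -(Ps w * conj (Ps w₀)) := by
    intro w
    have e1 : -(Ps w * conj (Ps w₀)) = evalAt p z w * conj (evalAt p z w₀) -
        Ps w * conj (Ps w₀) := by rw [h0]; simp
    rw [hXX, e1, evalAt_eq_sum_fib hpm z w, evalAt_eq_sum_fib hpm z w₀]
    simp only [hPs, map_sum, Finset.sum_mul_sum]
    rw [← Finset.sum_sub_distrib]
    refine Finset.sum_congr rfl fun b _ => ?_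
    rw [← Finset.sum_sub_distrib]
    refine Finset.sum_congr rfl fun k _ => ?_
    have e2 := h.kern_identity hp1 hpo hps hz b k
    have e3 := h.kern_identity' hp1 hpo hps hz b k
    simp only [map_mul, map_pow, Complex.conj_conj]
    linear_combination (w ^ b * conj w₀ ^ k) * (e2 - e3)
  have hX0 : Xs w₀ = ((∑ i, ‖evalAt (wBasis ht X i) z w₀‖ ^ 2 : ℝ) : ℂ) := by
    rw [hXs]
    beta_reduce
    rw [sum_sum_kern X hXle]
    push_cast
    exact Finset.sum_congr rfl fun i _ => by
      rw [Complex.mul_conj, Complex.normSq_eq_norm_sq]; push_cast; rfl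
  have hP0 : Ps w₀ = 0 := by
    have e1 := hPP w₀
    rw [Complex.mul_conj, Complex.mul_conj, hX0, Complex.normSq_eq_norm_sq,
      Complex.normSq_eq_norm_sq] at e1
    have e2 : (1 - ‖w₀‖ ^ 2) * ∑ i, ‖evalAt (wBasis ht X i) z w₀‖ ^ 2 = -‖Ps w₀‖ ^ 2 := by
      exact_mod_cast e1
    have e3 : 0 ≤ ∑ i, ‖evalAt (wBasis ht X i) z w₀‖ ^ 2 :=
      Finset.sum_nonneg fun i _ => sq_nonneg _
    have e4 : 0 ≤ 1 - ‖w₀‖ ^ 2 := by nlinarith [norm_nonneg w₀]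
    have e5 := mul_nonneg e4 e3
    have e6 := sq_nonneg ‖Ps w₀‖
    exact norm_eq_zero.1 (pow_eq_zero_iff two_ne_zero |>.1 (by linarith))
  -- For |w₀| = 1 the factor 1 - w w̄₀ vanishes at w = w₀. It is nonzero on the open disc, where
  -- X(·,w₀) is therefore zero; being a polynomial, it is zero identically.
  have hXzero : Xs w₀ = 0 := by
    have e1 : ∀ w, Xs w = ∑ b ∈ Finset.range m,
        (∑ k ∈ Finset.range m, kern ht X (fib z b) (fib z k) * conj w₀ ^ k) * w ^ b := by
      intro w
      refine Finset.sum_congr rfl fun b _ => ?_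
      rw [Finset.sum_mul]
      exact Finset.sum_congr rfl fun k _ => by ring
    rw [e1]
    refine Finset.sum_eq_zero fun b hb => ?_
    rw [sum_mul_pow_eq_zero (M := m) (a := fun b : ℕ =>
      ∑ k ∈ Finset.range m, kern ht X (fib z b) (fib z k) * conj w₀ ^ k) (fun w hw => ?_)
      (Finset.mem_range.1 hb), zero_mul]
    rw [← e1]
    have e2 := hPP w
    rw [hP0, map_zero, mul_zero, neg_zero, mul_eq_zero] at e2
    refine e2.resolve_left ?_
    intro e3
    have e4 : ‖w * conj w₀‖ = 1 := by rw [← sub_eq_zero.1 e3]; simp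
    rw [norm_mul, Complex.norm_conj] at e4
    nlinarith [norm_nonneg w, norm_nonneg w₀]
  have hDzero : ∑ i, ‖evalAt (wBasis ht D i) z w₀‖ ^ 2 = 0 := by
    have e1 := sum_sum_kern (ht := ht) D hDle z w₀ w₀
    have e2 : ∑ b ∈ Finset.range (m + 1), ∑ k ∈ Finset.range (m + 1),
        kern ht D (fib z b) (fib z k) * w₀ ^ b * conj w₀ ^ k = 0 := by
      have e3 : ∑ b ∈ Finset.range (m + 1), ∑ k ∈ Finset.range (m + 1),
          kern ht D (fib z b) (fib z k) * w₀ ^ b * conj w₀ ^ k = Ps w₀ * conj (Ps w₀) + Xs w₀ := by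
        have e4 : Xs w₀ = ∑ b ∈ Finset.range (m + 1), ∑ k ∈ Finset.range (m + 1),
            kern ht X (fib z b) (fib z k) * w₀ ^ b * conj w₀ ^ k := by
          have hXle' : X ≤ rect 0 n 0 ((m + 1 : ℕ) - 1) :=
            hXle.trans (rect_mono le_rfl le_rfl le_rfl (by push_cast; omega))
          rw [sum_sum_kern X hXle', ← sum_sum_kern X hXle]
        rw [e4]
        simp only [hPs, map_sum, Finset.sum_mul_sum]
        rw [← Finset.sum_add_distrib]
        refine Finset.sum_congr rfl fun b _ => ?_
        rw [← Finset.sum_add_distrib]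
        refine Finset.sum_congr rfl fun k _ => ?_
        have e3 := h.kern_identity' hp1 hpo hps hz b k
        simp only [map_mul, map_pow, Complex.conj_conj]
        linear_combination (w₀ ^ b * conj w₀ ^ k) * e3
      rw [e3, hP0, hXzero]; simp
    rw [e2] at e1
    have e5 : ((∑ i, ‖evalAt (wBasis ht D i) z w₀‖ ^ 2 : ℝ) : ℂ) = 0 := by
      rw [e1]
      push_cast
      exact Finset.sum_congr rfl fun i _ => by
        rw [Complex.mul_conj, Complex.normSq_eq_norm_sq]; push_cast; rfl
    exact_mod_cast e5
  have hvan : ∀ d ∈ D, evalAt d z w₀ = 0 := by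
    intro d hd
    rw [wBasis_sum (ht := ht) D hd, evalAt_eq_evLin, map_sum]
    refine Finset.sum_eq_zero fun i _ => ?_
    have := (Finset.sum_eq_zero_iff_of_nonneg fun i _ => sq_nonneg _).1 hDzero i
      (Finset.mem_univ i)
    rw [map_smul, ← evalAt_eq_evLin, norm_eq_zero.1 (pow_eq_zero_iff two_ne_zero |>.1 this),
      smul_zero]
  have h1m : mono 0 0 ∈ rect 0 n 0 ((m + 1 : ℕ) - 1) :=
    mono_mem_rect le_rfl (by omega) le_rfl (by push_cast; omega)
  obtain ⟨d, hd, hdf⟩ := exists_fib_eq (ht := ht) hz h1m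
  have hd' : d ∈ D := by
    rw [Nat.cast_add, Nat.cast_one, add_sub_cancel_right] at hd
    exact hd
  have e1 := hvan d hd'
  rw [evalAt_eq_sum_fib (hDle hd')] at e1
  simp only [hdf] at e1
  rw [← evalAt_eq_sum_fib h1m, evalAt_mono] at e1
  simp at e1

end

/-! ### Agreement of the two weights -/

theorem factors_mul_starRefl {p : Laurent} {n m : ℕ} (hp : p ∈ rect 0 n 0 m)
    (h0 : ∀ z w : ℂ, ‖z‖ = 1 → ‖w‖ ≤ 1 → evalAt p z w ≠ 0) :
    Factors (p * starRefl p) p n m :=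
  ⟨hp, h0, fun z w hz hw => by
    rw [evalAt_mul _ _ (ne_zero_of_norm_one hz) (ne_zero_of_norm_one hw),
      evalAt_starRefl _ hz hw]⟩

/-- The two weights give the same inner product on `A`. -/
def AgreeOn (s t : Laurent) (A : Submodule ℂ Laurent) : Prop :=
  ∀ f ∈ A, ∀ g ∈ A, ipw s f g = ipw t f g

theorem AgreeOn.sup {s t : Laurent} (hs : TorusPos s) (ht : TorusPos t)
    {A B : Submodule ℂ Laurent} (hA : AgreeOn s t A) (hB : AgreeOn s t B)
    (h1 : ∀ f ∈ A, ∀ g ∈ B, ipw s f g = 0) (h2 : ∀ f ∈ A, ∀ g ∈ B, ipw t f g = 0) :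
    AgreeOn s t (A ⊔ B) := by
  intro f hf g hg
  obtain ⟨a, ha, b, hb, rfl⟩ := Submodule.mem_sup.1 hf
  obtain ⟨a', ha', b', hb', rfl⟩ := Submodule.mem_sup.1 hg
  simp only [ipw_add_left hs, ipw_add_left ht, ipw_add_right hs, ipw_add_right ht]
  rw [hA a ha a' ha', hB b hb b' hb', h1 a ha b' hb', h2 a ha b' hb',
    ipw_eq_zero_symm hs (h1 a' ha' b hb), ipw_eq_zero_symm ht (h2 a' ha' b hb)]

theorem AgreeOn.map_mulMono {s t : Laurent} {A : Submodule ℂ Laurent} (hA : AgreeOn s t A)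
    (i j : ℤ) : AgreeOn s t (A.map (mulMono i j)) := by
  rintro _ ⟨f, hf, rfl⟩ _ ⟨g, hg, rfl⟩
  rw [mulMono_apply, mulMono_apply, ipw_shift, ipw_shift, hA f hf g hg]

theorem ipw_rect_right {s : Laurent} (hs : TorusPos s) {x : Laurent} {a b c d : ℤ}
    (h : ∀ l k : ℤ, a ≤ l → l ≤ b → c ≤ k → k ≤ d → ipw s x (mono l k) = 0) {f : Laurent}
    (hf : f ∈ rect a b c d) : ipw s x f = 0 := by
  induction hf using Submodule.span_induction with
  | zero => exact ipw_zero_right x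
  | add y z _ _ hy hz => rw [ipw_add_right hs, hy, hz, add_zero]
  | smul r y _ hy => rw [ipw_smul_right, hy, mul_zero]
  | mem y hy =>
    obtain ⟨l, k, h1, h2, h3, h4, rfl⟩ := hy
    exact h l k h1 h2 h3 h4

/-- All shifts of `A` in the `z` direction are mutually orthogonal for `s`, and the inner
product of weight `1 / s` on `A` is that of weight `1 / t`. -/
def ShiftOrth (s t : Laurent) (A : Submodule ℂ Laurent) : Prop :=
  ∀ f ∈ A, ∀ g ∈ A, ∀ l : ℤ, ipw s f (mono l 0 * g) = if l = 0 then ipw t f g else 0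

theorem ipw_mono_neg_mul {s : Laurent} (i j : ℤ) (f g : Laurent) :
    ipw s f (mono (-i) (-j) * g) = ipw s (mono i j * f) g := by
  rw [← ipw_shift i j, mono_mul_mono_mul]
  simp [mono_zero_mul]

/-- For the weight 1/|p|² the z^l p are orthonormal and orthogonal to everything of positive
w-degree, hence to all shifts of w X; w X inherits the property from X. -/
theorem ShiftOrth.span_sup {s t : Laurent} {n m : ℕ} {p : Laurent} (h : Factors s p n m)
    (ht : TorusPos t) (hp1 : ipw t p p = 1) {X : Submodule ℂ Laurent}
    (hX : X ≤ rect 0 n 0 (m - 1)) (hXs : ShiftOrth s t X)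
    (hpX : ∀ f ∈ X.map (mulMono 0 1), ipw t p f = 0) :
    ShiftOrth s t (Submodule.span ℂ {p} ⊔ X.map (mulMono 0 1)) := by
  have hs := h.torusPos
  have key : ∀ f ∈ X, ∀ l : ℤ, ipw s p (mono l 0 * (mono 0 1 * f)) = 0 := by
    intro f hf l
    rw [mono_mul_mono_mul]
    refine ipw_rect_right hs (fun l k _ _ hk _ => h.ipw_p_mono l k hk)
      (a := 0 + (l + 0)) (b := n + (l + 0)) (c := 1) (d := m) ?_
    have := (mono_mul_mem_rect (l + 0) (0 + 1)).2 (hX hf)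
    exact rect_mono le_rfl le_rfl (by omega) (by omega) this
  intro f hf g hg l
  obtain ⟨a, ha, b, ⟨x, hx, rfl⟩, rfl⟩ := Submodule.mem_sup.1 hf
  obtain ⟨a', ha', b', ⟨x', hx', rfl⟩, rfl⟩ := Submodule.mem_sup.1 hg
  obtain ⟨c, rfl⟩ := Submodule.mem_span_singleton.1 ha
  obtain ⟨c', rfl⟩ := Submodule.mem_span_singleton.1 ha'
  simp only [mulMono_apply]
  have e1 := h.ipw_p_p l
  have e2 := key x' hx' l
  have e3 : ipw s (mono 0 1 * x) (mono l 0 * p) = 0 := by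
    have := ipw_mono_neg_mul (s := s) (-l) 0 (mono 0 1 * x) p
    rw [neg_neg, neg_zero] at this
    rw [this]
    exact ipw_eq_zero_symm hs (key x hx (-l))
  have e4 : ipw s (mono 0 1 * x) (mono l 0 * (mono 0 1 * x')) =
      if l = 0 then ipw t x x' else 0 := by
    rw [← hXs x hx x' hx' l, ← ipw_shift 0 1 x, mono_mul_mono_mul, mono_mul_mono_mul]
    congr 3; ring
  have e5 := hpX _ ⟨x', hx', rfl⟩
  have e6 := ipw_eq_zero_symm ht (hpX _ ⟨x, hx, rfl⟩)
  rw [mulMono_apply] at e5 e6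
  simp only [mul_add, mul_smul_comm, ipw_add_left hs, ipw_add_left ht, ipw_add_right hs,
    ipw_add_right ht, ipw_smul_left hs, ipw_smul_left ht, ipw_smul_right, e1, e2, e3, e4, e5, e6,
    hp1, ipw_shift]
  split_ifs <;> simp

section

variable {t : Laurent} {ht : TorusPos t} {n m : ℕ} {K₁ K₂ : Submodule ℂ Laurent}

/-- The data constructed from a split pair: the polynomial `p`, the weight `s = |p|²`, and the
space `X = 𝓟_{n,m-1} ⊖ 𝓟_{n-1,m-1}`. -/
structure SplitFactor (ht : TorusPos t) (n m : ℕ) (K₁ K₂ : Submodule ℂ Laurent) (p s : Laurent) :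
    Prop extends SplitPair ht n m K₁ K₂ where
  mem : p ∈ eSpace ht n m
  unit : ipw t p p = 1
  orth_left : ∀ f ∈ K₁, ipw t p f = 0
  orth_right : ∀ f ∈ K₂.map (mulMono 1 0), ipw t p f = 0
  sup_eq : (K₁ ⊔ K₂.map (mulMono 1 0)) ⊔ Submodule.span ℂ {p} = eSpace ht n m
  fac : Factors s p n m
  top : ShiftOrth s t (topSpace ht n (m - 1))

/-- The difference of the two kernel identities is the hypothesis `hstar` of
`Factors.fibre_orthonormal` for an orthonormal basis of X, and `eq_zero_of_fib` gives independence
on fibres. Integration over z makes the shifts of X orthogonal. -/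
theorem SplitPair.exists_splitFactor (h : SplitPair ht n m K₁ K₂) :
    ∃ p, SplitFactor ht n m K₁ K₂ p (p * starRefl p) := by
  obtain ⟨p, hp, hp1, hpo, hps⟩ := h.exists_unit
  have hf : Factors (p * starRefl p) p n m := factors_mul_starRefl hp.1
    fun z w hz hw => h.evalAt_ne_zero hp hp1 hpo hps hz hw
  refine ⟨p, h, hp, hp1, fun f hf => ipw_eq_zero_symm ht (hpo f (Submodule.mem_sup_left hf)),
    fun f hf => ipw_eq_zero_symm ht (hpo f (Submodule.mem_sup_right hf)), hps, hf, ?_⟩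
  have hs := hf.torusPos
  set X := topSpace ht n (m - 1)
  set e := wBasis ht X
  have key : ∀ i j l, ipw (p * starRefl p) (e i) (mono l 0 * e j) =
      if l = 0 then (if i = j then 1 else 0) else 0 := fun i j l =>
    hf.ipw_of_fibre _ (fun z hz => hf.fibre_orthonormal e
      (fun i => (wBasis_mem X i).1) (fun z hz c hc => ?_) (fun z hz b k => ?_) i j hz) l
  · intro f hfX g hgX l
    have hg0 := wBasis_sum (ht := ht) X hgX
    have hgl : mono l 0 * g = ∑ j, ipw t (e j) g • (mono l 0 * e j) := by
      conv_lhs => rw [hg0]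
      rw [Finset.mul_sum]
      exact Finset.sum_congr rfl fun j _ => mul_smul_comm _ _ _
    have hf0 : ∀ j, ipw (p * starRefl p) f (mono l 0 * e j) =
        if l = 0 then ipw t f (e j) else 0 := by
      intro j
      conv_lhs => rw [wBasis_sum (ht := ht) X hfX]
      rw [← ipwForm_apply hs, map_sum, LinearMap.sum_apply]
      simp only [LinearMap.map_smulₛₗ, LinearMap.smul_apply, ipwForm_apply, smul_eq_mul]
      rw [Finset.sum_congr rfl fun i _ => by rw [key i j l]]
      split_ifs
      · simp only [mul_ite, mul_one, mul_zero, Finset.sum_ite_eq', Finset.mem_univ, if_true]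
        exact ipw_conj ht _ _
      · simp
    rw [hgl, ← ipwForm_apply hs, map_sum]
    simp only [map_smul, ipwForm_apply, hf0, smul_eq_mul]
    split_ifs
    · conv_rhs => rw [hg0]
      rw [← ipwForm_apply ht, map_sum]
      simp only [map_smul, ipwForm_apply, smul_eq_mul]
      rfl
    · simp
  · have h1 : ∑ i, c i • e i = 0 := by
      refine eq_zero_of_fib (ht := ht) hz (X.sum_mem fun i _ => X.smul_mem _ (wBasis_mem X i))
        fun k => ?_
      rw [map_sum, ← hc k]
      simp
    intro i
    have h2 : ipw t (e i) (∑ j, c j • e j) = 0 := by rw [h1, ipw_zero_right]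
    rw [← ipwForm_apply ht, map_sum] at h2
    simp only [map_smul, ipwForm_apply, smul_eq_mul] at h2
    rw [Finset.sum_congr rfl fun j _ => by rw [ipw_wBasis (ht := ht) X i j]] at h2
    simpa using h2
  · have e2 := h.kern_identity hp1 hpo hps hz b k
    have e3 := h.kern_identity' hp1 hpo hps hz b k
    simp only [kern] at e2 e3 ⊢
    linear_combination e2 - e3

end

/-! ### The weights agree -/

section

variable {t s p : Laurent} {ht : TorusPos t} {n m : ℕ} {K₁ K₂ : Submodule ℂ Laurent}

theorem rect_sup_topSpace (ht : TorusPos t) (n M : ℤ) :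
    rect 0 (n - 1) 0 M ⊔ topSpace ht n M = rect 0 n 0 M := by
  rw [sup_comm, topSpace_sup]

theorem mono_mul_mem_rect_sup {n M : ℤ} {v : Laurent} (hv : v ∈ rect 0 (n - 1) 0 M) :
    mono 1 0 * v ∈ rect 0 (n - 1) 0 M ⊔ topSpace ht n M := by
  rw [rect_sup_topSpace]
  exact rect_mono (by omega) (by omega) (by omega) (by omega) ((mono_mul_mem_rect 1 0).2 hv)

theorem ShiftOrth.agreeOn {A : Submodule ℂ Laurent} (h : ShiftOrth s t A) : AgreeOn s t A := by
  intro f hf g hg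
  have := h f hf g hg 0
  rwa [mono_zero_mul, if_pos rfl] at this

/-- Any monomial with l ≤ n - 1, negative l included, is a strictly negative z-shift of an element
of 𝓟_{n,M} = 𝓟_{n-1,M} ⊕ X. Shifts of X are orthogonal to X by hypothesis, and shifts of 𝓟_{n-1,M}
by transfer. -/
theorem ipw_topSpace_mono (hs : TorusPos s) {n M : ℤ} (hn : 0 ≤ n)
    (hX : ShiftOrth s t (topSpace ht n M)) {x : Laurent} (hx : x ∈ topSpace ht n M) {l k : ℤ}
    (hl : l ≤ n - 1) (hk : 0 ≤ k) (hk' : k ≤ M) : ipw s x (mono l k) = 0 := by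
  have key : ∀ N : ℕ, ∀ y ∈ topSpace ht n M, ipw s x (mono (-1 * (N + 1)) 0 * y) = 0 :=
    fun N y hy => by rw [hX x hx y hy, if_neg (by omega)]
  obtain ⟨N, h1, h2⟩ : ∃ N : ℕ, 0 ≤ l + (N + 1) ∧ l + (N + 1) ≤ n := by
    rcases lt_or_ge l 0 with h | h
    · exact ⟨(-l - 1).toNat, by omega, by omega⟩
    · exact ⟨0, by omega, by omega⟩
  have h3 : mono l k = mono (-1 * (N + 1)) 0 * mono (l + (N + 1)) k := by
    rw [mul_mono]; congr 1 <;> ring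
  have h4 : mono (l + (N + 1)) k ∈ rect 0 n 0 M := mono_mem_rect h1 h2 hk hk'
  rw [← rect_sup_topSpace ht] at h4
  obtain ⟨v, hv, y, hy, hvy⟩ := Submodule.mem_sup.1 h4
  rw [h3, ← hvy, mul_add, ipw_add_right hs, key N y hy, add_zero]
  have := transfer_ipw_zero ht hs (Y := topSpace ht n M) one_ne_zero (fun v hv y hy => hy.2 v hv)
    (fun v hv => mono_mul_mem_rect_sup hv) x key (N + 1) hv
  exact_mod_cast this

theorem agreeOn_rect_of_topSpace (hs : TorusPos s) {n M : ℤ} (hn : 0 ≤ n)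
    (hX : ShiftOrth s t (topSpace ht n M)) : AgreeOn s t (rect 0 n 0 M) := by
  rw [← topSpace_sup ht]
  refine hX.agreeOn.sup hs ht (fun f hf g hg => ?_)
    (fun f hf g hg => ipw_rect_right hs (fun l k _ hl hk hk' =>
      ipw_topSpace_mono hs hn hX hf hl hk hk') hg) (fun f hf g hg => ipw_wOminus_left hf hg)
  refine transfer_ipw_eq ht hs (Y := topSpace ht n M) one_ne_zero (fun v hv y hy => hy.2 v hv)
    (fun v hv => mono_mul_mem_rect_sup hv) (fun y' hy' N y hy => ?_)
    (fun y hy y' hy' => hX.agreeOn y hy y' hy') hf hg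
  rw [hX y' hy' y hy, if_neg (by omega)]

variable (ht) in
/-- `𝓟_{n,M} ⊖ z 𝓟_{n-1,M}`. -/
def botSpace (n M : ℤ) : Submodule ℂ Laurent := wOminus ht (rect 0 n 0 M) (rect 1 n 0 M)

theorem reflect_mem_topSpace {n M : ℤ} {x : Laurent} (hx : x ∈ botSpace ht n M) :
    reflect n M x ∈ topSpace ht n M := by
  refine ⟨by simpa using reflect_mem (N := n) (M := M) hx.1, fun g hg => ?_⟩
  rw [← reflect_reflect n M g, ipw_reflect]
  refine ipw_eq_zero_symm ht (hx.2 _ ?_)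
  exact rect_mono (by omega) (by omega) (by omega) (by omega)
    (reflect_mem (N := n) (M := M) hg)

theorem ipw_botSpace_mono (hs : TorusPos s) {n M : ℤ} (hn : 0 ≤ n)
    (hX : ShiftOrth s t (topSpace ht n M)) {x : Laurent} (hx : x ∈ botSpace ht n M) {l k : ℤ}
    (hl : 1 ≤ l) (hk : 0 ≤ k) (hk' : k ≤ M) : ipw s x (mono l k) = 0 := by
  rw [← ipw_reflect n M, reflect_mono]
  exact ipw_eq_zero_symm hs (ipw_topSpace_mono hs hn hX (reflect_mem_topSpace hx) (by omega)
    (by omega) (by omega))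

/-- Reflection carries `botSpace` into `topSpace`, preserves both inner products up to exchange of
arguments, and inverts the shift. -/
theorem ShiftOrth.botSpace {n M : ℤ} (hX : ShiftOrth s t (topSpace ht n M)) :
    ShiftOrth s t (botSpace ht n M) := by
  intro f hf g hg l
  rw [← ipw_reflect n M, reflect_mono_mul, ← ipw_reflect (t := t) n M g f,
    ← hX _ (reflect_mem_topSpace hg) _ (reflect_mem_topSpace hf)]
  have := ipw_mono_neg_mul (s := s) (-l) 0 (reflect n M g) (reflect n M f)
  rw [neg_neg, neg_zero] at this
  exact this.symm

/-! ### The inner products of K₁, z K₂ and p for the weight 1/|p|². -/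

namespace SplitFactor

theorem ipw_eSpace_left {N : ℤ} {f g : Laurent} (hf : f ∈ eSpace ht N m)
    (hg : g ∈ rect 0 N 1 m) : ipw t f g = 0 := ipw_eq_zero_symm ht (hf.2 g hg)

theorem map_mulMono_le_rect {X : Submodule ℂ Laurent} (hX : X ≤ rect 0 n 0 (m - 1)) :
    X.map (mulMono 0 1) ≤ rect 0 n 1 m := by
  rintro _ ⟨x, hx, rfl⟩
  exact rect_mono (by omega) (by omega) (by omega) (by omega) ((mono_mul_mem_rect 0 1).2 (hX hx))

theorem shiftOrth_sup (h : SplitFactor ht n m K₁ K₂ p s) {X : Submodule ℂ Laurent}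
    (hX : X ≤ rect 0 n 0 (m - 1)) (hXs : ShiftOrth s t X) :
    ShiftOrth s t (Submodule.span ℂ {p} ⊔ X.map (mulMono 0 1)) :=
  ShiftOrth.span_sup h.fac ht h.unit hX hXs fun _ hf => ipw_eSpace_left h.mem (map_mulMono_le_rect hX hf)

theorem ipw_span_sup (ht : TorusPos t) {X : Submodule ℂ Laurent}
    (hX : X ≤ rect 0 n 0 (m - 1)) {f : Laurent} (hf : f ∈ eSpace ht n m) (hfp : ipw t p f = 0) :
    ∀ y ∈ Submodule.span ℂ {p} ⊔ X.map (mulMono 0 1), ipw t f y = 0 := by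
  refine ipw_sup_right ht (fun y hy => ?_) fun y hy =>
    ipw_eSpace_left hf (map_mulMono_le_rect hX hy)
  obtain ⟨c, rfl⟩ := Submodule.mem_span_singleton.1 hy
  rw [ipw_smul_right, ipw_eq_zero_symm ht hfp, mul_zero]

theorem rect_le (h : SplitFactor ht n m K₁ K₂ p s) :
    (K₁ ⊔ K₂.map (mulMono 1 0)) ⊔ Submodule.span ℂ {p} ⊔ rect 0 n 1 m = rect 0 n 0 m := by
  rw [h.sup_eq, eSpace_sup]

theorem map_botSpace_sup (ht : TorusPos t) (n m : ℕ) :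
    (botSpace ht n (m - 1)).map (mulMono 0 1) ⊔ rect 1 n 1 m = rect 0 n 1 m := by
  have h1 : botSpace ht n (m - 1) ⊔ rect 1 n 0 (m - 1) = rect 0 n 0 (m - 1) :=
    wOminus_sup (rect_mono (by omega) le_rfl le_rfl le_rfl)
  have h2 := congrArg (Submodule.map (mulMono 0 1)) h1
  rw [Submodule.map_sup, map_rect, map_rect] at h2
  simpa using h2

theorem map_topSpace_sup (ht : TorusPos t) (n m : ℕ) :
    (topSpace ht n (m - 1)).map (mulMono 0 1) ⊔ rect 0 (n - 1) 1 m = rect 0 n 1 m := by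
  have h2 := congrArg (Submodule.map (mulMono 0 1)) (topSpace_sup ht n (m - 1))
  rw [Submodule.map_sup, map_rect, map_rect] at h2
  simpa using h2

theorem ipw_map_wOminus {A B : Submodule ℂ Laurent} {f g : Laurent}
    (hf : f ∈ (wOminus ht A B).map (mulMono 0 1)) (hg : g ∈ B.map (mulMono 0 1)) :
    ipw t f g = 0 := by
  obtain ⟨f, hf, rfl⟩ := hf
  obtain ⟨g, hg, rfl⟩ := hg
  rw [mulMono_apply, mulMono_apply, ipw_shift, ipw_wOminus_left hf hg]

/-- 𝓟_{n,m} is the orthogonal sum of K₁, z K₂, p, w `botSpace` and z w 𝓟_{n-1,m-1}. Since v is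
orthogonal to K₂ and w 𝓟_{n-1,m-1}, the components of z v in the second and last summands vanish. -/
theorem shift_left_mem (h : SplitFactor ht n m K₁ K₂ p s) {v : Laurent} (hv : v ∈ K₁) :
    mono 1 0 * v ∈
      K₁ ⊔ (Submodule.span ℂ {p} ⊔ (botSpace ht n (m - 1)).map (mulMono 0 1)) := by
  have hX : botSpace ht n (m - 1) ≤ rect 0 n 0 (m - 1) := wOminus_le
  have hr : rect (1 : ℤ) n 1 m ≤ rect 0 n 1 m := rect_mono (by omega) le_rfl le_rfl le_rfl
  refine mem_of_mem_sup_of_ipw (B := K₂.map (mulMono 1 0) ⊔ rect 1 n 1 m) ht ?_ ?_ ?_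
  · intro f hf
    refine ipw_sup_right ht (fun g hg => ?_) (fun g hg => ?_)
    · refine ipw_sup_left ht (fun f hf => h.orth_shift f hf g hg) (fun f hf => ?_) f hf
      exact ipw_eq_zero_symm ht
        (ipw_span_sup ht hX (h.right_le hg) (h.orth_right g hg) f hf)
    · refine ipw_sup_left ht (fun f hf => ipw_eSpace_left (h.left_le hf) (hr hg))
        (ipw_sup_left ht (fun f hf => ?_) fun f hf => ?_) f hf
      · obtain ⟨c, rfl⟩ := Submodule.mem_span_singleton.1 hf
        rw [ipw_smul_left ht, ipw_eSpace_left h.mem (hr hg), mul_zero]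
      · refine ipw_map_wOminus hf ?_
        rw [map_rect]
        simpa using hg
  · have h1 := h.rect_le
    rw [← map_botSpace_sup ht] at h1
    have h2 : mono 1 0 * v ∈ rect 0 n 0 m :=
      rect_mono (by omega) (by omega) (by omega) (by omega)
        ((mono_mul_mem_rect 1 0).2 (h.left_le' hv).1)
    rw [← h1] at h2
    convert h2 using 1
    simp only [sup_assoc, sup_left_comm, sup_comm]
  · refine ipw_sup_right ht ?_ fun g hg => ?_
    · rintro _ ⟨g, hg, rfl⟩
      rw [mulMono_apply, ipw_shift, h.orth v hv g hg]
    · have h1 : (rect 0 (n - 1) 1 m).map (mulMono 1 0) = rect 1 n 1 m := by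
        rw [map_rect]; simp
      rw [← h1] at hg
      obtain ⟨g, hg, rfl⟩ := hg
      rw [mulMono_apply, ipw_shift, ipw_eSpace_left (h.left_le' hv) hg]

/-- The mirror image: in 𝓟_{n,m} = K₁ ⊕ z K₂ ⊕ span p ⊕ w `topSpace` ⊕ w 𝓟_{n-1,m-1}, an element of
K₂ has no component in the first and last summands. -/
theorem shift_right_mem (h : SplitFactor ht n m K₁ K₂ p s) {v : Laurent}
    (hv : v ∈ K₂.map (mulMono 1 0)) : mono (-1) 0 * v ∈ K₂.map (mulMono 1 0) ⊔
      (Submodule.span ℂ {p} ⊔ (topSpace ht n (m - 1)).map (mulMono 0 1)) := by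
  have hX : topSpace ht n (m - 1) ≤ rect 0 n 0 (m - 1) := wOminus_le
  have hr : rect 0 (n - 1 : ℤ) 1 m ≤ rect 0 n 1 m := rect_mono le_rfl (by omega) le_rfl le_rfl
  obtain ⟨v, hv, rfl⟩ := hv
  rw [mulMono_apply, mono_mul_mono_mul, neg_add_cancel, add_zero, mono_zero_mul]
  refine mem_of_mem_sup_of_ipw (B := K₁ ⊔ rect 0 (n - 1) 1 m) ht ?_ ?_ ?_
  · intro f hf
    refine ipw_sup_right ht (fun g hg => ?_) (fun g hg => ?_)
    · refine ipw_sup_left ht (fun f hf => ipw_eq_zero_symm ht (h.orth_shift g hg f hf))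
        (fun f hf => ?_) f hf
      exact ipw_eq_zero_symm ht (ipw_span_sup ht hX (h.left_le hg) (h.orth_left g hg) f hf)
    · refine ipw_sup_left ht (fun f hf => ipw_eSpace_left (h.right_le hf) (hr hg))
        (ipw_sup_left ht (fun f hf => ?_) fun f hf => ?_) f hf
      · obtain ⟨c, rfl⟩ := Submodule.mem_span_singleton.1 hf
        rw [ipw_smul_left ht, ipw_eSpace_left h.mem (hr hg), mul_zero]
      · refine ipw_map_wOminus hf ?_
        rw [map_rect]
        simpa using hg
  · have h1 := h.rect_le
    rw [← map_topSpace_sup ht] at h1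
    have h2 : v ∈ rect 0 n 0 m :=
      rect_mono (by omega) (by omega) (by omega) (by omega) (h.right_le' hv).1
    rw [← h1] at h2
    convert h2 using 1
    simp only [sup_assoc, sup_left_comm, sup_comm]
  · exact ipw_sup_right ht (fun g hg => ipw_eq_zero_symm ht (h.orth g hg v hv))
      fun g hg => ipw_eSpace_left (h.right_le' hv) hg

theorem finiteDimensional_left (h : SplitFactor ht n m K₁ K₂ p s) : FiniteDimensional ℂ K₁ :=
  finiteDimensional_of_le_rect fun _ hf => (h.left_le hf).1

theorem finiteDimensional_right (h : SplitFactor ht n m K₁ K₂ p s) :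
    FiniteDimensional ℂ (K₂.map (mulMono 1 0)) :=
  finiteDimensional_of_le_rect fun _ hf => (h.right_le hf).1

/-- The test for orthogonality to `K₁`. -/
theorem ipw_left_eq_zero (h : SplitFactor ht n m K₁ K₂ p s) {x : Laurent}
    (hp : ∀ l : ℤ, l ≤ -1 → ipw s x (mono l 0 * p) = 0)
    (hx : ∀ l : ℤ, l ≤ -1 → ∀ y ∈ botSpace ht n (m - 1), ipw s x (mono l 1 * y) = 0)
    {v : Laurent} (hv : v ∈ K₁) : ipw s x v = 0 := by
  have := h.finiteDimensional_left
  have hs := h.fac.torusPos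
  have := transfer_ipw_zero ht hs one_ne_zero
    (fun v hv => ipw_span_sup ht (X := botSpace ht n (m - 1)) wOminus_le (h.left_le hv)
      (h.orth_left v hv)) (fun v hv => h.shift_left_mem hv) x (fun N y hy => ?_) 0 hv
  · simpa [mono_zero_mul] using this
  · obtain ⟨a, ha, _, ⟨y, hy', rfl⟩, rfl⟩ := Submodule.mem_sup.1 hy
    obtain ⟨c, rfl⟩ := Submodule.mem_span_singleton.1 ha
    rw [mul_add, ipw_add_right hs, mul_smul_comm, ipw_smul_right, hp _ (by omega), mulMono_apply,
      mono_mul_mono_mul, add_zero, zero_add, hx _ (by omega) y hy', mul_zero, add_zero]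

/-- The test for orthogonality to `z K₂`. -/
theorem ipw_right_eq_zero (h : SplitFactor ht n m K₁ K₂ p s) {x : Laurent}
    (hp : ∀ l : ℤ, 1 ≤ l → ipw s x (mono l 0 * p) = 0)
    (hx : ∀ l : ℤ, 1 ≤ l → ∀ y ∈ topSpace ht n (m - 1), ipw s x (mono l 1 * y) = 0)
    {v : Laurent} (hv : v ∈ K₂.map (mulMono 1 0)) : ipw s x v = 0 := by
  have := h.finiteDimensional_right
  have hs := h.fac.torusPos
  have := transfer_ipw_zero ht hs (j := -1) (by simp)
    (fun v hv => ipw_span_sup ht (X := topSpace ht n (m - 1)) wOminus_le (h.right_le hv)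
      (h.orth_right v hv)) (fun v hv => h.shift_right_mem hv) x (fun N y hy => ?_) 0 hv
  · simpa [mono_zero_mul] using this
  · obtain ⟨a, ha, _, ⟨y, hy', rfl⟩, rfl⟩ := Submodule.mem_sup.1 hy
    obtain ⟨c, rfl⟩ := Submodule.mem_span_singleton.1 ha
    rw [mul_add, ipw_add_right hs, mul_smul_comm, ipw_smul_right, hp _ (by omega), mulMono_apply,
      mono_mul_mono_mul, add_zero, zero_add, hx _ (by omega) y hy', mul_zero, add_zero]

theorem ipw_mono_mul_p (h : SplitFactor ht n m K₁ K₂ p s) (i l k : ℤ) (hk : 1 ≤ k) :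
    ipw s (mono l k) (mono i 0 * p) = 0 := by
  have h1 := ipw_mono_neg_mul (s := s) (-i) 0 (mono l k) p
  rw [neg_neg, neg_zero] at h1
  rw [h1, mul_mono]
  exact ipw_eq_zero_symm h.fac.torusPos (h.fac.ipw_p_mono _ _ (by omega))

/-- By the test for K₁ only negative z-shifts of p and of w `botSpace` matter. For the latter, z^l
w^k moves across to z^(l-i) w^(k-1) with l - i ≥ 1, which is orthogonal to `botSpace`. -/
theorem ipw_left_mono (h : SplitFactor ht n m K₁ K₂ p s) {l k : ℤ} (hl : 0 ≤ l) (hk : 1 ≤ k)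
    (hk' : k ≤ m) {v : Laurent} (hv : v ∈ K₁) : ipw s v (mono l k) = 0 := by
  have hs := h.fac.torusPos
  refine ipw_eq_zero_symm hs (h.ipw_left_eq_zero (fun i _ => h.ipw_mono_mul_p i l k hk)
    (fun i hi y hy => ?_) hv)
  have h1 := ipw_mono_neg_mul (s := s) (-i) (-1) (mono l k) y
  rw [neg_neg, neg_neg] at h1
  rw [h1, mul_mono]
  exact ipw_eq_zero_symm hs (ipw_botSpace_mono hs (by omega) h.top hy (by omega) (by omega)
    (by omega))

theorem ipw_right_mono (h : SplitFactor ht n m K₁ K₂ p s) {l k : ℤ} (hl : l ≤ n) (hk : 1 ≤ k)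
    (hk' : k ≤ m) {v : Laurent} (hv : v ∈ K₂.map (mulMono 1 0)) : ipw s v (mono l k) = 0 := by
  have hs := h.fac.torusPos
  refine ipw_eq_zero_symm hs (h.ipw_right_eq_zero (fun i _ => h.ipw_mono_mul_p i l k hk)
    (fun i hi y hy => ?_) hv)
  have h1 := ipw_mono_neg_mul (s := s) (-i) (-1) (mono l k) y
  rw [neg_neg, neg_neg] at h1
  rw [h1, mul_mono]
  exact ipw_eq_zero_symm hs (ipw_topSpace_mono hs (by omega) h.top hy (by omega) (by omega)
    (by omega))

theorem ipw_left_p (h : SplitFactor ht n m K₁ K₂ p s) {v : Laurent} (hv : v ∈ K₁) :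
    ipw s v p = 0 := by
  have hs := h.fac.torusPos
  refine ipw_eq_zero_symm hs (h.ipw_left_eq_zero (fun l hl => ?_) (fun l hl y hy => ?_) hv)
  · rw [h.fac.ipw_p_p, if_neg (by omega)]
  · exact ipw_rect_right hs (fun _ _ _ _ hk _ => h.fac.ipw_p_mono _ _ (by omega))
      ((mono_mul_mem_rect l 1).2 hy.1)

theorem ipw_right_p (h : SplitFactor ht n m K₁ K₂ p s) {v : Laurent}
    (hv : v ∈ K₂.map (mulMono 1 0)) : ipw s v p = 0 := by
  have hs := h.fac.torusPos
  refine ipw_eq_zero_symm hs (h.ipw_right_eq_zero (fun l hl => ?_) (fun l hl y hy => ?_) hv)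
  · rw [h.fac.ipw_p_p, if_neg (by omega)]
  · exact ipw_rect_right hs (fun _ _ _ _ hk _ => h.fac.ipw_p_mono _ _ (by omega))
      ((mono_mul_mem_rect l 1).2 hy.1)

/-- The two tests are nested. Shifts by l ≤ -1 on the side of K₁ and by i ≥ 1 on that of z K₂
combine to i - l ≥ 2, which puts all four pairs formed from p, w `botSpace` and p, w `topSpace`
under known relations. -/
theorem ipw_left_right (h : SplitFactor ht n m K₁ K₂ p s) {v u : Laurent} (hv : v ∈ K₁)
    (hu : u ∈ K₂.map (mulMono 1 0)) : ipw s v u = 0 := by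
  have hs := h.fac.torusPos
  have hmove : ∀ i j : ℤ, ∀ f g : Laurent, ipw s (mono i j * f) g = ipw s f (mono (-i) (-j) * g) :=
    fun i j f g => (ipw_mono_neg_mul i j f g).symm
  refine ipw_eq_zero_symm hs (h.ipw_left_eq_zero (fun l hl => ?_) (fun l hl y hy => ?_) hv)
  · refine ipw_eq_zero_symm hs (h.ipw_right_eq_zero (fun i hi => ?_) (fun i hi y hy => ?_) hu)
    · rw [hmove, mono_mul_mono_mul, neg_zero, add_zero, h.fac.ipw_p_p, if_neg (by omega)]
    · rw [hmove, mono_mul_mono_mul]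
      exact ipw_rect_right hs (fun _ _ _ _ hk _ => h.fac.ipw_p_mono _ _ (by omega))
        ((mono_mul_mem_rect _ _).2 hy.1)
  · refine ipw_eq_zero_symm hs (h.ipw_right_eq_zero (fun i hi => ?_) (fun i hi y' hy' => ?_) hu)
    · refine ipw_eq_zero_symm hs ?_
      rw [hmove, mono_mul_mono_mul]
      exact ipw_rect_right hs (fun _ _ _ _ hk _ => h.fac.ipw_p_mono _ _ (by omega))
        ((mono_mul_mem_rect _ _).2 hy.1)
    · rw [hmove, mono_mul_mono_mul]
      exact ipw_rect_right hs (fun _ _ _ _ hk _ => ipw_botSpace_mono hs (by omega) h.top hy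
        (by omega) (by omega) (by omega)) ((mono_mul_mem_rect _ _).2 hy'.1)

theorem agreeOn_left (h : SplitFactor ht n m K₁ K₂ p s) : AgreeOn s t K₁ := by
  have := h.finiteDimensional_left
  have hY := h.shiftOrth_sup (X := botSpace ht n (m - 1)) wOminus_le h.top.botSpace
  intro f hf g hg
  exact transfer_ipw_eq ht h.fac.torusPos one_ne_zero
    (fun v hv => ipw_span_sup ht (X := botSpace ht n (m - 1)) wOminus_le (h.left_le hv)
      (h.orth_left v hv)) (fun v hv => h.shift_left_mem hv)
    (fun y' hy' N y hy => by rw [hY y' hy' y hy, if_neg (by omega)]) hY.agreeOn hf hg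

theorem agreeOn_right (h : SplitFactor ht n m K₁ K₂ p s) :
    AgreeOn s t (K₂.map (mulMono 1 0)) := by
  have := h.finiteDimensional_right
  have hY := h.shiftOrth_sup (X := topSpace ht n (m - 1)) wOminus_le h.top
  intro f hf g hg
  exact transfer_ipw_eq ht h.fac.torusPos (j := -1) (by simp)
    (fun v hv => ipw_span_sup ht (X := topSpace ht n (m - 1)) wOminus_le (h.right_le hv)
      (h.orth_right v hv)) (fun v hv => h.shift_right_mem hv)
    (fun y' hy' N y hy => by rw [hY y' hy' y hy, if_neg (by omega)]) hY.agreeOn hf hg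

theorem agreeOn (h : SplitFactor ht n m K₁ K₂ p s) : AgreeOn s t (rect 0 n 0 m) := by
  have hs := h.fac.torusPos
  have hp : AgreeOn s t (Submodule.span ℂ {p}) := fun f hf g hg =>
    (h.shiftOrth_sup (X := topSpace ht n (m - 1)) wOminus_le h.top).agreeOn f
      (Submodule.mem_sup_left hf) g (Submodule.mem_sup_left hg)
  have hR : AgreeOn s t (rect 0 n 1 m) := by
    have := (agreeOn_rect_of_topSpace hs (Int.natCast_nonneg n) h.top).map_mulMono 0 1
    rw [map_rect] at this
    simpa using this
  -- K₁ ⊕ z K₂ ⊕ span p ⊕ w 𝓟_{n,m-1} is orthogonal for both weights, so agreement on each summand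
  -- suffices.
  rw [← h.rect_le]
  refine AgreeOn.sup hs ht (AgreeOn.sup hs ht (AgreeOn.sup hs ht h.agreeOn_left h.agreeOn_right
    (fun f hf g hg => h.ipw_left_right hf hg) h.orth_shift) hp ?_ ?_) hR ?_ ?_
  · intro f hf g hg
    obtain ⟨c, rfl⟩ := Submodule.mem_span_singleton.1 hg
    rw [ipw_smul_right, ipw_sup_left hs (fun f hf => h.ipw_left_p hf)
      (fun f hf => h.ipw_right_p hf) f hf, mul_zero]
  · intro f hf g hg
    obtain ⟨c, rfl⟩ := Submodule.mem_span_singleton.1 hg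
    rw [ipw_smul_right, ipw_sup_left ht (fun f hf => ipw_eq_zero_symm ht (h.orth_left f hf))
      (fun f hf => ipw_eq_zero_symm ht (h.orth_right f hf)) f hf, mul_zero]
  · intro f hf g hg
    refine ipw_rect_right hs (fun l k hl hl' hk hk' => ?_) hg
    refine ipw_sup_left hs (ipw_sup_left hs (fun f hf => h.ipw_left_mono hl hk hk' hf)
      fun f hf => h.ipw_right_mono hl' hk hk' hf) (fun f hf => ?_) f hf
    obtain ⟨c, rfl⟩ := Submodule.mem_span_singleton.1 hf
    rw [ipw_smul_left hs, h.fac.ipw_p_mono _ _ (by omega), mul_zero]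
  · intro f hf g hg
    rw [h.sup_eq] at hf
    exact ipw_eSpace_left hf hg

end SplitFactor

/-- Agreement on 𝓟_{n,m} means that 1/s and 1/t have the same moments on 𝓛_{n,m}. As s - t lies
there, 0 = ∫ (s - t)(1/t - 1/s) = ∫ (s - t)²/(s t). -/
theorem AgreeOn.eq (hs : TorusPos s) (ht : TorusPos t) (h : AgreeOn s t (rect 0 n 0 m))
    (hsm : s ∈ rect (-n) n (-m) m) (htm : t ∈ rect (-n) n (-m) m) : s = t := by
  have hmom : ∀ q ∈ rect (-n : ℤ) n (-m) m, ipw s (mono 0 0) q = ipw t (mono 0 0) q := by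
    intro q hq
    induction hq using Submodule.span_induction with
    | zero => rw [ipw_zero_right, ipw_zero_right]
    | add y z _ _ hy hz => rw [ipw_add_right hs, ipw_add_right ht, hy, hz]
    | smul r y _ hy => rw [ipw_smul_right, ipw_smul_right, hy]
    | mem y hy =>
      obtain ⟨l, k, h1, h2, h3, h4, rfl⟩ := hy
      -- Positive and negative parts of the exponents write z^l w^k on the torus as conj(f) g with
      -- monomials f, g in 𝓟_{n,m}.
      have h5 := h (mono (max (-l) 0) (max (-k) 0))
        (mono_mem_rect (by omega) (by omega) (by omega) (by omega)) (mono (max l 0) (max k 0))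
        (mono_mem_rect (by omega) (by omega) (by omega) (by omega))
      have h6 : mono (max (-l) 0) (max (-k) 0) =
          mono (max (-l) 0) (max (-k) 0) * mono 0 0 := by rw [mul_mono, add_zero, add_zero]
      have h7 : mono (max l 0) (max k 0) = mono (max (-l) 0) (max (-k) 0) * mono l k := by
        rw [mul_mono]; congr 1 <;> omega
      rwa [h6, h7, ipw_shift, ipw_shift] at h5
  have hst : TorusPos (s * t) := fun z w hz hw => by
    rw [evalAt_mul _ _ (ne_zero_of_norm_one hz) (ne_zero_of_norm_one hw)]
    exact mul_pos (hs z w hz hw) (ht z w hz hw)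
  refine sub_eq_zero.1 (eq_zero_of_ipw_self hst (f := s - t) ?_)
  have h1 := hmom (s - t) (sub_mem hsm htm)
  have h2 : ipw t (mono 0 0) (s - t) =
      ipw (s * t) (s - t) (s - t) + ipw s (mono 0 0) (s - t) := by
    rw [ipw, ipw, ipw, ← torusAverage_add (torusCont_ipw hst _ _) (torusCont_ipw hs _ _)]
    refine torusAverage_congr fun z w hz hw => ?_
    have e1 := hs.ne_zero hz hw
    have e2 := ht.ne_zero hz hw
    rw [evalAt_mul _ _ (ne_zero_of_norm_one hz) (ne_zero_of_norm_one hw), evalAt_sub, map_sub,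
      hs.conj_eq hz hw, ht.conj_eq hz hw, evalAt_mono]
    simp only [zpow_zero, mul_one, map_one]
    field_simp
    ring
  rw [h1] at h2
  linear_combination -h2

theorem SplitPair.exists_factors (h : SplitPair ht n m K₁ K₂) (htm : t ∈ rect (-n) n (-m) m) :
    ∃ p, Factors t p n m := by
  obtain ⟨p, hp⟩ := h.exists_splitFactor
  have hsm : p * starRefl p ∈ rect (-n) n (-m) m := by
    have := mul_mem_rect hp.mem.1 (starRefl_mem_rect hp.mem.1)
    simpa using this
  refine ⟨p, ?_⟩
  rw [← hp.agreeOn.eq hp.fac.torusPos ht hsm htm]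
  exact hp.fac

end

/-! ### Density of the multiples of the weight -/

section

variable {t : Laurent} (ht : TorusPos t)

include ht in
theorem TorusPos.exists_bounds : ∃ a b : ℝ, 0 < a ∧ ∀ z w : ℂ, ‖z‖ = 1 → ‖w‖ = 1 →
    a ≤ (evalAt t z w).re ∧ (evalAt t z w).re ≤ b := by
  set F : ℝ × ℝ → ℝ := fun x => (evalAt t (circleMap 0 1 x.1) (circleMap 0 1 x.2)).re
  have hF : Continuous F := Complex.continuous_re.comp (torusCont_evalAt t)
  set S : Set (ℝ × ℝ) := Set.Icc (-Real.pi) Real.pi ×ˢ Set.Icc (-Real.pi) Real.pi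
  have hS : IsCompact S := isCompact_Icc.prod isCompact_Icc
  have hne : S.Nonempty := ⟨(0, 0), by simp [S, Real.pi_pos.le]⟩
  obtain ⟨x, -, hx⟩ := hS.exists_isMinOn hne hF.continuousOn
  obtain ⟨y, -, hy⟩ := hS.exists_isMaxOn hne hF.continuousOn
  refine ⟨F x, F y, (Complex.pos_iff.1 (ht _ _ (norm_circleMap _) (norm_circleMap _))).1,
    fun z w hz hw => ?_⟩
  have harg : ∀ z : ℂ, ‖z‖ = 1 → circleMap 0 1 z.arg = z := fun z hz => by
    have := Complex.norm_mul_exp_arg_mul_I z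
    rw [hz] at this
    simpa [circleMap] using this
  have hmem : (z.arg, w.arg) ∈ S :=
    ⟨⟨(Complex.neg_pi_lt_arg z).le, Complex.arg_le_pi z⟩,
      ⟨(Complex.neg_pi_lt_arg w).le, Complex.arg_le_pi w⟩⟩
  have h1 := hx hmem
  have h2 := hy hmem
  simp only [Set.mem_ofPred_eq, F, harg z hz, harg w hw] at h1 h2
  exact ⟨h1, h2⟩

include ht in
theorem ipw_mul_mono_left (l k : ℤ) (v : Laurent) :
    ipw t (t * mono l k) v = v.coeff (l, k) := by
  rw [← torusAverage_coeff]
  refine torusAverage_congr fun z w hz hw => ?_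
  have h := ht.ne_zero hz hw
  rw [evalAt_mul _ _ (ne_zero_of_norm_one hz) (ne_zero_of_norm_one hw), map_mul,
    ht.conj_eq hz hw, evalAt_mono]
  field_simp

include ht in
theorem re_ipw_le_re_ipw {f g f' g' : Laurent} {c : ℝ}
    (h : ∀ z w : ℂ, ‖z‖ = 1 → ‖w‖ = 1 → conj (evalAt f z w) * evalAt g z w / evalAt t z w ≤
      c * (conj (evalAt f' z w) * evalAt g' z w / evalAt t z w)) :
    (ipw t f g).re ≤ c * (ipw t f' g').re := by
  have h1 : (c : ℂ) * ipw t f' g' = ipw t f g + torusAverage fun z w =>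
      (((c : ℂ) * (conj (evalAt f' z w) * evalAt g' z w / evalAt t z w) -
        conj (evalAt f z w) * evalAt g z w / evalAt t z w).re : ℂ) := by
    have h2 : (c : ℂ) * ipw t f' g' = torusAverage fun z w =>
        conj (evalAt f z w) * evalAt g z w / evalAt t z w +
        ((c : ℂ) * (conj (evalAt f' z w) * evalAt g' z w / evalAt t z w) -
          conj (evalAt f z w) * evalAt g z w / evalAt t z w) := by
      rw [ipw, ← torusAverage_smul]
      exact torusAverage_congr fun z w _ _ => by ring
    rw [h2, torusAverage_add (torusCont_ipw ht _ _)]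
    · congr 1
      refine torusAverage_congr fun z w hz hw => ?_
      have h3 := sub_nonneg.2 (h z w hz hw)
      exact (Complex.conj_eq_iff_re.1 (Complex.conj_eq_iff_im.2
        (Complex.nonneg_iff.1 h3).2.symm)).symm
    · have h4 : TorusCont fun z w =>
          (c : ℂ) * (conj (evalAt f' z w) * evalAt g' z w / evalAt t z w) :=
        Continuous.mul continuous_const (torusCont_ipw ht f' g')
      exact Continuous.sub h4 (torusCont_ipw ht f g)
  have h5 := torusAverage_nonneg (F := fun z w =>
    ((c : ℂ) * (conj (evalAt f' z w) * evalAt g' z w / evalAt t z w) -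
        conj (evalAt f z w) * evalAt g z w / evalAt t z w).re) fun z w hz hw =>
    (Complex.nonneg_iff.1 (sub_nonneg.2 (h z w hz hw))).1
  have h6 := congrArg Complex.re h1
  rw [Complex.re_ofReal_mul, Complex.add_re] at h6
  have h7 := (Complex.nonneg_iff.1 h5).1
  linarith

theorem norm_toW_sq (f : Laurent) : ‖toW ht f‖ ^ 2 = (ipw t f f).re := by
  rw [← inner_toW ht, ← inner_self_eq_norm_sq (𝕜 := ℂ)]
  rfl

/-- The embedding of the Laurent polynomials into the Hilbert space of weight `1 / t`. -/
def toH : Laurent →ₗ[ℂ] UniformSpace.Completion (WSpace ht) :=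
  (UniformSpace.Completion.toComplL (𝕜 := ℂ) (E := WSpace ht)).toLinearMap ∘ₗ
    (toW ht).toLinearMap

theorem inner_toH (f g : Laurent) : inner ℂ (toH ht f) (toH ht g) = ipw t f g :=
  UniformSpace.Completion.inner_coe (toW ht f) (toW ht g)

theorem norm_toH (f : Laurent) : ‖toH ht f‖ = ‖toW ht f‖ :=
  UniformSpace.Completion.norm_coe (toW ht f)

theorem denseRange_toH : DenseRange (toH ht) :=
  UniformSpace.Completion.denseRange_coe.comp (toW ht).surjective.denseRange
    (UniformSpace.Completion.continuous_coe _)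

/-- Density of the multiples of t. With 0 < a ≤ t ≤ b, a ‖v‖² ≤ Re ⟨t v, v⟩ = Re ⟨t v, v - h⟩ ≤ b
‖v‖ ‖v - h‖. The bound a ‖v‖ ≤ b ‖v - h‖ extends to the completion, where v = h gives h = 0. -/
theorem eq_zero_of_inner_mul {h : UniformSpace.Completion (WSpace ht)}
    (h0 : ∀ v : Laurent, inner ℂ (toH ht (t * v)) h = 0) : h = 0 := by
  obtain ⟨a, b, ha, hab⟩ := ht.exists_bounds
  have hb : 0 < b := by
    have := hab 1 1 (by simp) (by simp)
    linarith
  have hre : ∀ z w : ℂ, ‖z‖ = 1 → ‖w‖ = 1 → evalAt t z w = ((evalAt t z w).re : ℂ) :=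
    fun z w hz hw => (Complex.conj_eq_iff_re.1 (ht.conj_eq hz hw)).symm
  have hlow : ∀ v : Laurent, a * ‖toH ht v‖ ^ 2 ≤ (ipw t (t * v) v).re := by
    intro v
    have h1 := re_ipw_le_re_ipw ht (f := v) (g := v) (f' := t * v) (g' := v) (c := a⁻¹)
      fun z w hz hw => ?_
    · rw [norm_toH, norm_toW_sq]
      rw [inv_mul_eq_div, le_div_iff₀ ha] at h1
      linarith
    · obtain ⟨h2, h3⟩ := hab z w hz hw
      rw [evalAt_mul _ _ (ne_zero_of_norm_one hz) (ne_zero_of_norm_one hw), map_mul, hre z w hz hw,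
        Complex.conj_ofReal, mul_assoc, mul_comm (conj (evalAt v z w)), Complex.mul_conj]
      norm_cast
      have h4 := Complex.normSq_nonneg (evalAt v z w)
      have h5 : 0 < (evalAt t z w).re := by linarith
      rw [mul_div_cancel_left₀ _ h5.ne', inv_mul_eq_div]
      exact div_le_div_of_nonneg_left h4 ha h2
  have hup : ∀ v : Laurent, ‖toH ht (t * v)‖ ≤ b * ‖toH ht v‖ := by
    intro v
    refine le_of_sq_le_sq ?_ (by positivity)
    rw [mul_pow, norm_toH, norm_toH, norm_toW_sq, norm_toW_sq]
    refine re_ipw_le_re_ipw ht fun z w hz hw => ?_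
    obtain ⟨h2, h3⟩ := hab z w hz hw
    rw [evalAt_mul _ _ (ne_zero_of_norm_one hz) (ne_zero_of_norm_one hw), map_mul, hre z w hz hw,
      Complex.conj_ofReal, mul_mul_mul_comm, mul_comm (conj (evalAt v z w)), Complex.mul_conj]
    norm_cast
    have h4 := Complex.normSq_nonneg (evalAt v z w)
    have h5 : 0 < (evalAt t z w).re := by linarith
    rw [← mul_div_assoc]
    refine div_le_div_of_nonneg_right (mul_le_mul_of_nonneg_right ?_ h4) h5.le
    nlinarith
  have hapx : ∀ v : Laurent, a * ‖toH ht v‖ ≤ b * ‖toH ht v - h‖ := by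
    intro v
    have h1 : inner ℂ (toH ht (t * v)) (toH ht v - h) = ipw t (t * v) v := by
      rw [inner_sub_right, h0, sub_zero, inner_toH]
    have h2 : (ipw t (t * v) v).re ≤ b * ‖toH ht v‖ * ‖toH ht v - h‖ := by
      rw [← h1]
      exact (Complex.re_le_norm _).trans ((norm_inner_le_norm _ _).trans
        (mul_le_mul_of_nonneg_right (hup v) (norm_nonneg _)))
    have h3 := hlow v
    rcases (norm_nonneg (toH ht v)).eq_or_lt with h4 | h4
    · rw [← h4, mul_zero]; positivity
    · refine le_of_mul_le_mul_right ?_ h4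
      nlinarith
  have hcl : IsClosed {x : UniformSpace.Completion (WSpace ht) | a * ‖x‖ ≤ b * ‖x - h‖} :=
    isClosed_le (by fun_prop) (by fun_prop)
  have h1 : a * ‖h‖ ≤ b * ‖h - h‖ := (denseRange_toH ht).induction_on
    (p := fun x => a * ‖x‖ ≤ b * ‖x - h‖) h hcl hapx
  rw [sub_self, norm_zero, mul_zero] at h1
  exact norm_le_zero_iff.1 (nonpos_of_mul_nonpos_right h1 ha)

end

/-! ### Projections with prescribed support -/

/-- The span of the `z ^ s * w ^ t` with `s ≤ N`, `c ≤ t ≤ d`. -/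
def strip (N c d : ℤ) : Submodule ℂ Laurent :=
  Submodule.span ℂ {f | ∃ s t : ℤ, s ≤ N ∧ c ≤ t ∧ t ≤ d ∧ f = mono s t}

theorem rect_le_strip {a b c d N c' d' : ℤ} (h1 : b ≤ N) (h2 : c' ≤ c) (h3 : d ≤ d') :
    rect a b c d ≤ strip N c' d' := by
  refine Submodule.span_mono ?_
  rintro _ ⟨s, t, _, hs, ht, ht', rfl⟩
  exact ⟨s, t, by omega, by omega, by omega, rfl⟩

theorem coeff_eq_zero_of_mem_strip {N c d : ℤ} {f : Laurent} (hf : f ∈ strip N c d) {l k : ℤ}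
    (h : ¬(l ≤ N ∧ c ≤ k ∧ k ≤ d)) : f.coeff (l, k) = 0 := by
  induction hf using Submodule.span_induction with
  | zero => simp
  | add x y _ _ hx hy => simp [hx, hy]
  | smul r x _ hx => simp [hx]
  | mem x hx =>
    obtain ⟨s', t', h1, h2, h3, rfl⟩ := hx
    simp only [mono, AddMonoidAlgebra.coeff_single, Finsupp.single_apply, Prod.mk.injEq]
    rw [if_neg]
    rintro ⟨rfl, rfl⟩
    exact h ⟨h1, h2, h3⟩

theorem inner_eq_zero_of_mem_closure {t : Laurent} {ht : TorusPos t} {S : Submodule ℂ Laurent}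
    {a x : UniformSpace.Completion (WSpace ht)} (h : ∀ u ∈ S, inner ℂ a (toH ht u) = 0)
    (hx : x ∈ (S.map (toH ht)).topologicalClosure) : inner ℂ a x = 0 := by
  have h1 : (S.map (toH ht)).topologicalClosure ≤ (Submodule.span ℂ {a})ᗮ := by
    refine Submodule.topologicalClosure_minimal _ ?_ (Submodule.isClosed_orthogonal _)
    rintro _ ⟨u, hu, rfl⟩
    exact Submodule.mem_orthogonal_singleton_iff_inner_right.2 (h u hu)
  exact Submodule.mem_orthogonal_singleton_iff_inner_right.1 (h1 hx)

/-- The component of `x` orthogonal to `S` is a polynomial, when `S` and `x` are supported in a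
strip and `S` represents the coefficients of negative degree. -/
theorem exists_orthogonal_component {t : Laurent} (ht : TorusPos t) {N c d : ℤ}
    {S : Submodule ℂ Laurent} (hS : S ≤ strip N c d) {x : Laurent} (hx : x ∈ strip N c d)
    (hT : ∀ l k : ℤ, l ≤ -1 → c ≤ k → k ≤ d →
      ∃ u ∈ S, ∀ v ∈ strip N c d, ipw t u v = v.coeff (l, k)) :
    ∃ g ∈ rect 0 N c d, (∀ u ∈ S, ipw t u g = 0) ∧
      ∀ y, (∀ u ∈ S, ipw t u y = 0) → ipw t (x - g) y = 0 := by
  set A := (S.map (toH ht)).topologicalClosure with hA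
  set x₁ := A.starProjection (toH ht x) with hx₁
  set x₀ := toH ht x - x₁ with hx₀
  have hx₁A : x₁ ∈ A := A.starProjection_apply_mem _
  have hx₀A : ∀ a ∈ A, inner ℂ a x₀ = 0 := fun a ha =>
    (A.mem_orthogonal _).1 (A.sub_starProjection_mem_orthogonal _) a ha
  have hB : x₀ ∈ ((strip N c d).map (toH ht)).topologicalClosure := by
    refine sub_mem (Submodule.le_topologicalClosure _ ⟨x, hx, rfl⟩) ?_
    exact Submodule.topologicalClosure_mono (Submodule.map_mono hS) hx₁A
  have hSA : ∀ u ∈ S, toH ht u ∈ A := fun u hu => Submodule.le_topologicalClosure _ ⟨u, hu, rfl⟩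
  -- For weight 1/t, pairing with t z^l w^k is the Fourier coefficient (`ipw_mul_mono_left`), so φ
  -- is the coefficient function of the Hilbert space element x₀.
  set φ : ℤ → ℤ → ℂ := fun l k => inner ℂ (toH ht (t * mono l k)) x₀ with hφ
  have hφ0 : ∀ l k : ℤ, ¬(0 ≤ l ∧ l ≤ N ∧ c ≤ k ∧ k ≤ d) → φ l k = 0 := by
    intro l k hlk
    by_cases h1 : l ≤ N ∧ c ≤ k ∧ k ≤ d
    -- For l ≤ -1 the coefficient functional on the closed strip is represented by an element of S,
    -- and x₀ is orthogonal to S.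
    · obtain ⟨u, hu, huv⟩ := hT l k (by omega) h1.2.1 h1.2.2
      have h2 : inner ℂ (toH ht (t * mono l k) - toH ht u) x₀ = 0 := by
        refine inner_eq_zero_of_mem_closure (S := strip N c d) (fun v hv => ?_) hB
        rw [inner_sub_left, inner_toH, inner_toH, huv v hv, ipw_mul_mono_left ht, sub_self]
      rwa [inner_sub_left, hx₀A _ (hSA u hu), sub_zero] at h2
    · refine inner_eq_zero_of_mem_closure (S := strip N c d) (fun v hv => ?_) hB
      rw [inner_toH, ipw_mul_mono_left ht, coeff_eq_zero_of_mem_strip hv h1]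
  set g : Laurent := ∑ l ∈ Finset.Icc 0 N, ∑ k ∈ Finset.Icc c d, φ l k • mono l k with hg
  have hgr : g ∈ rect 0 N c d := by
    refine Submodule.sum_mem _ fun l hl => Submodule.sum_mem _ fun k hk =>
      Submodule.smul_mem _ _ ?_
    rw [Finset.mem_Icc] at hl hk
    exact mono_mem_rect hl.1 hl.2 hk.1 hk.2
  have hgc : ∀ l k : ℤ, g.coeff (l, k) = φ l k := by
    intro l k
    by_cases h1 : 0 ≤ l ∧ l ≤ N ∧ c ≤ k ∧ k ≤ d
    · have h2 : g.coeff (l, k) = ∑ l' ∈ Finset.Icc 0 N, ∑ k' ∈ Finset.Icc c d,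
          if l' = l ∧ k' = k then φ l' k' else 0 := by
        simp [hg, mono, Finsupp.single_apply]
      rw [h2, Finset.sum_eq_single l, Finset.sum_eq_single k]
      · simp
      · intro k' _ hk'
        rw [if_neg fun h => hk' h.2]
      · intro h
        exact absurd (Finset.mem_Icc.2 ⟨h1.2.2.1, h1.2.2.2⟩) h
      · intro l' _ hl'
        exact Finset.sum_eq_zero fun k' _ => if_neg fun h => hl' h.1
      · intro h
        exact absurd (Finset.mem_Icc.2 ⟨h1.1, h1.2.1⟩) h
    · rw [hφ0 l k h1, mem_rect_iff.1 hgr l k h1]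
  -- Only finitely many coefficients of x₀ survive; an element is determined by its coefficients, so
  -- x₀ is the polynomial g.
  have hgx : toH ht g = x₀ := by
    refine sub_eq_zero.1 (eq_zero_of_inner_mul ht fun v => ?_)
    rw [inner_sub_right, inner_toH, sub_eq_zero]
    induction v using laurent_induction with
    | zero => rw [mul_zero, ipw_zero_left ht, map_zero, inner_zero_left]
    | add f g hf hg => rw [mul_add, ipw_add_left ht, map_add, inner_add_left, hf, hg]
    | mono r l k =>
      rw [mul_smul_comm, ipw_smul_left ht, map_smul, inner_smul_left, ipw_mul_mono_left ht, hgc]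
  refine ⟨g, hgr, fun u hu => ?_, fun y hy => ?_⟩
  · rw [← inner_toH ht, hgx, hx₀A _ (hSA u hu)]
  · rw [← inner_toH ht, map_sub, hgx, hx₀, sub_sub_cancel, ← inner_conj_symm,
      inner_eq_zero_of_mem_closure (fun u hu => ?_) hx₁A, map_zero]
    rw [inner_toH]
    exact ipw_eq_zero_symm ht (hy u hu)

/-! ### A split pair from a factorization -/

/-- The part of `dualPoly` of positive degree in `w`, modulo multiples of `p`. -/
def dualRest (p : Laurent) (m k : ℕ) : Laurent := dualPoly p m k - p * starRefl (row k p)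

theorem dualRest_add (p : Laurent) (m k : ℕ) :
    dualPoly p m k = dualRest p m k + p * starRefl (row k p) := by
  rw [dualRest, sub_add_cancel]

/-- The span of the `z ^ j * dualRest p m k` with `j ≤ -1`. -/
def restSpan (p : Laurent) (m : ℕ) : Submodule ℂ Laurent :=
  Submodule.span ℂ {f | ∃ (j : ℤ) (k : ℕ), j ≤ -1 ∧ k ≤ m ∧ f = mono j 0 * dualRest p m k}

/-- The span of the `z ^ j * p` and `z ^ j * dualRest p m k` with `j ≤ -1`. -/
def negSpan (p : Laurent) (m : ℕ) : Submodule ℂ Laurent :=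
  Submodule.span ℂ {f | ∃ j : ℤ, j ≤ -1 ∧ f = mono j 0 * p} ⊔ restSpan p m

section

variable {t p : Laurent} {n m : ℕ}

theorem restSpan_le_negSpan : restSpan p m ≤ negSpan p m := le_sup_right

theorem mono_mul_mem_negSpan {j : ℤ} (hj : j ≤ -1) : mono j 0 * p ∈ negSpan p m :=
  Submodule.mem_sup_left (Submodule.subset_span ⟨j, hj, rfl⟩)

theorem mono_mul_dualRest_mem {j : ℤ} {k : ℕ} (hj : j ≤ -1) (hk : k ≤ m) :
    mono j 0 * dualRest p m k ∈ restSpan p m := Submodule.subset_span ⟨j, k, hj, hk, rfl⟩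

/-- Induction on the generators of `negSpan`. -/
theorem negSpan_le {V : Submodule ℂ Laurent} (h1 : ∀ j : ℤ, j ≤ -1 → mono j 0 * p ∈ V)
    (h2 : restSpan p m ≤ V) : negSpan p m ≤ V := by
  refine sup_le (Submodule.span_le.2 ?_) h2
  rintro _ ⟨j, hj, rfl⟩
  exact h1 j hj

theorem restSpan_le {V : Submodule ℂ Laurent}
    (h : ∀ (j : ℤ) (k : ℕ), j ≤ -1 → k ≤ m → mono j 0 * dualRest p m k ∈ V) :
    restSpan p m ≤ V := by
  refine Submodule.span_le.2 ?_
  rintro _ ⟨j, k, hj, hk, rfl⟩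
  exact h j k hj hk

theorem mono_neg_mul_mem_negSpan {u : Laurent} (hu : u ∈ negSpan p m) :
    mono (-1) 0 * u ∈ negSpan p m := by
  have h : negSpan p m ≤ (negSpan p m).comap (mulMono (-1) 0) := by
    refine negSpan_le (fun j hj => ?_) (restSpan_le fun j k hj hk => ?_)
    · rw [Submodule.mem_comap, mulMono_apply, mono_mul_mono_mul, add_zero]
      exact mono_mul_mem_negSpan (by omega)
    · rw [Submodule.mem_comap, mulMono_apply, mono_mul_mono_mul, add_zero]
      exact restSpan_le_negSpan (mono_mul_dualRest_mem (by omega) hk)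
  exact h hu

/-! ### Orthogonality relations for L and the construction of the split pair. -/

namespace Factors

variable (h : Factors t p n m)
include h

theorem restSpan_le_strip : restSpan p m ≤ strip (n - 1) 1 m :=
  restSpan_le fun j k hj _ => rect_le_strip (by omega) (by omega) (by omega)
    ((mono_mul_mem_rect j 0).2 (dualPoly_sub_mem h.mem k))

theorem negSpan_le_strip : negSpan p m ≤ strip (n - 1) 0 m := by
  refine negSpan_le (fun j hj => rect_le_strip (by omega) (by omega) (by omega)
    ((mono_mul_mem_rect j 0).2 h.mem)) (h.restSpan_le_strip.trans ?_)
  refine Submodule.span_mono ?_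
  rintro _ ⟨s, t, h1, h2, h3, rfl⟩
  exact ⟨s, t, h1, by omega, h3, rfl⟩

theorem ipw_mono_mul_dualPoly {N : ℤ} {k : ℕ} (hk : k ≤ m) (l : ℤ) {v : Laurent}
    (hv : v ∈ strip N 0 m) : ipw t (mono l 0 * dualPoly p m k) v = v.coeff (l, k) := by
  have ht := h.torusPos
  induction hv using Submodule.span_induction with
  | zero => rw [ipw_zero_right]; simp
  | add x y _ _ hx hy => rw [ipw_add_right ht, hx, hy]; simp
  | smul r x _ hx => rw [ipw_smul_right, hx]; simp
  | mem x hx =>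
    obtain ⟨s, i, h1, h2, h3, rfl⟩ := hx
    lift i to ℕ using h2
    rw [← ipw_mono_neg_mul, mul_mono, neg_zero, zero_add,
      h.ipw_dualPoly k i hk (by exact_mod_cast h3)]
    simp only [mono, AddMonoidAlgebra.coeff_single, Finsupp.single_apply, Prod.mk.injEq,
      Nat.cast_inj]
    split_ifs <;> first | rfl | omega

theorem ipw_mono_mul_mul {a b N : ℤ} {r : Laurent} (hr : r ∈ rect a b 0 0) (l : ℤ) {v : Laurent}
    (hv : v ∈ strip N 1 m) : ipw t (mono l 0 * (p * r)) v = 0 := by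
  have ht := h.torusPos
  induction hr using Submodule.span_induction with
  | zero => rw [mul_zero, mul_zero, ipw_zero_left ht]
  | add x y _ _ hx hy => rw [mul_add, mul_add, ipw_add_left ht, hx, hy, add_zero]
  | smul c x _ hx => rw [mul_smul_comm, mul_smul_comm, ipw_smul_left ht, hx, mul_zero]
  | mem x hx =>
    obtain ⟨s, i, _, _, hi, hi', rfl⟩ := hx
    obtain rfl : i = 0 := le_antisymm hi' hi
    rw [mul_comm p, mono_mul_mono_mul, add_zero]
    induction hv using Submodule.span_induction with
    | zero => exact ipw_zero_right _
    | add x y _ _ hx hy => rw [ipw_add_right ht, hx, hy, add_zero]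
    | smul c x _ hx => rw [ipw_smul_right, hx, mul_zero]
    | mem x hx =>
      obtain ⟨s', i, _, hi, _, rfl⟩ := hx
      rw [← ipw_mono_neg_mul, mul_mono, h.ipw_p_mono _ _ (by omega)]

/-- The term p conj p_k dropped from `dualPoly` is orthogonal to positive w-degrees, so on that part
of the strip `dualRest` still represents the coefficient. -/
theorem ipw_mono_mul_dualRest {N : ℤ} {k : ℕ} (hk : k ≤ m) (l : ℤ) {v : Laurent}
    (hv : v ∈ strip N 1 m) : ipw t (mono l 0 * dualRest p m k) v = v.coeff (l, k) := by
  have hv0 : v ∈ strip N 0 m := by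
    refine Submodule.span_mono ?_ hv
    rintro _ ⟨s, t, h1, h2, h3, rfl⟩
    exact ⟨s, t, h1, by omega, h3, rfl⟩
  have hr := starRefl_mem_rect (row_mem h.mem k)
  rw [neg_zero] at hr
  have h1 := h.ipw_mono_mul_mul hr l hv
  have h2 := h.ipw_mono_mul_dualPoly hk l hv0
  rw [dualRest_add, mul_add,
    ipw_add_left h.torusPos, h1, add_zero] at h2
  exact h2

/-- The factor conj p_k has only nonpositive powers of z, so z^l p conj p_k is a combination of z^j
p with j ≤ l. -/
theorem mono_mul_dualPoly_mem {l : ℤ} (hl : l ≤ -1) {k : ℕ} (hk : k ≤ m) :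
    mono l 0 * dualPoly p m k ∈ negSpan p m := by
  rw [dualRest_add, mul_add]
  refine add_mem (restSpan_le_negSpan (mono_mul_dualRest_mem hl hk)) ?_
  have hr := starRefl_mem_rect (row_mem h.mem k)
  rw [neg_zero] at hr
  generalize starRefl (row k p) = r at hr
  induction hr using Submodule.span_induction with
  | zero => simp
  | add x y _ _ hx hy => rw [mul_add, mul_add]; exact add_mem hx hy
  | smul c x _ hx => rw [mul_smul_comm, mul_smul_comm]; exact Submodule.smul_mem _ _ hx
  | mem x hx =>
    obtain ⟨s, i, _, hs, hi, hi', rfl⟩ := hx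
    obtain rfl : i = 0 := le_antisymm hi' hi
    rw [mul_comm p, mono_mul_mono_mul, add_zero]
    exact mono_mul_mem_negSpan (by omega)

theorem ipw_negSpan_mono {l i : ℤ} (hl : 0 ≤ l) (hi : 1 ≤ i) (hi' : i ≤ m) {u : Laurent}
    (hu : u ∈ negSpan p m) : ipw t u (mono l i) = 0 := by
  have ht := h.torusPos
  have hs : mono l i ∈ strip l 1 m := Submodule.subset_span ⟨l, i, le_rfl, hi, hi', rfl⟩
  have h1 : negSpan p m ≤ wOminus ht ⊤ (Submodule.span ℂ {mono l i}) := by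
    have h2 : ∀ f, ipw t f (mono l i) = 0 →
        f ∈ wOminus ht ⊤ (Submodule.span ℂ {mono l i}) := by
      intro f hf
      refine ⟨trivial, fun g hg => ?_⟩
      obtain ⟨c, rfl⟩ := Submodule.mem_span_singleton.1 hg
      rw [ipw_smul_left ht, ipw_eq_zero_symm ht hf, mul_zero]
    refine negSpan_le (fun j _ => h2 _ ?_) (restSpan_le fun j k hj hk => h2 _ ?_)
    · have := h.ipw_mono_mul_mul (r := mono 0 0)
        (mono_mem_rect (a := 0) (b := 0) le_rfl le_rfl le_rfl le_rfl) j hs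
      rwa [mul_comm p, mono_zero_mul] at this
    · rw [h.ipw_mono_mul_dualRest hk j hs]
      simp only [mono, AddMonoidAlgebra.coeff_single, Finsupp.single_apply, Prod.mk.injEq]
      exact if_neg (by omega)
  exact ipw_wOminus_left (h1 hu) (Submodule.mem_span_singleton_self _)

/-- K₂ is the part of 𝓔¹_{n-1,m} orthogonal to L, and K₁ the part orthogonal to L^⊥. K₁ ⟂ z K₂
because z⁻¹ L ⊆ L keeps z K₂ inside L^⊥; K₁ ⊆ 𝓔¹_{n,m} because L^⊥ contains z^l w^i for l ≥ 0, 1 ≤ i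
≤ m. -/
theorem exists_splitPair (ht : TorusPos t) : ∃ K₁ K₂, SplitPair ht n m K₁ K₂ := by
  set L := negSpan p m
  set P := wOminus ht ⊤ L with hP
  have hmem : ∀ {f g}, f ∈ wOminus ht (eSpace ht (n - 1) m) P → (∀ u ∈ L, ipw t u g = 0) →
      ipw t f g = 0 := fun hf hg => ipw_wOminus_left hf ⟨trivial, hg⟩
  refine ⟨wOminus ht (eSpace ht (n - 1) m) P, wOminus ht (eSpace ht (n - 1) m) L, ?_, ?_, ?_, ?_,
    ?_⟩
  · refine le_antisymm (fun f hf => ?_) (sup_le wOminus_le wOminus_le)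
    obtain ⟨g, hg, hgL, hfg⟩ := exists_orthogonal_component ht h.negSpan_le_strip
      (rect_le_strip le_rfl le_rfl le_rfl hf.1) fun l k hl hk hk' => by
        lift k to ℕ using hk
        have hk' : k ≤ m := by exact_mod_cast hk'
        exact ⟨_, h.mono_mul_dualPoly_mem hl hk', fun v hv => h.ipw_mono_mul_dualPoly hk' l hv⟩
    -- The removed part f - g lies in the closure of L, hence is orthogonal to w 𝓟_{n-1,m-1}, as f
    -- is; so g stays in 𝓔¹_{n-1,m}.
    have hgE : g ∈ eSpace ht (n - 1) m := by
      refine ⟨hg, fun y hy => ipw_eq_zero_symm ht ?_⟩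
      have h1 : ipw t (f - g) y = 0 := ipw_rect_right ht (fun l k hl _ hk hk' =>
        hfg _ fun u hu => h.ipw_negSpan_mono hl hk hk' hu) hy
      have h2 := ipw_wOminus_left hf hy
      rw [← sub_add_cancel f g, ipw_add_left ht, h1, zero_add] at h2
      exact h2
    rw [← sub_add_cancel f g]
    exact Submodule.add_mem_sup
      ⟨sub_mem hf hgE, fun y hy => ipw_eq_zero_symm ht (hfg y hy.2)⟩ ⟨hgE, hgL⟩
  · exact fun f hf g hg => hmem hf hg.2
  · rintro f hf _ ⟨g, hg, rfl⟩
    refine hmem hf fun u hu => ?_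
    have h1 := hg.2 _ (mono_neg_mul_mem_negSpan hu)
    have h2 := ipw_mono_neg_mul (s := t) (-1) 0 u g
    rw [neg_neg, neg_zero] at h2
    rw [mulMono_apply, h2, h1]
  · intro f hf
    refine ⟨rect_mono le_rfl (by omega) le_rfl le_rfl hf.1.1, fun y hy => ?_⟩
    exact ipw_eq_zero_symm ht (ipw_rect_right ht (fun l k hl _ hk hk' =>
      hmem hf fun u hu => h.ipw_negSpan_mono hl hk hk' hu) hy)
  · rintro _ ⟨f, hf, rfl⟩
    refine ⟨rect_mono (by omega) (by omega) (by omega) (by omega)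
      ((mono_mul_mem_rect 1 0).2 hf.1.1), fun y hy => ipw_eq_zero_symm ht ?_⟩
    refine ipw_rect_right ht (fun l i hl hl' hi hi' => ?_) hy
    rw [mulMono_apply, ← ipw_mono_neg_mul, mul_mono, neg_zero, zero_add]
    rcases hl.eq_or_lt with rfl | hl
    -- Only f ⟂ z⁻¹ w^i is new. Off `restSpan`, which f ∈ K₂ is orthogonal to, z⁻¹ w^i projects to
    -- an element of w 𝓟_{n-1,m-1}, and f ∈ 𝓔¹_{n-1,m} is orthogonal to that. Use of `restSpan`
    -- instead of L keeps the w-degrees at least 1.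
    · obtain ⟨g, hg, -, hxg⟩ := exists_orthogonal_component ht (x := mono (-1) i)
        h.restSpan_le_strip (Submodule.subset_span ⟨-1, i, by omega, hi, hi', rfl⟩)
        fun l k hl hk hk' => by
          lift k to ℕ using by omega
          have hk' : k ≤ m := by exact_mod_cast hk'
          exact ⟨_, mono_mul_dualRest_mem hl hk', fun v hv => h.ipw_mono_mul_dualRest hk' l hv⟩
      have h1 := hxg f fun u hu => hf.2 u (restSpan_le_negSpan hu)
      have h2 := hf.1.2 g hg
      have h3 : ipw t (mono (-1) i) f = 0 := by
        rw [← sub_add_cancel (mono (-1) i) g, ipw_add_left ht, h1, h2, add_zero]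
      simpa using ipw_eq_zero_symm ht h3
    · exact ipw_wOminus_left hf.1 (mono_mem_rect (by omega) (by omega) hi hi')

end Factors

end

/-! ### The linear form of a weight -/

section

variable {t : Laurent} {n m : ℕ}

theorem momentForm_apply (ht : TorusPos t) (q : laurentSpace n m) :
    momentForm n m t q = torusAverage fun z w => evalAt q z w / evalAt t z w := by
  rw [momentForm, LinearMap.domRestrict_apply]
  generalize (q : Laurent) = q
  have hc : ∀ f : Laurent, TorusCont fun z w => evalAt f z w / evalAt t z w := fun f =>
    (torusCont_evalAt f).div (torusCont_evalAt t) fun _ _ => ht.ne_zero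
  induction q using laurent_induction with
  | zero =>
    rw [map_zero, torusAverage_congr (G := fun z w => 0 * 0) fun z w _ _ => by
      simp [evalAt_zero], torusAverage_smul, zero_mul]
  | add f g hf hg =>
    rw [map_add, hf, hg, ← torusAverage_add (hc f) (hc g)]
    exact torusAverage_congr fun z w _ _ => by rw [evalAt_add, add_div]
  | mono c i j =>
    rw [map_smul, smul_eq_mul, torusAverage_congr (G := fun z w =>
      c * (z ^ i * w ^ j / evalAt t z w)) fun z w _ _ => by
        rw [evalAt_smul, evalAt_mono, mul_div_assoc], torusAverage_smul]
    simp [mono]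

/-- The arguments are exchanged because `ip` is linear in the first and `ipw` in the second. -/
theorem ip_momentForm (ht : TorusPos t) (f g : polySpace n m) :
    ip (momentForm n m t) f g = ipw t g f := by
  rw [ip, momentForm_apply ht]
  refine torusAverage_congr fun z w hz hw => ?_
  rw [evalAt_mul _ _ (ne_zero_of_norm_one hz) (ne_zero_of_norm_one hw), evalAt_starRefl _ hz hw,
    mul_comm]

theorem isPositive_momentForm (ht : TorusPos t) : IsPositive (momentForm n m t) := by
  intro f hf
  rw [ip_momentForm ht]
  refine lt_of_le_of_ne (ipw_self_nonneg ht _) fun h => hf ?_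
  exact Subtype.ext (eq_zero_of_ipw_self ht h.symm)

theorem rect_le_polySpace {k : ℤ} (hk : k ≤ n) {c : ℤ} (hc : 0 ≤ c) :
    rect 0 k c m ≤ polySpace n m := rect_mono (c' := 0) le_rfl hk hc le_rfl

theorem mem_E1_iff (ht : TorusPos t) {k : ℤ} (hk : k ≤ n) (f : polySpace n m) :
    f ∈ E1 (momentForm n m t) k m ↔ (f : Laurent) ∈ eSpace ht k m := by
  have h1 : times (mono 0 1) (polySpace k (m - 1)) = rect 0 k 1 m := by
    have := map_rect 0 1 0 k 0 (m - 1)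
    rw [add_zero, add_zero, zero_add, sub_add_cancel] at this
    exact this
  rw [E1, h1]
  refine and_congr Iff.rfl ⟨fun h g hg => ?_, fun h g hg => ?_⟩
  · rw [← h ⟨g, rect_le_polySpace hk zero_le_one hg⟩ hg, ip_momentForm ht]
  · rw [ip_momentForm ht]
    exact h _ hg

theorem map_E1 (ht : TorusPos t) {k : ℤ} (hk : k ≤ n) :
    (E1 (momentForm n m t) k m).map (polySpace n m).subtype = eSpace ht k m := by
  ext f
  constructor
  · rintro ⟨f, hf, rfl⟩
    exact (mem_E1_iff ht hk f).1 hf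
  · intro hf
    exact ⟨⟨f, rect_le_polySpace hk le_rfl hf.1⟩, (mem_E1_iff ht hk _).2 hf, rfl⟩

theorem mul_mem_polySpace (ht : TorusPos t) {f : Laurent} (hf : f ∈ eSpace ht (n - 1) m) :
    mono 1 0 * f ∈ polySpace n m :=
  rect_mono (by omega) (by omega) (by omega) (by omega) ((mono_mul_mem_rect 1 0).2 hf.1)

theorem splitPair_of_splitShiftCondition (ht : TorusPos t)
    (h : SplitShiftCondition (momentForm n m t)) : ∃ K₁ K₂, SplitPair ht n m K₁ K₂ := by
  obtain ⟨K₁, K₂, ⟨hsup, -, horth⟩, hshift, hl, hr⟩ := h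
  have hE := map_E1 (n := n) (m := m) ht (k := n - 1) (by omega)
  have hK₂ : ∀ g ∈ K₂, (g : Laurent) ∈ eSpace ht (n - 1) m := fun g hg =>
    (mem_E1_iff ht (by omega) g).1 (hsup ▸ Submodule.mem_sup_right hg)
  refine ⟨K₁.map (polySpace n m).subtype, K₂.map (polySpace n m).subtype, ?_, ?_, ?_, ?_, ?_⟩
  · rw [← hE, hsup, Submodule.map_sup]
  · rintro _ ⟨f, hf, rfl⟩ _ ⟨g, hg, rfl⟩
    refine ipw_eq_zero_symm ht ?_
    have := horth f hf g hg
    rwa [ip_momentForm ht] at this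
  · rintro _ ⟨f, hf, rfl⟩ _ ⟨_, ⟨g, hg, rfl⟩, rfl⟩
    refine ipw_eq_zero_symm ht ?_
    have := hshift f hf ⟨_, mul_mem_polySpace ht (hK₂ g hg)⟩ ⟨_, ⟨g, hg, rfl⟩, rfl⟩
    rwa [ip_momentForm ht] at this
  · rintro _ ⟨f, hf, rfl⟩
    exact (mem_E1_iff ht le_rfl f).1 (hl hf)
  · rintro _ ⟨_, ⟨g, hg, rfl⟩, rfl⟩
    have h1 := mul_mem_polySpace ht (hK₂ g hg)
    exact (mem_E1_iff ht le_rfl ⟨_, h1⟩).1 (hr ⟨_, ⟨g, hg, rfl⟩, rfl⟩)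

theorem SplitPair.splitShiftCondition {ht : TorusPos t} {K₁ K₂ : Submodule ℂ Laurent}
    (h : SplitPair ht n m K₁ K₂) : SplitShiftCondition (momentForm n m t) := by
  have hle : ∀ {K : Submodule ℂ Laurent}, K ≤ eSpace ht (n - 1) m →
      (inside n m K).map (polySpace n m).subtype = K := fun hK => by
    rw [inside, Submodule.map_comap_subtype]
    exact inf_eq_right.2 (hK.trans fun f hf => rect_le_polySpace (by omega) le_rfl hf.1)
  have horth : Orth (momentForm n m t) (inside n m K₁) (inside n m K₂) := fun f hf g hg => by
    rw [ip_momentForm ht]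
    exact ipw_eq_zero_symm ht (h.orth f hf g hg)
  have hz : ∀ g ∈ zTimes (inside n m K₂), (g : Laurent) ∈ K₂.map (mulMono 1 0) := by
    intro g hg
    rw [zTimes, hle h.right_le'] at hg
    exact hg
  refine ⟨inside n m K₁, inside n m K₂, ⟨?_, ?_, horth⟩, fun f hf g hg => ?_, fun f hf => ?_,
    fun f hf => ?_⟩
  · refine Submodule.map_injective_of_injective (polySpace n m).injective_subtype ?_
    rw [map_E1 ht (by omega), Submodule.map_sup, hle h.left_le', hle h.right_le', h.sup]
  · rw [Submodule.disjoint_def]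
    intro f hf hg
    have := horth f hf f hg
    rw [ip_momentForm ht] at this
    exact Subtype.ext (eq_zero_of_ipw_self ht this)
  · rw [ip_momentForm ht]
    exact ipw_eq_zero_symm ht (h.orth_shift f hf g (hz g hg))
  · exact (mem_E1_iff ht le_rfl f).2 (h.left_le hf)
  · exact (mem_E1_iff ht le_rfl f).2 (h.right_le (hz f hf))

end

/-! ### Polynomials -/

theorem exists_laurent_of_mvPolynomial {n m : ℕ} (p : MvPolynomial (Fin 2) ℂ)
    (h0 : p.degreeOf 0 ≤ n) (h1 : p.degreeOf 1 ≤ m) :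
    ∃ q ∈ rect 0 n 0 m, ∀ z w, evalAt q z w = MvPolynomial.eval ![z, w] p := by
  refine ⟨∑ d ∈ p.support, p.coeff d • mono (d 0) (d 1), Submodule.sum_mem _ fun d hd =>
    Submodule.smul_mem _ _ (mono_mem_rect (by omega) ?_ (by omega) ?_), fun z w => ?_⟩
  · exact_mod_cast (MvPolynomial.monomial_le_degreeOf 0 hd).trans h0
  · exact_mod_cast (MvPolynomial.monomial_le_degreeOf 1 hd).trans h1
  · rw [MvPolynomial.eval_eq', evalAt_eq_evLin, map_sum]
    refine Finset.sum_congr rfl fun d _ => ?_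
    rw [map_smul, ← evalAt_eq_evLin, evalAt_mono]
    simp

theorem exists_mvPolynomial_of_laurent {n m : ℕ} {q : Laurent} (hq : q ∈ rect 0 n 0 m) :
    ∃ p : MvPolynomial (Fin 2) ℂ, (p.degreeOf 0 ≤ n ∧ p.degreeOf 1 ≤ m) ∧
      ∀ z w, evalAt q z w = MvPolynomial.eval ![z, w] p := by
  induction hq using Submodule.span_induction with
  | zero => exact ⟨0, by simp, fun z w => by simp [evalAt_zero]⟩
  | add x y _ _ hx hy =>
    obtain ⟨a, ⟨ha0, ha1⟩, ha⟩ := hx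
    obtain ⟨b, ⟨hb0, hb1⟩, hb⟩ := hy
    exact ⟨a + b, ⟨(MvPolynomial.degreeOf_add_le _ _ _).trans (max_le ha0 hb0),
      (MvPolynomial.degreeOf_add_le _ _ _).trans (max_le ha1 hb1)⟩,
      fun z w => by rw [evalAt_add, ha, hb, map_add]⟩
  | smul r x _ hx =>
    obtain ⟨a, ⟨ha0, ha1⟩, ha⟩ := hx
    exact ⟨MvPolynomial.C r * a, ⟨(MvPolynomial.degreeOf_C_mul_le _ _ _).trans ha0,
      (MvPolynomial.degreeOf_C_mul_le _ _ _).trans ha1⟩,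
      fun z w => by rw [evalAt_smul, ha, map_mul, MvPolynomial.eval_C]⟩
  | mem x hx =>
    obtain ⟨s, k, h1, h2, h3, h4, rfl⟩ := hx
    lift s to ℕ using h1
    lift k to ℕ using h3
    have h2 : s ≤ n := by exact_mod_cast h2
    have h4 : k ≤ m := by exact_mod_cast h4
    have hX : ∀ i j : Fin 2, (MvPolynomial.X j : MvPolynomial (Fin 2) ℂ).degreeOf i =
        if i = j then 1 else 0 := fun i j => MvPolynomial.degreeOf_X i j
    refine ⟨MvPolynomial.X 0 ^ s * MvPolynomial.X 1 ^ k, ⟨?_, ?_⟩, fun z w => ?_⟩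
    · refine (MvPolynomial.degreeOf_mul_le _ _ _).trans ((add_le_add
        (MvPolynomial.degreeOf_pow_le _ _ _) (MvPolynomial.degreeOf_pow_le _ _ _)).trans ?_)
      simpa [hX] using h2
    · refine (MvPolynomial.degreeOf_mul_le _ _ _).trans ((add_le_add
        (MvPolynomial.degreeOf_pow_le _ _ _) (MvPolynomial.degreeOf_pow_le _ _ _)).trans ?_)
      simpa [hX] using h4
    · rw [evalAt_mono]
      simp

theorem exists_factors_iff {t : Laurent} {n m : ℕ} : (∃ p, Factors t p n m) ↔
    ∃ p : MvPolynomial (Fin 2) ℂ,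
      (p.degreeOf 0 ≤ n ∧ p.degreeOf 1 ≤ m) ∧
      (∀ z w : ℂ, ‖z‖ = 1 → ‖w‖ ≤ 1 → MvPolynomial.eval ![z, w] p ≠ 0) ∧
      (∀ z w : ℂ, ‖z‖ = 1 → ‖w‖ = 1 →
        evalAt t z w = ((‖MvPolynomial.eval ![z, w] p‖ ^ 2 : ℝ) : ℂ)) := by
  constructor
  · rintro ⟨q, hq⟩
    obtain ⟨p, hp, hqp⟩ := exists_mvPolynomial_of_laurent hq.mem
    refine ⟨p, hp, fun z w hz hw => hqp z w ▸ hq.ne_zero z w hz hw, fun z w hz hw => ?_⟩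
    rw [hq.eq z w hz hw, Complex.mul_conj, Complex.normSq_eq_norm_sq, hqp]
  · rintro ⟨p, hp, h0, h1⟩
    obtain ⟨q, hq, hqp⟩ := exists_laurent_of_mvPolynomial p hp.1 hp.2
    refine ⟨q, hq, fun z w hz hw => hqp z w ▸ h0 z w hz hw, fun z w hz hw => ?_⟩
    rw [h1 z w hz hw, Complex.mul_conj, Complex.normSq_eq_norm_sq, hqp]

theorem laurentSpace_eq_rect (n m : ℕ) : laurentSpace n m = rect (-n) n (-m) m := by
  rw [laurentSpace, rect]
  simp only [abs_le, and_assoc]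

end SplitShift
end

theorem mainTheorem6 (n m : ℕ) (t : SplitShift.Laurent) (ht : t ∈ SplitShift.laurentSpace n m)
    (hpos : ∀ z w : ℂ, ‖z‖ = 1 → ‖w‖ = 1 → 0 < SplitShift.evalAt t z w) :
    SplitShift.IsPositive (SplitShift.momentForm n m t) ∧
    ((∃ p : MvPolynomial (Fin 2) ℂ,
        (p.degreeOf 0 ≤ n ∧ p.degreeOf 1 ≤ m) ∧
        (∀ z w : ℂ, ‖z‖ = 1 → ‖w‖ ≤ 1 → MvPolynomial.eval ![z, w] p ≠ 0) ∧
        (∀ z w : ℂ, ‖z‖ = 1 → ‖w‖ = 1 →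
          SplitShift.evalAt t z w = ((‖MvPolynomial.eval ![z, w] p‖ ^ 2 : ℝ) : ℂ))) ↔
      SplitShift.SplitShiftCondition (SplitShift.momentForm n m t)) := by
  have htp : SplitShift.TorusPos t := hpos
  rw [SplitShift.laurentSpace_eq_rect] at ht
  refine ⟨SplitShift.isPositive_momentForm htp, ?_⟩
  rw [← SplitShift.exists_factors_iff]
  constructor
  · rintro ⟨p, hp⟩
    obtain ⟨K₁, K₂, h⟩ := hp.exists_splitPair htp
    exact h.splitShiftCondition
  · intro h
    obtain ⟨K₁, K₂, h⟩ := SplitShift.splitPair_of_splitShiftCondition htp h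
    exact h.exists_factors ht
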